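/- For a field $K$ and $f,g,h\in K[x_1,\ldots,x_n]^n$ write $f=g\circ h$ if $f_i=g_i(h_1,\ldots,h_n)$ for all $i$; such a decomposition is called degree proper if $d_f=d_g\,d_h$, where the degree of a tuple is the maximum of the total degrees of its components. An algorithm is a probabilistic program for an algebraic random access machine over $K$: it adds, subtracts and compares natural numbers (used for addressing and control), performs field operations and equality tests in $K$, and draws random elements of $K$, each at unit cost; the program depends neither on $K$ nor on $n$. Forms are given by the tables of their coefficients. Theorem. There are one such program and polynomials $T,Q\in\mathbb{N}[z]$ with the following properties for all $n\ge 5$. (1) Let $K$ be any field and let $f\in K[x_1,\ldots,x_n]^n$ consist of homogeneous polynomials of degree four. On input $f$, whatever its random choices are, the program halts after at most $T(n)$ steps. It then either reports failure or outputs $g,h\in K[x_1,\ldots,x_n]^n$ consisting of quadratic forms such that $f=g\circ h$ is a degree proper decomposition. (2) Let $K$ be of characteristic zero. There is a proper algebraic subset $Z$ of the space $K^{n^2(n+1)}$ of the coefficients of pairs $(g,h)$ of $n$-tuples of quadratic forms in $x_1,\ldots,x_n$ (namely the zero set of a nonzero polynomial) such that, for every $(g,h)\notin Z$, the program on input $f=g\circ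 h$ outputs a degree proper decomposition of $f$ into quadratic forms with probability one, i.e. for all values of its (at most $T(n)$) random elements outside the zero set of some nonzero polynomial. (3) Let $K=\mathbb{F}_q$. If the coefficients of the $n$-tuples $g,h$ of quadratic forms and the random elements drawn by the program are independent and uniformly distributed in $\mathbb{F}_q$, then on input $f=g\circ h$ the program outputs a degree proper decomposition of $f$ into quadratic forms with probability at least $1-Q(n)/q$. This is close to one when $q$ is sufficiently large. -/

import Mathlib

universe u

namespace FDP

open MvPolynomial

/-! ## Functional decompositions -/

/-- The functional composition `g ∘ h = (g₁(h₁,…,hₙ), …, gₙ(h₁,…,hₙ))`. -/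
noncomputable def compose {K : Type u} [Field K] {n : ℕ}
    (g h : Fin n → MvPolynomial (Fin n) K) : Fin n → MvPolynomial (Fin n) K :=
  fun i => bind₁ h (g i)

/-- The degree of a tuple of polynomials: the maximum of the total degrees. -/
noncomputable def tupleDegree {K : Type u} [Field K] {n : ℕ}
    (f : Fin n → MvPolynomial (Fin n) K) : ℕ :=
  Finset.univ.sup fun i => (f i).totalDegree

/-- `f = g ∘ h` and `deg f = deg g * deg h`. -/
def IsDegreeProperDecomposition {K : Type u} [Field K] {n : ℕ}
    (f g h : Fin n → MvPolynomial (Fin n) K) : Prop :=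
  f = compose g h ∧ tupleDegree f = tupleDegree g * tupleDegree h

/-- A degree proper decomposition whose two factors consist of quadratic forms.  (The requirement
on the factors rules out the trivial degree proper decompositions of `f` with a linear factor.) -/
def IsQuadraticDecomposition {K : Type u} [Field K] {n : ℕ}
    (f g h : Fin n → MvPolynomial (Fin n) K) : Prop :=
  IsDegreeProperDecomposition f g h ∧
    (∀ i, (g i).IsHomogeneous 2) ∧ (∀ i, (h i).IsHomogeneous 2)

/-- The quadratic form `∑_{a ≤ b} c_{ab} x_a x_b`, the unordered pair `s(a, b)` standing for the
monomial `x_a x_b`. -/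
noncomputable def quadForm {K : Type u} [Field K] {n : ℕ} (c : Sym2 (Fin n) → K) :
    MvPolynomial (Fin n) K :=
  ∑ s : Sym2 (Fin n), C (c s) * (s.map X).mul

/-- Index set of the coefficients of a pair `(g, h)` of `n`-tuples of quadratic forms in `n`
variables: `(0, i, s)` belongs to `g i` and `(1, i, s)` to `h i`.  The coefficient space is
`CoeffIdx n → K`, of dimension `n² (n + 1)`. -/
abbrev CoeffIdx (n : ℕ) : Type := Fin 2 × Fin n × Sym2 (Fin n)

/-- The tuple `g` of the pair `(g, h)` with coefficient vector `v`. -/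
noncomputable def leftFactor {K : Type u} [Field K] {n : ℕ} (v : CoeffIdx n → K) :
    Fin n → MvPolynomial (Fin n) K :=
  fun i => quadForm fun s => v (0, i, s)

/-- The tuple `h` of the pair `(g, h)` with coefficient vector `v`. -/
noncomputable def rightFactor {K : Type u} [Field K] {n : ℕ} (v : CoeffIdx n → K) :
    Fin n → MvPolynomial (Fin n) K :=
  fun i => quadForm fun s => v (1, i, s)

/-! ## Probabilistic algebraic random access machines

Programs are finite objects that do not depend on the field or on the size of the input.  They work
on two kinds of memory cells, one kind holding natural numbers (used for addressing and control) and
one kind holding field elements.  Every cell has an address consisting of the number of an array and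
a list of indices.  Available at unit cost are addition and truncated subtraction of natural
numbers, the four field operations, drawing a random field element, and comparisons.
-/

/-- A reference to a cell, as it occurs in a program: the number of an array, and the numbers of the
natural number variables that hold the indices. -/
structure Ref where
  arr : ℕ
  idx : List ℕ

/-- Elementary instructions; the first argument is the destination. -/
inductive Instr where
  | natConst (d : Ref) (c : ℕ)
  | natAdd (d a b : Ref)
  | natSub (d a b : Ref)
  | fieldZero (d : Ref)
  | fieldOne (d : Ref)
  | fieldAdd (d a b : Ref)
  | fieldSub (d a b : Ref)
  | fieldMul (d a b : Ref)
  | fieldDiv (d a b : Ref)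
  | sample (d : Ref)

/-- Elementary tests. -/
inductive Cond where
  | natEq (a b : Ref)
  | natLt (a b : Ref)
  | fieldEq (a b : Ref)

/-- Programs. -/
inductive Prog where
  | skip
  | instr (c : Instr)
  | seq (p q : Prog)
  | ite (b : Cond) (p q : Prog)
  | loop (b : Cond) (p : Prog)

/-- A state of the machine: the contents of the cells, and the part of the random tape that has not
been read yet. -/
structure State (K : Type u) where
  nat : ℕ → List ℕ → ℕ
  field : ℕ → List ℕ → K
  tape : ℕ → K

namespace State

variable {K : Type u}

/-- The current values of the index variables of a reference; the natural number variable `v` is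
the cell of the array `v` with the empty list of indices. -/
def idx (σ : State K) (r : Ref) : List ℕ :=
  r.idx.map fun v => σ.nat v []

def getNat (σ : State K) (r : Ref) : ℕ :=
  σ.nat r.arr (σ.idx r)

def getField (σ : State K) (r : Ref) : K :=
  σ.field r.arr (σ.idx r)

def setNat (σ : State K) (r : Ref) (x : ℕ) : State K :=
  { σ with nat := fun a l => if a = r.arr ∧ l = σ.idx r then x else σ.nat a l }

def setField (σ : State K) (r : Ref) (x : K) : State K :=
  { σ with field := fun a l => if a = r.arr ∧ l = σ.idx r then x else σ.field a l }

end State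

/-- The effect of an elementary instruction.  Division by zero yields zero. -/
def Instr.exec {K : Type u} [Field K] (σ : State K) : Instr → State K
  | natConst d c => σ.setNat d c
  | natAdd d a b => σ.setNat d (σ.getNat a + σ.getNat b)
  | natSub d a b => σ.setNat d (σ.getNat a - σ.getNat b)
  | fieldZero d => σ.setField d 0
  | fieldOne d => σ.setField d 1
  | fieldAdd d a b => σ.setField d (σ.getField a + σ.getField b)
  | fieldSub d a b => σ.setField d (σ.getField a - σ.getField b)
  | fieldMul d a b => σ.setField d (σ.getField a * σ.getField b)
  | fieldDiv d a b => σ.setField d (σ.getField a / σ.getField b)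
  | sample d => { σ.setField d (σ.tape 0) with tape := fun k => σ.tape (k + 1) }

def Cond.Holds {K : Type u} (σ : State K) : Cond → Prop
  | natEq a b => σ.getNat a = σ.getNat b
  | natLt a b => σ.getNat a < σ.getNat b
  | fieldEq a b => σ.getField a = σ.getField b

/-- `Exec p σ t τ`: the program `p`, started in the state `σ`, halts after `t` steps in the state
`τ`.  Every elementary instruction and every test counts as one step. -/
inductive Exec {K : Type u} [Field K] : Prog → State K → ℕ → State K → Prop
  | skip (σ : State K) : Exec .skip σ 0 σ
  | instr (c : Instr) (σ : State K) : Exec (.instr c) σ 1 (c.exec σ)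
  | seq {p q : Prog} {σ τ υ : State K} {s t : ℕ} :
      Exec p σ s τ → Exec q τ t υ → Exec (.seq p q) σ (s + t) υ
  | iteTrue {b : Cond} {p q : Prog} {σ τ : State K} {t : ℕ} :
      b.Holds σ → Exec p σ t τ → Exec (.ite b p q) σ (t + 1) τ
  | iteFalse {b : Cond} {p q : Prog} {σ τ : State K} {t : ℕ} :
      ¬ b.Holds σ → Exec q σ t τ → Exec (.ite b p q) σ (t + 1) τ
  | loopTrue {b : Cond} {p : Prog} {σ τ υ : State K} {s t : ℕ} :
      b.Holds σ → Exec p σ s τ → Exec (.loop b p) τ t υ → Exec (.loop b p) σ (s + t + 1) υ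
  | loopFalse {b : Cond} {p : Prog} {σ : State K} :
      ¬ b.Holds σ → Exec (.loop b p) σ 1 σ

/-- For a fixed content of the random tape, a program has at most one halting computation. -/
theorem Exec.deterministic {K : Type u} [Field K] {p : Prog} {σ τ τ' : State K} {t t' : ℕ}
    (h : Exec p σ t τ) (h' : Exec p σ t' τ') : t = t' ∧ τ = τ' := by
  induction h generalizing t' τ' with
  | skip σ => cases h'; exact ⟨rfl, rfl⟩
  | instr c σ => cases h'; exact ⟨rfl, rfl⟩
  | seq _ _ ih₁ ih₂ =>
    cases h' with
    | seq a b =>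
      obtain ⟨rfl, rfl⟩ := ih₁ a
      obtain ⟨rfl, rfl⟩ := ih₂ b
      exact ⟨rfl, rfl⟩
  | iteTrue hb _ ih =>
    cases h' with
    | iteTrue _ a => obtain ⟨rfl, rfl⟩ := ih a; exact ⟨rfl, rfl⟩
    | iteFalse hb' _ => exact absurd hb hb'
  | iteFalse hb _ ih =>
    cases h' with
    | iteTrue hb' _ => exact absurd hb' hb
    | iteFalse _ a => obtain ⟨rfl, rfl⟩ := ih a; exact ⟨rfl, rfl⟩
  | loopTrue hb _ _ ih₁ ih₂ =>
    cases h' with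
    | loopTrue _ a b =>
      obtain ⟨rfl, rfl⟩ := ih₁ a
      obtain ⟨rfl, rfl⟩ := ih₂ b
      exact ⟨rfl, rfl⟩
    | loopFalse hb' => exact absurd hb hb'
  | loopFalse hb =>
    cases h' with
    | loopTrue hb' _ _ => exact absurd hb' hb
    | loopFalse _ => exact ⟨rfl, rfl⟩

/-! ## Input and output -/

/-- The coefficient table of a tuple of quartic forms: the entry `[i, a, b, c, d]` is the coefficient
of the monomial `x_a x_b x_c x_d` in `f_i`. -/
noncomputable def quarticTable {K : Type u} [Field K] {n : ℕ}
    (f : Fin n → MvPolynomial (Fin n) K) : List ℕ → K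
  | [i, a, b, c, d] =>
    if hyp : i < n ∧ a < n ∧ b < n ∧ c < n ∧ d < n then
      (f ⟨i, hyp.1⟩).coeff
        (Finsupp.single ⟨a, hyp.2.1⟩ 1 + Finsupp.single ⟨b, hyp.2.2.1⟩ 1 +
          Finsupp.single ⟨c, hyp.2.2.2.1⟩ 1 + Finsupp.single ⟨d, hyp.2.2.2.2⟩ 1)
    else 0
  | _ => 0

/-- The initial state on input `f` with random tape `ρ`: the natural number variable `0` holds `n`,
the field array `0` holds the coefficients of `f`, and all other cells are zero. -/
noncomputable def initState {K : Type u} [Field K] {n : ℕ}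
    (f : Fin n → MvPolynomial (Fin n) K) (ρ : ℕ → K) : State K where
  nat := fun a l => if a = 0 ∧ l = [] then n else 0
  field := fun a l => if a = 0 then quarticTable f l else 0
  tape := ρ

/-- A halting state in which the natural number variable `1` holds `1` announces a decomposition;
every other halting state announces failure. -/
def Announces {K : Type u} (τ : State K) : Prop :=
  τ.nat 1 [] = 1

/-- The tuple of quadratic forms written in the field array `m`: the coefficient of `x_a x_b`,
`a ≤ b`, in the `i`-th form is the entry `[i, a, b]`. -/
noncomputable def readForms {K : Type u} [Field K] (n m : ℕ) (τ : State K) :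
    Fin n → MvPolynomial (Fin n) K :=
  fun i => quadForm fun s => τ.field m [i, s.inf, s.sup]

/-- The left factor `g` in the output is read off from the field array `1`. -/
noncomputable def outputLeft {K : Type u} [Field K] (n : ℕ) (τ : State K) :
    Fin n → MvPolynomial (Fin n) K :=
  readForms n 1 τ

/-- The right factor `h` in the output is read off from the field array `2`. -/
noncomputable def outputRight {K : Type u} [Field K] (n : ℕ) (τ : State K) :
    Fin n → MvPolynomial (Fin n) K :=
  readForms n 2 τ

/-- A finite random tape, continued by zeros. -/
def extendTape {K : Type u} [Field K] {m : ℕ} (r : Fin m → K) : ℕ → K :=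
  fun k => if hk : k < m then r ⟨k, hk⟩ else 0

/-- On input `f` and with the random elements `r`, the program halts and outputs a decomposition
of `f`. -/
def Succeeds {K : Type u} [Field K] {n m : ℕ} (A : Prog)
    (f : Fin n → MvPolynomial (Fin n) K) (r : Fin m → K) : Prop :=
  ∃ (t : ℕ) (τ : State K), Exec A (initState f (extendTape r)) t τ ∧ Announces τ ∧
    IsQuadraticDecomposition f (outputLeft n τ) (outputRight n τ)

/-- The probability that the program, using at most `m` random elements, decomposes
`g ∘ h`, where the coefficients of the `n`-tuples of quadratic forms `g` and `h` and the random
elements are independent and uniformly distributed over the finite field `K`. -/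
noncomputable def successProb (K : Type u) [Field K] (n m : ℕ) (A : Prog) : ℝ :=
  (Nat.card {ω : (CoeffIdx n → K) × (Fin m → K) //
      Succeeds A (compose (leftFactor ω.1) (rightFactor ω.1)) ω.2} : ℝ) /
    (Nat.card ((CoeffIdx n → K) × (Fin m → K)) : ℝ)

end FDP

/-! Let `f = g ∘ h` with quadratic `g` and `h`. By the chain rule every partial derivative `∂_j f_i`
is a combination of the `n²` cubic forms `x_k h_m`. The coefficients are bilinear in the Hessians of
the `g_i` and the `h_l` and form the square matrix `chainMatrix`. If this matrix is invertible, the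
`∂_j f_i` and the `x_k h_m` span the same space `V`, which is thus known from `f` alone. The forms
`h_m` lie in the quotient `{q : x_k q ∈ V for all k}`. If, moreover, this quotient contains no
nonzero form without squares (`TrivialQuotient`), then a form in it is determined by its `n` square
coefficients, so the quotient has dimension at most `n` and a basis of it fits into an `n`-tuple
`t`. Each `h_m` is a combination of the `t_r`, hence each `f_i` is a combination of the products
`t_l t_m`, and the left factor is found by solving linear equations.

The algorithm is therefore deterministic linear algebra in three eliminations: the functionals that
vanish on `V`, the quotient as the solutions of equations obtained from these functionals, and the
linear relations between the `f_i` and the `t_l t_m`. Elimination keeps a basis of solutions dual to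
the free unknowns (`KernelBasis`) and always removes the last possible unknown. In the third system
the coefficients of the `f_i` come first, so they all stay free when every `f_i` is a combination of
products (`KernelBasis.le_pivot`). Conversely, if they stay free, the dual basis exhibits such
combinations. So announced answers are right for every input (`main_sound`), and the two conditions
above force an announcement (`main_complete`).

Both conditions hold off the zero set of a nonzero polynomial `D` in the coefficients of `(g, h)` of
degree at most `n³ + 3n²` (`exists_generic`): each follows from left invertibility of a matrix with
polynomial entries, and this is generic as soon as it holds at one point
(`exists_leftInverse_generic`). For the quotient the point `h_m = x_m²` serves. For the chain rule
`g_i = y_i²` and `h_l = ∑ x_j²` serve unless `2 = 0`. In characteristic two Hessians are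
alternating. There one takes `g_i = y_i y_{i+1}` with cyclic indices and graphs as Hessians of the
`h_l`, verifies block sizes from four to seven by elimination over the field with two elements, and
reaches all `n ≥ 4` by direct sums. Over a finite field the Schwartz–Zippel bound for `D` gives the
probability.

For the machine model, programs are compiled from commands with counting loops only. These have a
total denotation, a polynomial cost that can be read off their syntax, and syntactic lists of the
arrays they may change. Correctness of a nest of loops is proved with an invariant indexed by the
set of index tuples already processed (`den_reps`). -/

namespace FDP

/-! ## Structured commands with bounded loops -/

/-- Commands whose only loops are counting loops. The command `rep v u p` runs `p` with the natural
number variable `v` equal to `0, 1, …` as long as it is below the value of the variable `u`. -/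
inductive Cmd where
  | skip
  | instr (c : Instr)
  | seq (p q : Cmd)
  | ite (b : Cond) (p q : Cmd)
  | rep (v u : ℕ) (p : Cmd)

/-- The natural number array an instruction writes to. -/
def Instr.natWrites : Instr → List ℕ
  | natConst d _ => [d.arr]
  | natAdd d _ _ => [d.arr]
  | natSub d _ _ => [d.arr]
  | _ => []

/-- The field array an instruction writes to. -/
def Instr.fieldWrites : Instr → List ℕ
  | fieldZero d => [d.arr]
  | fieldOne d => [d.arr]
  | fieldAdd d _ _ => [d.arr]
  | fieldSub d _ _ => [d.arr]
  | fieldMul d _ _ => [d.arr]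
  | fieldDiv d _ _ => [d.arr]
  | sample d => [d.arr]
  | _ => []

namespace Cmd

/-- Increment of a counter; the variable `2` serves as a scratch cell. -/
def incr (v : ℕ) : Prog :=
  .seq (.instr (.natConst ⟨2, []⟩ 1)) (.instr (.natAdd ⟨v, []⟩ ⟨v, []⟩ ⟨2, []⟩))

/-- Translation into programs. -/
def compile : Cmd → Prog
  | skip => .skip
  | instr c => .instr c
  | seq p q => .seq p.compile q.compile
  | ite b p q => .ite b p.compile q.compile
  | rep v u p =>
    .seq (.instr (.natConst ⟨v, []⟩ 0))
      (.loop (.natLt ⟨v, []⟩ ⟨u, []⟩) (.seq p.compile (incr v)))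

/-- The natural number arrays a command writes to. -/
def natWrites : Cmd → List ℕ
  | skip => []
  | instr c => c.natWrites
  | seq p q => p.natWrites ++ q.natWrites
  | ite _ p q => p.natWrites ++ q.natWrites
  | rep v _ p => v :: 2 :: p.natWrites

/-- The field arrays a command writes to. -/
def fieldWrites : Cmd → List ℕ
  | skip => []
  | instr c => c.fieldWrites
  | seq p q => p.fieldWrites ++ q.fieldWrites
  | ite _ p q => p.fieldWrites ++ q.fieldWrites
  | rep _ _ p => p.fieldWrites

/-- The variables that bound loops. -/
def bounds : Cmd → List ℕ
  | skip => []
  | instr _ => []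
  | seq p q => p.bounds ++ q.bounds
  | ite _ p q => p.bounds ++ q.bounds
  | rep _ u p => u :: p.bounds

/-- No loop body changes the counter of the loop. -/
def CountersSafe : Cmd → Prop
  | skip => True
  | instr _ => True
  | seq p q => p.CountersSafe ∧ q.CountersSafe
  | ite _ p q => p.CountersSafe ∧ q.CountersSafe
  | rep v _ p => v ≠ 2 ∧ v ∉ p.natWrites ∧ p.CountersSafe

instance decidableCountersSafe : (c : Cmd) → Decidable c.CountersSafe
  | skip => .isTrue trivial
  | instr _ => .isTrue trivial
  | seq p q =>
    have := decidableCountersSafe p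
    have := decidableCountersSafe q
    inferInstanceAs (Decidable (_ ∧ _))
  | ite _ p q =>
    have := decidableCountersSafe p
    have := decidableCountersSafe q
    inferInstanceAs (Decidable (_ ∧ _))
  | rep _ _ p =>
    have := decidableCountersSafe p
    inferInstanceAs (Decidable (_ ∧ _ ∧ _))

/-- An upper bound for the running time in terms of an upper bound for the loop bounds. -/
noncomputable def costPoly : Cmd → Polynomial ℕ
  | skip => 0
  | instr _ => 1
  | seq p q => p.costPoly + q.costPoly
  | ite _ p q => p.costPoly + q.costPoly + 1
  -- The 2 pays for setting the counter to zero and for the last, failing test; the 3 pays for the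
  -- test of an iteration and the two instructions of `incr`.
  | rep _ _ p => 2 + Polynomial.X * (p.costPoly + 3)

section

variable {K : Type u}

/-- `τ` differs from `σ` only in arrays the command `c` writes to. -/
structure Frame (c : Cmd) (σ τ : State K) : Prop where
  nat : ∀ a, a ∉ c.natWrites → τ.nat a = σ.nat a
  field : ∀ a, a ∉ c.fieldWrites → τ.field a = σ.field a

theorem Frame.refl (c : Cmd) (σ : State K) : Frame c σ σ := ⟨fun _ _ => rfl, fun _ _ => rfl⟩

theorem Frame.trans {c : Cmd} {σ τ υ : State K} (h : Frame c σ τ) (h' : Frame c τ υ) :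
    Frame c σ υ :=
  ⟨fun a ha => (h'.nat a ha).trans (h.nat a ha), fun a ha => (h'.field a ha).trans (h.field a ha)⟩

theorem Frame.mono {c d : Cmd} {σ τ : State K} (h : Frame c σ τ)
    (hn : c.natWrites ⊆ d.natWrites) (hf : c.fieldWrites ⊆ d.fieldWrites) : Frame d σ τ :=
  ⟨fun a ha => h.nat a fun h' => ha (hn h'), fun a ha => h.field a fun h' => ha (hf h')⟩

theorem Frame.setNat {c : Cmd} {σ τ : State K} (h : Frame c σ τ) {r : Ref} {x : ℕ}
    (hr : r.arr ∈ c.natWrites) : Frame c σ (τ.setNat r x) := by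
  refine ⟨fun a ha => ?_, h.field⟩
  rw [← h.nat a ha]
  funext l
  have : a ≠ r.arr := fun e => ha (e ▸ hr)
  simp [State.setNat, this]

end

/-! ### Denotation, frames and running time of commands -/

variable {K : Type u} [Field K]

open Classical in
/-- The state transformation computed by a command. -/
noncomputable def den : Cmd → State K → State K
  | skip, σ => σ
  | instr c, σ => c.exec σ
  | seq p q, σ => q.den (p.den σ)
  | ite b p q, σ => if b.Holds σ then p.den σ else q.den σ
  | rep v u p, σ =>
    -- The number of iterations is fixed on entry and the counter is overwritten with `k + 1`. This
    -- agrees with the compiled loop only if the body changes neither the counter nor the bound,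
    -- which `exec_compile` assumes.
    Nat.rec (σ.setNat ⟨v, []⟩ 0)
      (fun k τ => ((p.den τ).setNat ⟨2, []⟩ 1).setNat ⟨v, []⟩ (k + 1)) (σ.nat u [])

theorem _root_.FDP.Instr.frame_exec (c : Instr) (σ : State K) :
    Frame (.instr c) σ (c.exec σ) := by
  constructor <;> intro a ha <;> funext l <;>
    cases c <;>
    simp_all [Instr.exec, State.setNat, State.setField, natWrites, fieldWrites, Instr.natWrites,
      Instr.fieldWrites]

/-- Turns every claim that an array keeps its contents into non-membership in a concrete list, which
can be decided. -/
theorem frame_den (c : Cmd) (σ : State K) : Frame c σ (c.den σ) := by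
  induction c generalizing σ with
  | skip => exact Frame.refl _ _
  | instr c => exact c.frame_exec σ
  | seq p q ihp ihq =>
    exact ((ihp σ).mono (by simp [natWrites]) (by simp [fieldWrites])).trans
      ((ihq _).mono (by simp [natWrites]) (by simp [fieldWrites]))
  | ite b p q ihp ihq =>
    rw [den]
    split_ifs
    · exact (ihp σ).mono (by simp [natWrites]) (by simp [fieldWrites])
    · exact (ihq σ).mono (by simp [natWrites]) (by simp [fieldWrites])
  | rep v u p ih =>
    rw [den]
    generalize σ.nat u [] = m
    induction m with
    | zero => exact (Frame.refl _ _).setNat (by simp [natWrites])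
    | succ k ihk =>
      refine Frame.setNat (Frame.setNat (ihk.trans ?_) ?_) ?_
      · exact (ih _).mono (by intro a ha; simp [natWrites, ha]) (by simp [fieldWrites])
      · simp [natWrites]
      · simp [natWrites]

/-- A loop establishes the final instance of an invariant. -/
theorem den_rep {v u : ℕ} {p : Cmd} {σ : State K} (I : ℕ → State K → Prop)
    (stable : ∀ k τ x y, I k τ → I k ((τ.setNat ⟨2, []⟩ x).setNat ⟨v, []⟩ y))
    (stable₀ : ∀ y, I 0 σ → I 0 (σ.setNat ⟨v, []⟩ y))
    (h₀ : I 0 σ)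
    (step : ∀ k τ, k < σ.nat u [] → τ.nat v [] = k → Frame (rep v u p) σ τ → I k τ →
      I (k + 1) (p.den τ)) :
    I (σ.nat u []) ((rep v u p).den σ) := by
  rw [den]
  -- The value of the counter and the frame are carried along with the invariant, since `step` may
  -- use both.
  have key : ∀ m ≤ σ.nat u [], (fun τ : State K => I m τ ∧ τ.nat v [] = m ∧ Frame (rep v u p) σ τ)
      (Nat.rec (σ.setNat ⟨v, []⟩ 0)
        (fun k τ => ((p.den τ).setNat ⟨2, []⟩ 1).setNat ⟨v, []⟩ (k + 1)) m) := by
    intro m hm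
    induction m with
    | zero =>
      exact ⟨stable₀ _ h₀, by simp [State.setNat, State.idx],
        (Frame.refl _ _).setNat (by simp [natWrites])⟩
    | succ k ih =>
      obtain ⟨h₁, h₂, h₃⟩ := ih (by omega)
      refine ⟨stable _ _ _ _ (step k _ (by omega) h₂ h₃ h₁), by simp [State.setNat, State.idx], ?_⟩
      refine Frame.setNat (Frame.setNat (h₃.trans ?_) ?_) ?_
      · exact (frame_den p _).mono (by intro a ha; simp [natWrites, ha]) (by simp [fieldWrites])
      · simp [natWrites]
      · simp [natWrites]
  exact (key _ le_rfl).1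

theorem exec_incr (v : ℕ) (hv : v ≠ 2) (σ : State K) :
    Exec (incr v) σ 2 ((σ.setNat ⟨2, []⟩ 1).setNat ⟨v, []⟩ (σ.nat v [] + 1)) := by
  have h := Exec.seq (Exec.instr (.natConst ⟨2, []⟩ 1) σ)
    (Exec.instr (.natAdd ⟨v, []⟩ ⟨v, []⟩ ⟨2, []⟩) (Instr.exec σ (.natConst ⟨2, []⟩ 1)))
  simpa [incr, Instr.exec, State.getNat, State.setNat, State.idx, hv] using h

/-- The compiled program computes the denotation, within the time given by `costPoly`. -/
theorem exec_compile (c : Cmd) (hc : c.CountersSafe) (hb : ∀ u ∈ c.bounds, u ∉ c.natWrites)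
    (B : ℕ) (σ : State K) (hB : ∀ u ∈ c.bounds, σ.nat u [] ≤ B) :
    ∃ t ≤ c.costPoly.eval B, Exec c.compile σ t (c.den σ) := by
  induction c generalizing σ with
  | skip => exact ⟨0, by simp, .skip σ⟩
  | instr c => exact ⟨1, by simp [costPoly], .instr c σ⟩
  | seq p q ihp ihq =>
    simp only [bounds, natWrites, List.mem_append, not_or] at hb hB
    obtain ⟨s, hs, hps⟩ := ihp hc.1 (fun u hu => (hb u (.inl hu)).1) σ (fun u hu => hB u (.inl hu))
    obtain ⟨t, ht, hqt⟩ := ihq hc.2 (fun u hu => (hb u (.inr hu)).2) (p.den σ) (fun u hu => by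
      rw [(frame_den p σ).nat u (hb u (.inr hu)).1]; exact hB u (.inr hu))
    exact ⟨s + t, by simpa [costPoly] using add_le_add hs ht, .seq hps hqt⟩
  | ite b p q ihp ihq =>
    simp only [bounds, natWrites, List.mem_append, not_or] at hb hB
    obtain ⟨s, hs, hps⟩ := ihp hc.1 (fun u hu => (hb u (.inl hu)).1) σ (fun u hu => hB u (.inl hu))
    obtain ⟨t, ht, hqt⟩ := ihq hc.2 (fun u hu => (hb u (.inr hu)).2) σ (fun u hu => hB u (.inr hu))
    rw [den]
    by_cases h : b.Holds σ
    · refine ⟨s + 1, by simp [costPoly]; omega, ?_⟩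
      rw [if_pos h]; exact .iteTrue h hps
    · refine ⟨t + 1, by simp [costPoly]; omega, ?_⟩
      rw [if_neg h]; exact .iteFalse h hqt
  | rep v u p ih =>
    obtain ⟨hv2, hvp, hp⟩ := hc
    simp only [bounds, natWrites, List.mem_cons, not_or, forall_eq_or_imp] at hb hB
    set m := σ.nat u [] with hm
    set S : ℕ → State K := fun k => Nat.rec (σ.setNat ⟨v, []⟩ 0)
        (fun k τ => ((p.den τ).setNat ⟨2, []⟩ 1).setNat ⟨v, []⟩ (k + 1)) k with hS
    have hden : (rep v u p).den σ = S m := by rw [den]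
    have hSv : ∀ k, (S k).nat v [] = k := by
      intro k
      cases k <;> simp [hS, State.setNat, State.idx]
    have hF : ∀ k, Frame (rep v u p) σ (S k) := by
      intro k
      induction k with
      | zero => exact (Frame.refl _ _).setNat (by simp [natWrites])
      | succ k ihk =>
        refine Frame.setNat (Frame.setNat (ihk.trans ?_) ?_) ?_
        · exact (frame_den p _).mono (by intro a ha; simp [natWrites, ha]) (by simp [fieldWrites])
        · simp [natWrites]
        · simp [natWrites]
    have hSu : ∀ k, (S k).nat u [] = m := fun k => by
      rw [(hF k).nat u (by simp [natWrites, hb.1])]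
    -- Induction on the number `k` of iterations still to be done, because an execution of a loop is
    -- built by putting one iteration in front of the rest.
    have loop : ∀ k ≤ m, ∃ t ≤ 1 + k * (p.costPoly.eval B + 3),
        Exec (.loop (.natLt ⟨v, []⟩ ⟨u, []⟩) (.seq p.compile (incr v))) (S (m - k)) t (S m) := by
      intro k hk
      induction k with
      | zero =>
        refine ⟨1, by simp, .loopFalse ?_⟩
        simp [Cond.Holds, State.getNat, State.idx, hSv, hSu]
      | succ k ihk =>
        obtain ⟨t, ht, he⟩ := ihk (by omega)
        obtain ⟨s, hs, hps⟩ := ih hp (fun w hw => (hb.2 w hw).2.2) (S (m - (k + 1)))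
          (fun w hw => by
            rw [(hF _).nat w (by simp [natWrites, hb.2 w hw])]; exact hB.2 w hw)
        have hstep : Exec (.seq p.compile (incr v)) (S (m - (k + 1))) (s + 2) (S (m - k)) := by
          have := Exec.seq hps (exec_incr v hv2 _)
          rw [(frame_den p _).nat v hvp, hSv] at this
          have e : m - k = m - (k + 1) + 1 := by omega
          rw [e]
          exact this
        refine ⟨s + 2 + t + 1, ?_, .loopTrue ?_ hstep he⟩
        · rw [add_mul]; omega
        · simp only [Cond.Holds, State.getNat, State.idx, List.map_nil, hSv, hSu]
          omega
    obtain ⟨t, ht, he⟩ := loop m le_rfl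
    rw [Nat.sub_self] at he
    refine ⟨1 + t, ?_, ?_⟩
    · have : m * (p.costPoly.eval B + 3) ≤ B * (p.costPoly.eval B + 3) :=
        Nat.mul_le_mul_right _ hB.1
      simp [costPoly]
      omega
    · rw [hden]
      exact .seq (.instr _ _) he

/-! ### Nested loops -/

/-- Nested loops with the counters `vs` and the common bound `u`. -/
def reps (vs : List ℕ) (u : ℕ) (p : Cmd) : Cmd :=
  vs.foldr (fun v c => rep v u c) p

theorem natWrites_reps_subset (vs : List ℕ) (u : ℕ) (p : Cmd) :
    p.natWrites ⊆ (reps vs u p).natWrites := by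
  induction vs with
  | nil => exact List.Subset.refl _
  | cons v vs ih => intro a ha; simp [reps, natWrites]; exact .inr (.inr (ih ha))

theorem fieldWrites_reps (vs : List ℕ) (u : ℕ) (p : Cmd) :
    (reps vs u p).fieldWrites = p.fieldWrites := by
  induction vs with
  | nil => rfl
  | cons v vs ih => exact ih

theorem mem_natWrites_reps {vs : List ℕ} {u : ℕ} {p : Cmd} {a : ℕ}
    (h : a ∈ (reps vs u p).natWrites) : a ∈ vs ∨ a = 2 ∨ a ∈ p.natWrites := by
  induction vs with
  | nil => exact .inr (.inr h)
  | cons v vs ih =>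
    rcases List.mem_cons.1 h with rfl | h
    · simp
    · rcases List.mem_cons.1 h with rfl | h
      · simp
      · rcases ih h with h | h
        · exact .inl (List.mem_cons_of_mem _ h)
        · exact .inr h

/-- The lists of length `d` with entries below `m`. -/
def box (m : ℕ) : ℕ → Finset (List ℕ)
  | 0 => {[]}
  | d + 1 => (Finset.range m ×ˢ box m d).image fun x => x.1 :: x.2

theorem mem_box {m d : ℕ} {l : List ℕ} : l ∈ box m d ↔ l.length = d ∧ ∀ x ∈ l, x < m := by
  induction d generalizing l with
  | zero => simp +contextual [box]
  | succ d ih =>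
    cases l with
    | nil => simp [box]
    | cons a l => simp [box, ih]; tauto

theorem sum_box_succ {M : Type*} [AddCommMonoid M] (m d : ℕ) (F : List ℕ → M) :
    ∑ t ∈ box m (d + 1), F t = ∑ a ∈ Finset.range m, ∑ t ∈ box m d, F (a :: t) := by
  rw [box, Finset.sum_image (by rintro ⟨a, s⟩ _ ⟨b, t⟩ _ h; simpa using h),
    Finset.sum_product]

theorem sum_box_zero {M : Type*} [AddCommMonoid M] (m : ℕ) (F : List ℕ → M) :
    ∑ t ∈ box m 0, F t = F [] := by
  simp [box]

/-- Nested loops process the tuples of a box one after the other. -/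
theorem den_reps {vs : List ℕ} {u : ℕ} {p : Cmd} {σ : State K}
    (hvs : vs.Nodup) (hv : ∀ v ∈ vs, v ≠ 2 ∧ v ≠ u ∧ v ∉ p.natWrites)
    (hu : u ≠ 2 ∧ u ∉ p.natWrites) (I : Finset (List ℕ) → State K → Prop)
    (stable : ∀ P τ v x, v ∈ vs ∨ v = 2 → I P τ → I P (τ.setNat ⟨v, []⟩ x))
    (h₀ : I ∅ σ)
    (step : ∀ t ∈ box (σ.nat u []) vs.length, ∀ P ⊆ box (σ.nat u []) vs.length, t ∉ P → ∀ τ,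
      vs.map (fun v => τ.nat v []) = t → Frame (reps vs u p) σ τ → I P τ →
      I (insert t P) (p.den τ)) :
    I (box (σ.nat u []) vs.length) ((reps vs u p).den σ) := by
  induction vs generalizing σ I with
  | nil => exact step [] (by simp [box]) ∅ (by simp) (by simp) σ rfl (Frame.refl _ _) h₀
  | cons v vs ih =>
    set m := σ.nat u [] with hm
    obtain ⟨hv₁, hv₂⟩ := List.nodup_cons.1 hvs
    obtain ⟨hv2, hvu, hvp⟩ := hv v (by simp)
    have hvin : v ∉ (reps vs u p).natWrites := fun h => by
      rcases mem_natWrites_reps h with h | h | h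
      · exact hv₁ h
      · exact hv2 h
      · exact hvp h
    have hun : u ∉ (reps (v :: vs) u p).natWrites := fun h => by
      rcases mem_natWrites_reps h with h | h | h
      · exact (hv u h).2.1 rfl
      · exact hu.1 h
      · exact hu.2 h
    -- `R k` is the set of tuples processed when the outer counter reaches `k`. The inner loops run
    -- with the invariant for `R k` enlarged by the tuples `k :: l`. As `step` allows any set of
    -- processed tuples, the order of processing never enters.
    let R : ℕ → Finset (List ℕ) := fun k =>
      (Finset.range k ×ˢ box m vs.length).image fun x => x.1 :: x.2
    have main := den_rep (K := K) (v := v) (u := u) (p := reps vs u p) (σ := σ)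
      (fun k τ => I (R k) τ)
      (fun k τ x y h => stable _ _ _ _ (.inl (by simp)) (stable _ _ _ _ (.inr rfl) h))
      (fun y h => stable _ _ _ _ (.inl (by simp)) h) (by simpa [R] using h₀) ?_
    · exact main
    · intro k τ hk hτv hτF hI
      have hτu : τ.nat u [] = m := by rw [hτF.nat u hun]
      have := ih (σ := τ) hv₂ (fun w hw => hv w (List.mem_cons_of_mem _ hw))
        (fun P υ => I (R k ∪ P.image (fun l => k :: l)) υ)
        (fun P υ w x hw h => stable _ _ _ _ (by
          rcases hw with hw | hw
          · exact .inl (List.mem_cons_of_mem _ hw)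
          · exact .inr hw) h)
        (by simpa using hI) ?_
      · rw [hτu] at this
        convert this using 1
        ext l
        cases l with
        | nil => simp [R]
        | cons a l =>
          simp only [R, Finset.mem_image, Finset.mem_product, Finset.mem_range, Prod.exists,
            Finset.mem_union, List.cons.injEq]
          constructor
          · rintro ⟨a', l', ⟨h₁, h₂⟩, rfl, rfl⟩
            rcases Nat.lt_succ_iff_lt_or_eq.1 h₁ with h | h
            · exact .inl ⟨_, _, ⟨h, h₂⟩, rfl, rfl⟩
            · exact .inr ⟨_, h₂, h.symm, rfl⟩
          · rintro (⟨a', l', ⟨h₁, h₂⟩, rfl, rfl⟩ | ⟨l', h₂, rfl, rfl⟩)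
            · exact ⟨_, _, ⟨by omega, h₂⟩, rfl, rfl⟩
            · exact ⟨_, _, ⟨by omega, h₂⟩, rfl, rfl⟩
      · intro t ht P hP htP υ hυ hυF hIυ
        rw [hτu] at ht hP
        have hF : Frame (reps (v :: vs) u p) σ υ :=
          hτF.trans (hυF.mono (by intro a ha; simp [reps, natWrites]; exact .inr (.inr ha))
            (List.Subset.refl _))
        have hυv : υ.nat v [] = k := by rw [hυF.nat v hvin, hτv]
        have := step (k :: t) (by
            rw [mem_box] at ht ⊢
            simpa [ht.1] using ⟨hk, ht.2⟩) (R k ∪ P.image (fun l => k :: l)) ?_ ?_ υ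
            (by simpa [hυv] using hυ) hF hIυ
        · simpa [Finset.image_insert, Finset.union_insert] using this
        · intro l hl
          simp only [Finset.mem_union, R, Finset.mem_image, Finset.mem_product, Finset.mem_range,
            Prod.exists] at hl
          rcases hl with ⟨a, l', ⟨h₁, h₂⟩, rfl⟩ | ⟨l', h₂, rfl⟩
          · rw [mem_box] at h₂ ⊢
            simpa [h₂.1] using ⟨by omega, h₂.2⟩
          · have h₂ := hP h₂
            rw [mem_box] at h₂ ⊢
            simpa [h₂.1] using ⟨hk, h₂.2⟩
        · simpa [R] using htP

end Cmd

end FDP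

namespace FDP

/-! ## Elimination -/

section Elimination

open Finset

variable {K : Type u} [Field K]

/-- The pairing of the first `C` coordinates. -/
def dot (C : ℕ) (x y : ℕ → K) : K := ∑ c ∈ range C, x c * y c

/-- `N` represents the space of solutions of the equations `rows` in `C` unknowns: the vectors `N s`,
for `s` in a set `S` of free unknowns, form a basis that is dual to the coordinates in `S`, and all
other `N s` vanish. -/
structure KernelBasis (C : ℕ) (N : ℕ → ℕ → K) (S : Finset ℕ) (rows : Set (ℕ → K)) : Prop where
  sub : S ⊆ range C
  solves : ∀ x ∈ rows, ∀ s < C, dot C x (N s) = 0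
  spans : ∀ y : ℕ → K, (∀ x ∈ rows, dot C x y = 0) → ∀ c < C, y c = ∑ s ∈ S, y s * N s c
  dual : ∀ s ∈ S, ∀ t ∈ S, N s t = if s = t then 1 else 0
  zero : ∀ s < C, s ∉ S → ∀ c < C, N s c = 0

/-- The last index below `C` at which `v` does not vanish, if there is one. -/
structure IsPivot (C : ℕ) (v : ℕ → K) (p : ℕ) : Prop where
  lt : p < C
  last : ∀ s < C, p < s → v s = 0
  ne : v p = 0 → ∀ s < C, v s = 0

theorem KernelBasis.initial (C : ℕ) (N : ℕ → ℕ → K)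
    (h : ∀ s < C, ∀ c < C, N s c = if s = c then 1 else 0) :
    KernelBasis C N (range C) ∅ where
  sub := Subset.refl _
  solves := by simp
  spans y _ c hc := by
    rw [sum_eq_single c]
    · simp [h c hc c hc]
    · intro s hs hsc
      simp [h s (mem_range.1 hs) c hc, hsc]
    · intro h; exact absurd (mem_range.2 hc) h
  dual s hs t ht := h s (mem_range.1 hs) t (mem_range.1 ht)
  zero s hs hs' := absurd (mem_range.2 hs) hs'

/-- The set of free unknowns need not be stored: the diagonal of the matrix shows it. -/
theorem KernelBasis.alive_iff {C : ℕ} {N : ℕ → ℕ → K} {S : Finset ℕ} {rows : Set (ℕ → K)}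
    (h : KernelBasis C N S rows) {s : ℕ} (hs : s < C) : s ∈ S ↔ N s s ≠ 0 := by
  constructor
  · intro hS; simp [h.dual s hS s hS]
  · intro hN; by_contra hS; exact hN (h.zero s hs hS s hs)

theorem dot_sub_smul (C : ℕ) (x y z : ℕ → K) (a : K) :
    dot C x (fun c => y c - a * z c) = dot C x y - a * dot C x z := by
  simp only [dot, mul_sub, sum_sub_distrib, mul_sum]
  congr 1
  exact sum_congr rfl fun c _ => by ring

theorem dot_congr {C : ℕ} {x x' y y' : ℕ → K} (hx : ∀ c < C, x c = x' c)
    (hy : ∀ c < C, y c = y' c) : dot C x y = dot C x' y' :=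
  sum_congr rfl fun c hc => by rw [hx c (mem_range.1 hc), hy c (mem_range.1 hc)]

theorem KernelBasis.dot_eq {C : ℕ} {N : ℕ → ℕ → K} {S : Finset ℕ} {rows : Set (ℕ → K)}
    (h : KernelBasis C N S rows) {y : ℕ → K} (hy : ∀ x ∈ rows, dot C x y = 0) (x : ℕ → K) :
    dot C x y = ∑ s ∈ S, y s * dot C x (N s) := by
  calc dot C x y = ∑ c ∈ range C, x c * ∑ s ∈ S, y s * N s c :=
        sum_congr rfl fun c hc => by rw [← h.spans y hy c (mem_range.1 hc)]
    _ = _ := by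
        simp only [dot, mul_sum]
        rw [sum_comm]
        exact sum_congr rfl fun s _ => sum_congr rfl fun c _ => by ring

open Classical in
/-- One elimination step. -/
theorem KernelBasis.absorb {C : ℕ} {N N' : ℕ → ℕ → K} {S : Finset ℕ} {rows : Set (ℕ → K)}
    (h : KernelBasis C N S rows) {x : ℕ → K} {p : ℕ}
    (hp : IsPivot C (fun s => dot C x (N s)) p)
    (hN' : ∀ s < C, ∀ c < C, N' s c = N s c - dot C x (N s) / dot C x (N p) * N p c) :
    KernelBasis C N' (if dot C x (N p) = 0 then S else S.erase p) (insert x rows) := by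
  set v := fun s => dot C x (N s) with hv
  have hdot : ∀ z : ℕ → K, ∀ s < C, dot C z (N' s) = dot C z (N s) - v s / v p * dot C z (N p) := by
    intro z s hs
    rw [← dot_sub_smul]
    exact dot_congr (fun _ _ => rfl) fun c hc => hN' s hs c hc
  -- A vanishing value at the pivot means that all values vanish, so the equation already holds on
  -- the space. Since division by zero yields zero, the update then changes nothing.
  by_cases hvp : dot C x (N p) = 0
  · have hall : ∀ s < C, dot C x (N s) = 0 := hp.ne hvp
    have hNN : ∀ s < C, ∀ c < C, N' s c = N s c := fun s hs c hc => by
      rw [hN' s hs c hc, hvp]; simp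
    have hlt : ∀ s ∈ S, s < C := fun s hs => mem_range.1 (h.sub hs)
    rw [if_pos hvp]
    refine ⟨h.sub, ?_, ?_, ?_, ?_⟩
    · rintro z (rfl | hz) s hs
      · rw [dot_congr (fun _ _ => rfl) (hNN s hs)]; exact hall s hs
      · rw [dot_congr (fun _ _ => rfl) (hNN s hs)]; exact h.solves z hz s hs
    · intro y hy c hc
      rw [h.spans y (fun z hz => hy z (.inr hz)) c hc]
      exact sum_congr rfl fun s hs => by rw [hNN s (hlt s hs) c hc]
    · intro s hs t ht
      rw [hNN s (hlt s hs) t (hlt t ht)]; exact h.dual s hs t ht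
    · intro s hs hS c hc
      rw [hNN s hs c hc]; exact h.zero s hs hS c hc
  · have hpS : p ∈ S := by
      by_contra hS
      exact hvp (sum_eq_zero fun c hc => by rw [h.zero p hp.lt hS c (mem_range.1 hc), mul_zero])
    rw [if_neg hvp]
    have hvp' : v p ≠ 0 := hvp
    refine ⟨(erase_subset _ _).trans h.sub, ?_, ?_, ?_, ?_⟩
    · rintro z (rfl | hz) s hs
      · rw [hdot _ s hs]
        change v s - v s / v p * v p = 0
        rw [div_mul_cancel₀ _ hvp', sub_self]
      · rw [hdot _ s hs, h.solves z hz s hs, h.solves z hz p hp.lt]; simp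
    · intro y hy c hc
      have hy' : ∀ z ∈ rows, dot C z y = 0 := fun z hz => hy z (.inr hz)
      -- The new equation expressed in the old basis. Solving it for `y p`, as `v p ≠ 0`, removes
      -- the unknown `p`.
      have h0 : ∑ s ∈ S, y s * v s = 0 := by
        rw [← h.dot_eq hy' x]; exact hy x (.inl rfl)
      have h1 := h.spans y hy' c hc
      rw [← add_sum_erase _ _ hpS] at h0 h1
      have h2 : ∑ s ∈ S.erase p, y s * N' s c =
          ∑ s ∈ S.erase p, y s * N s c - (∑ s ∈ S.erase p, y s * v s) / v p * N p c := by
        rw [sum_div, sum_mul, ← sum_sub_distrib]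
        refine sum_congr rfl fun s hs => ?_
        rw [hN' s (mem_range.1 (h.sub (mem_of_mem_erase hs))) c hc]
        change y s * (N s c - v s / v p * N p c) = _
        ring
      rw [h2, h1, eq_neg_of_add_eq_zero_right h0]
      field_simp
      ring
    · intro s hs t ht
      have hs' := mem_of_mem_erase hs
      have ht' := mem_of_mem_erase ht
      rw [hN' s (mem_range.1 (h.sub hs')) t (mem_range.1 (h.sub ht')), h.dual s hs' t ht',
        h.dual p hpS t ht', if_neg (ne_of_mem_erase ht).symm, mul_zero, sub_zero]
    · intro s hs hS c hc
      rw [hN' s hs c hc]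
      -- The pivot vector cancels itself and becomes zero, as required of an eliminated unknown.
      by_cases hsp : s = p
      · subst hsp
        rw [div_self hvp]; ring
      · have hsS : s ∉ S := fun h' => hS (mem_erase.2 ⟨hsp, h'⟩)
        have : dot C x (N s) = 0 :=
          sum_eq_zero fun c hc => by rw [h.zero s hs hsS c (mem_range.1 hc), mul_zero]
        rw [h.zero s hs hsS c hc, this]; simp

/-- If for each of the first `n` unknowns there is a solution that is one there and zero at the
others of the first `n` unknowns, then these unknowns are not eliminated. -/
theorem KernelBasis.le_pivot {C n : ℕ} {N : ℕ → ℕ → K} {S : Finset ℕ} {rows : Set (ℕ → K)}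
    (h : KernelBasis C N S rows) (hS : range n ⊆ S) {x : ℕ → K} {p : ℕ}
    (hp : IsPivot C (fun s => dot C x (N s)) p) (y : ℕ → ℕ → K)
    (hy : ∀ i < n, ∀ z ∈ insert x rows, dot C z (y i) = 0)
    (hyn : ∀ i < n, ∀ j < n, y i j = if i = j then 1 else 0) (hvp : dot C x (N p) ≠ 0) :
    n ≤ p := by
  by_contra hlt
  push Not at hlt
  have hy' : ∀ z ∈ rows, dot C z (y p) = 0 := fun z hz => hy p hlt z (.inr hz)
  -- Expand the new equation at the solution `y p`. Other free unknowns below `n` have coefficient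
  -- zero in `y p`, and those from `n` on lie beyond the pivot, where the values vanish. Only the
  -- nonzero value at `p` is left.
  have h0 := h.dot_eq hy' x
  rw [hy p hlt x (.inl rfl), sum_eq_single p] at h0
  · rw [hyn p hlt p hlt, if_pos rfl, one_mul] at h0
    exact hvp h0.symm
  · intro s hs hsp
    rcases lt_or_ge s n with hsn | hsn
    · rw [hyn p hlt s hsn, if_neg (Ne.symm hsp), zero_mul]
    · rw [hp.last s (mem_range.1 (h.sub hs)) (by omega), mul_zero]
  · intro hn; exact absurd (hS (mem_range.2 hlt)) hn

/-- A vector that is orthogonal to a represented space of solutions is a combination of the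
equations. -/
theorem KernelBasis.mem_span {C : ℕ} {N : ℕ → ℕ → K} {S : Finset ℕ} {rows : Set (ℕ → K)}
    (h : KernelBasis C N S rows) (t : ℕ → K) (ht : ∀ s < C, dot C (N s) t = 0) :
    (fun c : Fin C => t c) ∈ Submodule.span K ((fun (x : ℕ → K) (c : Fin C) => x c) '' rows) := by
  by_contra hn
  -- Double annihilator: a functional that separates `t` from the equations has a coefficient vector
  -- `y` that solves them. So `y` is a combination of the `N s`, all orthogonal to `t`, and the
  -- functional vanishes at `t` after all.
  obtain ⟨φ, hφt, hφ⟩ := Submodule.exists_le_ker_of_notMem hn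
  let y : ℕ → K := fun c => if hc : c < C then φ (Pi.single ⟨c, hc⟩ 1) else 0
  have hdot : ∀ x : ℕ → K, φ (fun c : Fin C => x c) = dot C x y := by
    intro x
    have : (fun c : Fin C => x c) = ∑ c : Fin C, x c • (Pi.single c 1 : Fin C → K) := by
      ext c; simp [Pi.single_apply]
    rw [this, map_sum, dot, ← Fin.sum_univ_eq_sum_range (fun c => x c * y c)]
    exact sum_congr rfl fun c _ => by simp [y]
  apply hφt
  rw [hdot, h.dot_eq (fun x hx => ?_)]
  · refine sum_eq_zero fun s hs => ?_
    have := ht s (mem_range.1 (h.sub hs))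
    rw [dot] at this ⊢
    rw [sum_congr rfl fun c _ => mul_comm (t c) (N s c), this, mul_zero]
  · rw [← hdot]
    exact hφ (Submodule.subset_span ⟨x, hx, rfl⟩)

end Elimination

end FDP

namespace FDP

/-! ## The program -/

namespace Cmd

/-- Sequential composition of a list of commands. -/
def block : List Cmd → Cmd
  | [] => skip
  | [c] => c
  | c :: cs => seq c (block cs)

/-- The natural number variable `v`. -/
abbrev var (v : ℕ) : Ref := ⟨v, []⟩

/-- The field cell that is never written and contains zero. -/
abbrev zeroCell : Ref := ⟨6, []⟩

/-- Copy a field element. -/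
def copy (d a : Ref) : Cmd := instr (.fieldAdd d a zeroCell)

/-- Tables of the multiples of `n` and of `n²` and of the powers of `5`, and the numbers `n²`, `n³`,
`n² + n`. -/
def setup : Cmd := block [
  instr (.natConst (var 25) 0),
  rep 6 0 (block [instr (.natAdd ⟨30, [6]⟩ (var 25) (var 28)),
    instr (.natAdd (var 25) (var 25) (var 0))]),
  instr (.natConst (var 26) 0),
  rep 6 0 (block [instr (.natAdd ⟨31, [6]⟩ (var 26) (var 28)),
    instr (.natAdd (var 26) (var 26) (var 25))]),
  instr (.natAdd (var 27) (var 25) (var 0)),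
  instr (.natConst (var 29) 1),
  rep 6 0 (block [instr (.natAdd ⟨32, [6]⟩ (var 29) (var 28)),
    instr (.natAdd (var 23) (var 29) (var 29)),
    instr (.natAdd (var 23) (var 23) (var 23)),
    instr (.natAdd (var 29) (var 23) (var 29))])]

/-- Write the identity matrix to the array `A`. -/
def initBasis (A u : ℕ) : Cmd :=
  reps [12, 13] u (ite (.natEq (var 12) (var 13))
    (instr (.fieldOne ⟨A, [12, 13]⟩)) (instr (.fieldZero ⟨A, [12, 13]⟩)))

/-- The values of the equation in the array `3` at the vectors in the array `A`. -/
def dots (A u : ℕ) : Cmd :=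
  reps [12] u (seq (instr (.fieldZero ⟨4, [12]⟩))
    (reps [13] u (seq (instr (.fieldMul ⟨7, []⟩ ⟨3, [13]⟩ ⟨A, [12, 13]⟩))
      (instr (.fieldAdd ⟨4, [12]⟩ ⟨4, [12]⟩ ⟨7, []⟩)))))

/-- Find the last nonzero value. -/
def findPivot (u : ℕ) : Cmd :=
  seq (instr (.natConst (var 14) 0))
    (rep 12 u (ite (.fieldEq ⟨4, [12]⟩ zeroCell) skip
      (instr (.natAdd (var 14) (var 12) (var 28)))))

/-- Save the pivot vector. -/
def savePivot (A u : ℕ) : Cmd :=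
  reps [13] u (copy ⟨5, [13]⟩ ⟨A, [14, 13]⟩)

/-- Subtract multiples of the pivot vector. -/
def eliminate (A u : ℕ) : Cmd :=
  reps [12] u (seq (instr (.fieldDiv ⟨8, []⟩ ⟨4, [12]⟩ ⟨4, [14]⟩))
    (reps [13] u (seq (instr (.fieldMul ⟨7, []⟩ ⟨8, []⟩ ⟨5, [13]⟩))
      (instr (.fieldSub ⟨A, [12, 13]⟩ ⟨A, [12, 13]⟩ ⟨7, []⟩)))))

/-- One elimination step with the equation in the array `3`. -/
def absorb (A u : ℕ) : Cmd :=
  seq (dots A u) (seq (findPivot u) (seq (savePivot A u) (eliminate A u)))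

/-- Write the number `[a, b, c]` in base `n` to the variable `17`. -/
def index₃ (a b c : ℕ) : Cmd :=
  seq (instr (.natAdd (var 17) ⟨31, [a]⟩ ⟨30, [b]⟩))
    (instr (.natAdd (var 17) (var 17) (var c)))

/-- The coefficients of a partial derivative. -/
def derivativeRow : Cmd :=
  reps [6, 7, 8] 0 (block [index₃ 6 7 8,
    copy ⟨3, [17]⟩ ⟨0, [3, 4, 6, 7, 8]⟩,
    ite (.natEq (var 6) (var 4))
      (instr (.fieldAdd ⟨3, [17]⟩ ⟨3, [17]⟩ ⟨0, [3, 4, 6, 7, 8]⟩)) skip,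
    ite (.natEq (var 7) (var 4))
      (instr (.fieldAdd ⟨3, [17]⟩ ⟨3, [17]⟩ ⟨0, [3, 4, 6, 7, 8]⟩)) skip,
    ite (.natEq (var 8) (var 4))
      (instr (.fieldAdd ⟨3, [17]⟩ ⟨3, [17]⟩ ⟨0, [3, 4, 6, 7, 8]⟩)) skip])

/-- The functionals that vanish on the partial derivatives. -/
def annihilator : Cmd :=
  seq (initBasis 10 26) (reps [3, 4] 0 (seq derivativeRow (absorb 10 26)))

/-- The linear functional of a quadratic form `q` that is the value at `x_k q` of a functional on
cubic forms. -/
def quotientRow : Cmd :=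
  reps [6, 7] 0 (block [
    instr (.natAdd (var 18) ⟨30, [6]⟩ (var 7)),
    index₃ 5 6 7,
    copy ⟨3, [18]⟩ ⟨10, [16, 17]⟩,
    index₃ 6 5 7,
    ite (.natEq (var 6) (var 5)) skip
      (instr (.fieldAdd ⟨3, [18]⟩ ⟨3, [18]⟩ ⟨10, [16, 17]⟩)),
    index₃ 6 7 5,
    ite (.natEq (var 6) (var 5)) skip (ite (.natEq (var 7) (var 5)) skip
      (instr (.fieldAdd ⟨3, [18]⟩ ⟨3, [18]⟩ ⟨10, [16, 17]⟩)))])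

/-- The quadratic forms whose products with all variables are combinations of the partial
derivatives. -/
def quotient : Cmd :=
  seq (initBasis 11 25) (reps [3, 4, 10, 5] 0 (seq
    (seq (index₃ 3 4 10) (seq (instr (.natAdd (var 16) (var 17) (var 28))) quotientRow))
    (absorb 11 25)))

/-- Copy the nonzero basis vectors to the output. -/
def extract : Cmd :=
  seq (instr (.natConst (var 15) 0))
    (rep 12 25 (ite (.fieldEq ⟨11, [12, 12]⟩ zeroCell) skip
      (seq (reps [6, 7] 0 (seq (instr (.natAdd (var 17) ⟨30, [6]⟩ (var 7)))
          (copy ⟨2, [15, 6, 7]⟩ ⟨11, [12, 17]⟩)))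
        (seq (instr (.natConst (var 18) 1)) (instr (.natAdd (var 15) (var 15) (var 18)))))))

/-- Write the sum of four powers of `5` to the variable `r`. -/
def monomialKey (r a b c d : ℕ) : Cmd :=
  seq (instr (.natAdd (var r) ⟨32, [a]⟩ ⟨32, [b]⟩))
    (seq (instr (.natAdd (var r) (var r) ⟨32, [c]⟩))
      (instr (.natAdd (var r) (var r) ⟨32, [d]⟩)))

/-- A coefficient of a product of two of the quadratic forms in the array `2`. -/
def productCoeff : Cmd :=
  seq (instr (.fieldZero ⟨9, []⟩))
    (ite (.natLt (var 11) (var 10)) skip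
      (reps [19, 20, 21, 22] 0
        (ite (.natLt (var 20) (var 19)) skip
          (ite (.natLt (var 22) (var 21)) skip
            (seq (monomialKey 24 19 20 21 22)
              (ite (.natEq (var 24) (var 23))
                (seq (instr (.fieldMul ⟨7, []⟩ ⟨2, [10, 19, 20]⟩ ⟨2, [11, 21, 22]⟩))
                  (instr (.fieldAdd ⟨9, []⟩ ⟨9, []⟩ ⟨7, []⟩))) skip))))))

/-- Write `n + l n + m` to the variable `17`. -/
def pairIndex : Cmd :=
  seq (instr (.natAdd (var 17) (var 0) ⟨30, [10]⟩))
    (instr (.natAdd (var 17) (var 17) (var 11)))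

/-- The coefficients of one monomial in the input and in the products of quadratic forms. -/
def compositionRow : Cmd :=
  seq (monomialKey 23 6 7 8 9)
    (seq (reps [3] 0 (copy ⟨3, [3]⟩ ⟨0, [3, 6, 7, 8, 9]⟩))
      (reps [10, 11] 0 (seq productCoeff (seq pairIndex
        (instr (.fieldSub ⟨3, [17]⟩ zeroCell ⟨9, []⟩))))))

/-- The linear relations between the input and the products of quadratic forms. -/
def relations : Cmd :=
  seq (initBasis 12 27) (reps [6, 7, 8, 9] 0 (seq compositionRow (absorb 12 27)))

/-- Write the left factor. -/
def writeLeft : Cmd :=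
  reps [3, 10, 11] 0 (seq pairIndex (copy ⟨1, [3, 10, 11]⟩ ⟨12, [3, 17]⟩))

/-- Announce success if the input is not zero and a left factor has been found. -/
def announce : Cmd :=
  seq (reps [3, 6, 7, 8, 9] 0 (ite (.fieldEq ⟨0, [3, 6, 7, 8, 9]⟩ zeroCell) skip
      (instr (.natConst (var 1) 1))))
    (reps [3] 0 (ite (.fieldEq ⟨12, [3, 3]⟩ zeroCell) (instr (.natConst (var 1) 0)) skip))

/-- The main part of the program. -/
def main : Cmd :=
  seq annihilator (seq quotient (seq extract (seq relations (seq writeLeft announce))))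

theorem countersSafe_setup : setup.CountersSafe := by decide

theorem countersSafe_main : main.CountersSafe := by decide

theorem bounds_setup : ∀ u ∈ setup.bounds, u ∉ setup.natWrites := by decide

theorem bounds_main : ∀ u ∈ main.bounds, u ∉ main.natWrites := by decide

/-! ### Elimination -/

section Elim

open Finset

variable {K : Type u} [Field K]

/-- The vector stored in a field array. -/
def vec (σ : State K) (A : ℕ) : ℕ → K := fun c => σ.field A [c]

/-- The matrix stored in a field array. -/
def mat (σ : State K) (A : ℕ) : ℕ → ℕ → K := fun s c => σ.field A [s, c]

theorem den_initBasis {A u : ℕ} (hu : 24 < u) (σ : State K) :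
    ∀ s < σ.nat u [], ∀ c < σ.nat u [],
      mat ((initBasis A u).den σ) A s c = if s = c then 1 else 0 := by
  have h := den_reps (K := K) (vs := [12, 13]) (u := u) (σ := σ)
    (p := ite (.natEq (var 12) (var 13))
      (instr (.fieldOne ⟨A, [12, 13]⟩)) (instr (.fieldZero ⟨A, [12, 13]⟩)))
    (by decide) (by simp [natWrites, Instr.natWrites]; omega)
    (by simp [natWrites, Instr.natWrites]; omega)
    (fun P τ => ∀ s c, [s, c] ∈ P → mat τ A s c = if s = c then 1 else 0)
    (fun P τ v x _ h => h) (by simp) ?_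
  · intro s hs c hc
    exact h s c (by simp [mem_box, hs, hc])
  · rintro _ - P - - τ rfl - hI s c hsc
    simp only [List.map_cons, List.map_nil, mem_insert, List.cons.injEq, and_true] at hsc
    by_cases e : τ.nat 12 [] = τ.nat 13 [] <;>
    by_cases e' : s = τ.nat 12 [] ∧ c = τ.nat 13 [] <;>
    simp_all [den, mat, Cond.Holds, State.getNat, Instr.exec, State.setField, State.idx]
    rw [if_neg fun h => e' h.1 h.2]
    exact hI s c (hsc.resolve_left fun h => e' h.1 h.2)

theorem den_dots {A u : ℕ} (hA : 9 < A) (hu : 24 < u) (σ : State K) :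
    ∀ s < σ.nat u [], vec ((dots A u).den σ) 4 s = dot (σ.nat u []) (vec σ 3) (mat σ A s) := by
  have h := den_reps (K := K) (vs := [12]) (u := u) (σ := σ)
    (p := seq (instr (.fieldZero ⟨4, [12]⟩))
      (reps [13] u (seq (instr (.fieldMul ⟨7, []⟩ ⟨3, [13]⟩ ⟨A, [12, 13]⟩))
      (instr (.fieldAdd ⟨4, [12]⟩ ⟨4, [12]⟩ ⟨7, []⟩)))))
    (by decide) (by simp [reps, natWrites, Instr.natWrites]; omega)
    (by simp [reps, natWrites, Instr.natWrites]; omega)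
    (fun P τ => ∀ s, [s] ∈ P → vec τ 4 s = dot (σ.nat u []) (vec σ 3) (mat σ A s))
    (fun P τ v x _ h => h) (by simp) ?_
  · intro s hs
    exact h s (by simp [mem_box, hs])
  · rintro _ - P - hP τ rfl hF hI
    set τ' := (instr (.fieldZero ⟨4, [12]⟩)).den τ with hτ'
    have hτu : τ'.nat u [] = σ.nat u [] := by
      change τ.nat u [] = _
      rw [hF.nat u (by simp [reps, natWrites, Instr.natWrites]; omega)]
    have hrow : τ'.field 3 = σ.field 3 := by
      rw [← hF.field 3 (by simp [reps, fieldWrites, Instr.fieldWrites])]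
      simp [hτ', den, Instr.exec, State.setField]
    have hN : τ'.field A = σ.field A := by
      rw [← hF.field A (by simp [reps, fieldWrites, Instr.fieldWrites]; omega)]
      have : A ≠ 4 := by omega
      simp [hτ', den, Instr.exec, State.setField, this]
    have inner := den_reps (K := K) (vs := [13]) (u := u) (σ := τ')
      (p := seq (instr (.fieldMul ⟨7, []⟩ ⟨3, [13]⟩ ⟨A, [12, 13]⟩))
        (instr (.fieldAdd ⟨4, [12]⟩ ⟨4, [12]⟩ ⟨7, []⟩)))
      (by decide) (by simp [natWrites, Instr.natWrites]; omega)
      (by simp [natWrites, Instr.natWrites]; omega)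
      (fun Q υ => (∀ s ≠ τ.nat 12 [], vec υ 4 s = vec τ 4 s) ∧
        vec υ 4 (τ.nat 12 []) =
          ∑ t ∈ Q, σ.field 3 t * σ.field A (τ.nat 12 [] :: t))
      (fun P τ v x _ h => h) ?_ ?_
    · intro s hs
      have hd : (seq (instr (.fieldZero ⟨4, [12]⟩))
        (reps [13] u (seq (instr (.fieldMul ⟨7, []⟩ ⟨3, [13]⟩ ⟨A, [12, 13]⟩))
        (instr (.fieldAdd ⟨4, [12]⟩ ⟨4, [12]⟩ ⟨7, []⟩))))).den τ = (reps [13] u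
        (seq (instr (.fieldMul ⟨7, []⟩ ⟨3, [13]⟩ ⟨A, [12, 13]⟩))
        (instr (.fieldAdd ⟨4, [12]⟩ ⟨4, [12]⟩ ⟨7, []⟩)))).den τ' := by rw [den]
      rw [hd]
      by_cases e : s = τ.nat 12 []
      · rw [e, inner.2, hτu]
        simp only [List.length_cons, List.length_nil, sum_box_succ, sum_box_zero]
        rfl
      · rw [inner.1 s e]
        exact hI s (by simpa [e] using hs)
    · constructor
      · intro s hs
        simp [hτ', vec, den, Instr.exec, State.setField, State.idx, hs]
      · simp [hτ', vec, den, Instr.exec, State.setField, State.idx]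
    · rintro _ - Q - hQ υ rfl hFυ ⟨h1, h2⟩
      have e12 : υ.nat 12 = τ.nat 12 := by
        rw [hFυ.nat 12 (by simp [reps, natWrites, Instr.natWrites])]; rfl
      have e3 : υ.field 3 = σ.field 3 := by
        rw [hFυ.field 3 (by simp [reps, fieldWrites, Instr.fieldWrites]), hrow]
      have eA : υ.field A = σ.field A := by
        rw [hFυ.field A (by simp [reps, fieldWrites, Instr.fieldWrites]; omega), hN]
      have hA4 : A ≠ 4 := by omega
      have hA7 : A ≠ 7 := by omega
      constructor
      · intro s hs
        rw [← h1 s hs]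
        simp [vec, den, Instr.exec, State.setField, State.idx, State.getField, e12, hs]
      · rw [sum_insert hQ, ← h2]
        simp [vec, den, Instr.exec, State.setField, State.idx, State.getField, e12, e3, eA]
        ring

/-- Every nonzero value overwrites the candidate, so the last one survives. If all values vanish the
candidate keeps the default `0`, a legal index because the number of unknowns is positive. -/
theorem den_findPivot {u : ℕ} (hu : 24 < u) (σ : State K) (hz : σ.field 6 [] = 0)
    (hz' : σ.nat 28 [] = 0) (hC : 0 < σ.nat u []) :
    IsPivot (σ.nat u []) (vec σ 4) (((findPivot u).den σ).nat 14 []) := by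
  set τ := (instr (.natConst (var 14) 0)).den σ with hτ
  have hτu : τ.nat u [] = σ.nat u [] := by
    have : u ≠ 14 := by omega
    simp [hτ, den, Instr.exec, State.setNat, this]
  let I : ℕ → State K → Prop := fun k υ => (υ.nat 14 [] < k ∨ υ.nat 14 [] = 0) ∧
    (∀ s < k, υ.nat 14 [] < s → vec σ 4 s = 0) ∧
    (vec σ 4 (υ.nat 14 []) = 0 → ∀ s < k, vec σ 4 s = 0)
  have h : I (τ.nat u []) ((findPivot u).den σ) := by
    refine den_rep (σ := τ) I ?_ ?_ ?_ ?_
    · intro k υ x y h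
      simpa [I, State.setNat, State.idx] using h
    · intro y h
      simpa [I, State.setNat, State.idx] using h
    · simp [I, hτ, den, Instr.exec, State.setNat, State.idx]
    · rintro k υ - hk hF ⟨h1, h2, h3⟩
      have e4 : υ.field 4 = σ.field 4 := by
        rw [hF.field 4 (by simp [fieldWrites, Instr.fieldWrites])]; rfl
      have e6 : υ.field 6 [] = 0 := by
        rw [hF.field 6 (by simp [fieldWrites, Instr.fieldWrites])]; exact hz
      have e28 : υ.nat 28 [] = 0 := by
        rw [hF.nat 28 (by simp [natWrites, Instr.natWrites])]
        simpa [hτ, den, Instr.exec, State.setNat] using hz'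
      by_cases e : vec σ 4 k = 0
      · have : (ite (.fieldEq ⟨4, [12]⟩ zeroCell) skip
            (instr (.natAdd (var 14) (var 12) (var 28)))).den υ = υ := by
          simp only [vec] at e
          simp [den, Cond.Holds, State.getField, State.idx, hk, e6, e4, e]
        rw [this]
        refine ⟨by omega, ?_, ?_⟩
        · intro s hs hp
          rcases Nat.lt_succ_iff_lt_or_eq.1 hs with hs | rfl
          · exact h2 s hs hp
          · exact e
        · intro hp s hs
          rcases Nat.lt_succ_iff_lt_or_eq.1 hs with hs | rfl
          · exact h3 hp s hs
          · exact e
      · have : ((ite (.fieldEq ⟨4, [12]⟩ zeroCell) skip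
            (instr (.natAdd (var 14) (var 12) (var 28)))).den υ).nat 14 [] = k := by
          simp only [vec] at e
          simp [den, Cond.Holds, State.getField, State.getNat, State.idx, hk, e6, e4, e,
            Instr.exec, State.setNat, e28]
        simp only [I, this]
        exact ⟨.inl (by omega), fun s hs hs' => by omega, fun h => absurd h e⟩
  rw [hτu] at h
  exact ⟨by rcases h.1 with h | h <;> omega, h.2.1, h.2.2⟩

/-- The copy is needed because the pivot row is itself reduced to zero while later rows still have
to be updated with it. -/
theorem den_savePivot {A u : ℕ} (hA : 9 < A) (hu : 24 < u) (σ : State K)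
    (hz : σ.field 6 [] = 0) :
    ∀ c < σ.nat u [], vec ((savePivot A u).den σ) 5 c = mat σ A (σ.nat 14 []) c := by
  let I : Finset (List ℕ) → State K → Prop := fun P τ =>
    ∀ c, [c] ∈ P → vec τ 5 c = mat σ A (σ.nat 14 []) c
  have h : I (box (σ.nat u []) 1) ((savePivot A u).den σ) := by
    refine den_reps (vs := [13]) (by decide) (by simp [copy, natWrites, Instr.natWrites]; omega)
      (by simp [copy, natWrites, Instr.natWrites]; omega) I (fun P τ v x _ h => h)
      (by simp [I]) ?_
    rintro _ - P - - τ rfl hF hI c hc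
    have e14 : τ.nat 14 = σ.nat 14 := hF.nat 14 (by simp [reps, copy, natWrites, Instr.natWrites])
    have eA : τ.field A = σ.field A :=
      hF.field A (by simp [reps, copy, fieldWrites, Instr.fieldWrites]; omega)
    have e6 : τ.field 6 [] = 0 := by
      rw [hF.field 6 (by simp [reps, copy, fieldWrites, Instr.fieldWrites]), hz]
    by_cases e : c = τ.nat 13 []
    · simp [vec, mat, copy, den, Instr.exec, State.setField, State.getField, State.idx, e, e14, eA,
        e6]
    · rw [← hI c (by simpa [e] using hc)]
      simp [vec, copy, den, Instr.exec, State.setField, State.getField, State.idx, e]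
  intro c hc
  exact h c (by simp [mem_box, hc])

/-- The values in array `4` and the saved pivot in array `5` are not changed, so all rows are
reduced with the same data. The invariants also record that rows and entries not yet reached are
untouched. -/
theorem den_eliminate {A u : ℕ} (hA : 9 < A) (hu : 24 < u) (σ : State K) :
    ∀ s < σ.nat u [], ∀ c < σ.nat u [], mat ((eliminate A u).den σ) A s c =
      mat σ A s c - vec σ 4 s / vec σ 4 (σ.nat 14 []) * vec σ 5 c := by
  let I : Finset (List ℕ) → State K → Prop := fun P τ =>
    (∀ s, [s] ∈ P → ∀ c < σ.nat u [], mat τ A s c =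
      mat σ A s c - vec σ 4 s / vec σ 4 (σ.nat 14 []) * vec σ 5 c) ∧
    (∀ s, [s] ∉ P → ∀ c, mat τ A s c = mat σ A s c)
  have h : I (box (σ.nat u []) 1) ((eliminate A u).den σ) := by
    refine den_reps (vs := [12]) (by decide) (by simp [reps, natWrites, Instr.natWrites]; omega)
      (by simp [reps, natWrites, Instr.natWrites]; omega) I (fun P τ v x _ h => h)
      (by simp [I]) ?_
    rintro _ - P - hP τ rfl hF ⟨hI₁, hI₂⟩
    set a := τ.nat 12 [] with ha
    simp only [List.map_cons, List.map_nil] at hP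
    set τ' := (instr (.fieldDiv ⟨8, []⟩ ⟨4, [12]⟩ ⟨4, [14]⟩)).den τ with hτ'
    have hA8 : A ≠ 8 := by omega
    have hA7 : A ≠ 7 := by omega
    have hA5 : (5 : ℕ) ≠ A := by omega
    have e14 : τ.nat 14 = σ.nat 14 := hF.nat 14 (by simp [reps, natWrites, Instr.natWrites])
    have e4 : τ.field 4 = σ.field 4 :=
      hF.field 4 (by simp [reps, fieldWrites, Instr.fieldWrites]; omega)
    have e5 : τ.field 5 = σ.field 5 :=
      hF.field 5 (by simp [reps, fieldWrites, Instr.fieldWrites]; omega)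
    have hτA : τ'.field A = τ.field A := by
      simp [hτ', den, Instr.exec, State.setField, hA8]
    have hτ5 : τ'.field 5 = σ.field 5 := by
      simp [hτ', den, Instr.exec, State.setField, e5]
    have hτ8 : τ'.field 8 [] = vec σ 4 a / vec σ 4 (σ.nat 14 []) := by
      simp [hτ', den, Instr.exec, State.setField, State.idx, State.getField, e14, e4, vec, ha]
    have hτu : τ'.nat u [] = σ.nat u [] := by
      change τ.nat u [] = _
      rw [hF.nat u (by simp [reps, natWrites, Instr.natWrites]; omega)]
    let J : Finset (List ℕ) → State K → Prop := fun Q υ =>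
      (∀ c, [c] ∈ Q → mat υ A a c = mat τ A a c - τ'.field 8 [] * vec σ 5 c) ∧
      (∀ s c, s ≠ a ∨ [c] ∉ Q → mat υ A s c = mat τ A s c)
    have inner : J (box (τ'.nat u []) 1) ((reps [13] u (seq (instr (.fieldMul ⟨7, []⟩ ⟨8, []⟩ ⟨5, [13]⟩))
          (instr (.fieldSub ⟨A, [12, 13]⟩ ⟨A, [12, 13]⟩ ⟨7, []⟩)))).den τ') := by
      refine den_reps (vs := [13]) (by decide) (by simp [natWrites, Instr.natWrites]; omega)
        (by simp [natWrites, Instr.natWrites]; omega) J (fun P τ v x _ h => h) ?_ ?_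
      · simp [J, mat, hτA]
      · rintro _ - Q - hQ υ rfl hFυ ⟨h₁, h₂⟩
        simp only [List.map_cons, List.map_nil] at hQ
        have e12 : υ.nat 12 [] = a := by
          rw [hFυ.nat 12 (by simp [reps, natWrites, Instr.natWrites])]; rfl
        have e5 : υ.field 5 = σ.field 5 := by
          rw [hFυ.field 5 (by simp [reps, fieldWrites, Instr.fieldWrites]; omega), hτ5]
        have e8 : υ.field 8 = τ'.field 8 := by
          rw [hFυ.field 8 (by simp [reps, fieldWrites, Instr.fieldWrites]; omega)]
        have hsub : ∀ s c, mat ((seq (instr (.fieldMul ⟨7, []⟩ ⟨8, []⟩ ⟨5, [13]⟩))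
            (instr (.fieldSub ⟨A, [12, 13]⟩ ⟨A, [12, 13]⟩ ⟨7, []⟩))).den υ) A s c =
            if s = a ∧ c = υ.nat 13 [] then mat υ A s c - τ'.field 8 [] * vec σ 5 c
            else mat υ A s c := by
          intro s c
          by_cases e : s = a ∧ c = υ.nat 13 [] <;>
          simp [mat, vec, den, Instr.exec, State.setField, State.idx, State.getField, e12, e5, e8,
            e, hA7]
        constructor
        · intro c hc
          rw [hsub]
          by_cases e : c = υ.nat 13 []
          · rw [if_pos ⟨rfl, e⟩, h₂ a c (.inr (e ▸ hQ))]
          · rw [if_neg fun h => e h.2]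
            exact h₁ c (by simpa [e] using hc)
        · intro s c hsc
          rw [hsub, if_neg]
          · exact h₂ s c (hsc.imp_right fun h h' => h (mem_insert_of_mem h'))
          · rintro ⟨rfl, rfl⟩
            rcases hsc with h | h
            · exact h rfl
            · exact h (by simp)
    simp only [J, hτu, hτ8] at inner
    obtain ⟨in₁, in₂⟩ := inner
    constructor
    · intro s hs c hc
      by_cases e : s = a
      · subst e
        refine (in₁ c (by simp [mem_box, hc])).trans ?_
        rw [hI₂ _ hP]
      · refine (in₂ s c (.inl e)).trans ?_
        exact hI₁ s (by simpa [e, ← ha] using hs) c hc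
    · intro s hs c
      have e : s ≠ a := fun e => hs (by simp [e, ha])
      refine (in₂ s c (.inl e)).trans ?_
      exact hI₂ s (fun h => hs (mem_insert_of_mem h)) c
  intro s hs c hc
  exact h.1 s (by simp [mem_box, hs]) c hc

theorem den_absorb {A u : ℕ} (hA : 9 < A) (hu : 24 < u) (σ : State K) (hz : σ.field 6 [] = 0)
    (hz' : σ.nat 28 [] = 0) (hC : 0 < σ.nat u []) :
    ∃ p, IsPivot (σ.nat u []) (fun s => dot (σ.nat u []) (vec σ 3) (mat σ A s)) p ∧
      ∀ s < σ.nat u [], ∀ c < σ.nat u [], mat ((absorb A u).den σ) A s c =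
        mat σ A s c - dot (σ.nat u []) (vec σ 3) (mat σ A s) /
          dot (σ.nat u []) (vec σ 3) (mat σ A p) * mat σ A p c := by
  set τ₁ := (dots A u).den σ with h₁
  set τ₂ := (findPivot u).den τ₁ with h₂
  set τ₃ := (savePivot A u).den τ₂ with h₃
  have F₁ := frame_den (dots A u) σ
  have F₂ := frame_den (findPivot u) τ₁
  have F₃ := frame_den (savePivot A u) τ₂
  rw [← h₁] at F₁
  rw [← h₂] at F₂
  rw [← h₃] at F₃
  have u₁ : τ₁.nat u [] = σ.nat u [] := by
    rw [F₁.nat u (by simp [dots, reps, natWrites, Instr.natWrites]; omega)]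
  have u₂ : τ₂.nat u [] = σ.nat u [] := by
    rw [F₂.nat u (by simp [findPivot, natWrites, Instr.natWrites]; omega), u₁]
  have u₃ : τ₃.nat u [] = σ.nat u [] := by
    rw [F₃.nat u (by simp [savePivot, copy, reps, natWrites, Instr.natWrites]; omega), u₂]
  have z₁ : τ₁.field 6 [] = 0 := by
    rw [F₁.field 6 (by simp [dots, reps, fieldWrites, Instr.fieldWrites]), hz]
  have f₂ : τ₂.field = τ₁.field := by
    funext a
    exact F₂.field a (by simp [findPivot, fieldWrites, Instr.fieldWrites])
  have A₁ : mat τ₁ A = mat σ A := by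
    unfold mat
    rw [F₁.field A (by simp [dots, reps, fieldWrites, Instr.fieldWrites]; omega)]
  have A₃ : mat τ₃ A = mat σ A := by
    rw [← A₁]
    unfold mat
    rw [F₃.field A (by simp [savePivot, copy, reps, fieldWrites, Instr.fieldWrites]; omega), f₂]
  have v₃ : vec τ₃ 4 = vec τ₁ 4 := by
    unfold vec
    rw [F₃.field 4 (by simp [savePivot, copy, reps, fieldWrites, Instr.fieldWrites]), f₂]
  have p₃ : τ₃.nat 14 [] = τ₂.nat 14 [] := by
    rw [F₃.nat 14 (by simp [savePivot, copy, reps, natWrites, Instr.natWrites])]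
  have d := den_dots hA hu σ
  have pv := den_findPivot hu τ₁ z₁ (by
    rw [F₁.nat 28 (by simp [dots, reps, natWrites, Instr.natWrites]), hz']) (by rw [u₁]; exact hC)
  rw [u₁, ← h₂] at pv
  have s := den_savePivot hA hu τ₂ (by rw [f₂, z₁])
  rw [u₂, ← h₃] at s
  have e := den_eliminate hA hu τ₃
  rw [u₃, A₃, v₃, p₃] at e
  refine ⟨τ₂.nat 14 [], ⟨pv.lt, fun t ht h => ?_, fun h t ht => ?_⟩, fun t ht c hc => ?_⟩
  · rw [← d t ht]; exact pv.last t ht h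
  · rw [← d t ht]
    refine pv.ne ?_ t ht
    rw [d _ pv.lt]; exact h
  · refine (e t ht c hc).trans ?_
    rw [d t ht, d _ pv.lt, s c hc]
    have : mat τ₂ A = mat σ A := by rw [← A₁]; unfold mat; rw [f₂]
    rw [this]

end Elim

end Cmd

end FDP

namespace FDP

namespace Cmd

open Finset

variable {K : Type u} [Field K]

/-! ### The environment -/

/-- The state contains the input and the tables written by `setup`. -/
structure Env (n : ℕ) (F : List ℕ → K) (τ : State K) : Prop where
  size : τ.nat 0 [] = n
  square : τ.nat 25 [] = n * n
  cube : τ.nat 26 [] = n * (n * n)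
  pairs : τ.nat 27 [] = n * n + n
  zeroNat : τ.nat 28 [] = 0
  mul : ∀ a < n, τ.nat 30 [a] = a * n
  mulSq : ∀ a < n, τ.nat 31 [a] = a * (n * n)
  pow : ∀ a < n, τ.nat 32 [a] = 5 ^ a
  input : τ.field 0 = F
  zero : τ.field 6 [] = 0

/-- A command that respects the environment. -/
def KeepsEnv (c : Cmd) : Prop :=
  (∀ a ∈ [0, 25, 26, 27, 28, 30, 31, 32], a ∉ c.natWrites) ∧ 0 ∉ c.fieldWrites ∧
    6 ∉ c.fieldWrites

instance (c : Cmd) : Decidable c.KeepsEnv := inferInstanceAs (Decidable (_ ∧ _ ∧ _))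

theorem Env.of_frame {n : ℕ} {F : List ℕ → K} {σ τ : State K} (h : Env n F σ) {c : Cmd}
    (hF : Frame c σ τ) (hc : c.KeepsEnv) : Env n F τ := by
  obtain ⟨h₁, h₂, h₃⟩ := hc
  simp only [List.mem_cons, List.not_mem_nil, or_false, forall_eq_or_imp, forall_eq] at h₁
  obtain ⟨k₁, k₂, k₃, k₄, k₅, k₆, k₇, k₈⟩ := h₁
  constructor
  · rw [hF.nat _ k₁]; exact h.size
  · rw [hF.nat _ k₂]; exact h.square
  · rw [hF.nat _ k₃]; exact h.cube
  · rw [hF.nat _ k₄]; exact h.pairs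
  · rw [hF.nat _ k₅]; exact h.zeroNat
  · rw [hF.nat _ k₆]; exact h.mul
  · rw [hF.nat _ k₇]; exact h.mulSq
  · rw [hF.nat _ k₈]; exact h.pow
  · rw [hF.field _ h₂]; exact h.input
  · rw [hF.field _ h₃]; exact h.zero

/-- Natural numbers can only be added and subtracted, so products and powers are tabulated by
accumulation; multiplication by five is computed as `4x + x`. -/
theorem env_setup {n : ℕ} (f : Fin n → MvPolynomial (Fin n) K) (ρ : ℕ → K) :
    Env n (quarticTable f) (setup.den (initState f ρ)) := by
  set σ := initState f ρ with hσ
  have hfield : (setup.den σ).field = σ.field := by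
    funext a
    exact (frame_den setup σ).field a (by
      simp [setup, block, fieldWrites, Instr.fieldWrites])
  have hn : σ.nat 0 [] = n := by simp [hσ, initState]
  have hz : σ.nat 28 [] = 0 := by simp [hσ, initState]
  set τ₁ := (instr (.natConst (var 25) 0)).den σ with h₁
  set τ₂ := (rep 6 0 (block [instr (.natAdd ⟨30, [6]⟩ (var 25) (var 28)),
    instr (.natAdd (var 25) (var 25) (var 0))])).den τ₁ with h₂
  set τ₃ := (instr (.natConst (var 26) 0)).den τ₂ with h₃
  set τ₄ := (rep 6 0 (block [instr (.natAdd ⟨31, [6]⟩ (var 26) (var 28)),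
    instr (.natAdd (var 26) (var 26) (var 25))])).den τ₃ with h₄
  set τ₅ := (instr (.natAdd (var 27) (var 25) (var 0))).den τ₄ with h₅
  set τ₆ := (instr (.natConst (var 29) 1)).den τ₅ with h₆
  set τ₇ := (rep 6 0 (block [instr (.natAdd ⟨32, [6]⟩ (var 29) (var 28)),
    instr (.natAdd (var 23) (var 29) (var 29)),
    instr (.natAdd (var 23) (var 23) (var 23)),
    instr (.natAdd (var 29) (var 23) (var 29))])).den τ₆ with h₇
  have h : setup.den σ = τ₇ := rfl
  have F₂ := frame_den (rep 6 0 (block [instr (.natAdd ⟨30, [6]⟩ (var 25) (var 28)),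
    instr (.natAdd (var 25) (var 25) (var 0))])) τ₁
  have F₄ := frame_den (rep 6 0 (block [instr (.natAdd ⟨31, [6]⟩ (var 26) (var 28)),
    instr (.natAdd (var 26) (var 26) (var 25))])) τ₃
  have F₇ := frame_den (rep 6 0 (block [instr (.natAdd ⟨32, [6]⟩ (var 29) (var 28)),
    instr (.natAdd (var 23) (var 29) (var 29)),
    instr (.natAdd (var 23) (var 23) (var 23)),
    instr (.natAdd (var 29) (var 23) (var 29))])) τ₆
  rw [← h₂] at F₂
  rw [← h₄] at F₄
  rw [← h₇] at F₇
  have n₁ : τ₁.nat 0 [] = n := by simpa [h₁, den, Instr.exec, State.setNat] using hn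
  have z₁ : τ₁.nat 28 [] = 0 := by simpa [h₁, den, Instr.exec, State.setNat] using hz
  have n₂ : τ₂.nat 0 [] = n := by rw [F₂.nat 0 (by decide), n₁]
  have z₂ : τ₂.nat 28 [] = 0 := by rw [F₂.nat 28 (by decide), z₁]
  have r₂ : τ₂.nat 25 [] = n * n ∧ ∀ a < n, τ₂.nat 30 [a] = a * n := by
    let I : ℕ → State K → Prop := fun k τ => τ.nat 25 [] = k * n ∧ ∀ a < k, τ.nat 30 [a] = a * n
    have : I (τ₁.nat 0 []) τ₂ := by
      refine den_rep I ?_ ?_ ?_ ?_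
      · intro k τ x y h
        simpa [I, State.setNat, State.idx] using h
      · intro y h
        simpa [I, State.setNat, State.idx] using h
      · simp [I, h₁, den, Instr.exec, State.setNat, State.idx]
      · rintro k τ - hk hF ⟨h, h'⟩
        have e0 : τ.nat 0 [] = n := by rw [hF.nat 0 (by decide), n₁]
        have e28 : τ.nat 28 [] = 0 := by rw [hF.nat 28 (by decide), z₁]
        constructor
        · simp [block, den, Instr.exec, State.setNat, State.getNat, State.idx, h, e0]; ring
        · intro a ha
          simp only [block, den, Instr.exec, State.setNat, State.getNat, State.idx]
          by_cases e : a = k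
          · simp [e, hk, h, e28]
          · simpa [e, hk] using h' a (by omega)
    rwa [n₁] at this
  have n₃ : τ₃.nat 0 [] = n := by simpa [h₃, den, Instr.exec, State.setNat] using n₂
  have z₃ : τ₃.nat 28 [] = 0 := by simpa [h₃, den, Instr.exec, State.setNat] using z₂
  have s₃ : τ₃.nat 25 [] = n * n := by simpa [h₃, den, Instr.exec, State.setNat] using r₂.1
  have m₃ : τ₃.nat 30 = τ₂.nat 30 := by simp [h₃, den, Instr.exec, State.setNat]
  have r₄ : τ₄.nat 26 [] = n * (n * n) ∧ ∀ a < n, τ₄.nat 31 [a] = a * (n * n) := by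
    let I : ℕ → State K → Prop := fun k τ =>
      τ.nat 26 [] = k * (n * n) ∧ ∀ a < k, τ.nat 31 [a] = a * (n * n)
    have : I (τ₃.nat 0 []) τ₄ := by
      refine den_rep I ?_ ?_ ?_ ?_
      · intro k τ x y h
        simpa [I, State.setNat, State.idx] using h
      · intro y h
        simpa [I, State.setNat, State.idx] using h
      · simp [I, h₃, den, Instr.exec, State.setNat, State.idx]
      · rintro k τ - hk hF ⟨h, h'⟩
        have e25 : τ.nat 25 [] = n * n := by rw [hF.nat 25 (by decide), s₃]
        have e28 : τ.nat 28 [] = 0 := by rw [hF.nat 28 (by decide), z₃]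
        constructor
        · simp [block, den, Instr.exec, State.setNat, State.getNat, State.idx, h, e25]; ring
        · intro a ha
          simp only [block, den, Instr.exec, State.setNat, State.getNat, State.idx]
          by_cases e : a = k
          · simp [e, hk, h, e28]
          · simpa [e, hk] using h' a (by omega)
    rwa [n₃] at this
  have n₄ : τ₄.nat 0 [] = n := by rw [F₄.nat 0 (by decide), n₃]
  have z₄ : τ₄.nat 28 [] = 0 := by rw [F₄.nat 28 (by decide), z₃]
  have s₄ : τ₄.nat 25 [] = n * n := by rw [F₄.nat 25 (by decide), s₃]
  have m₄ : τ₄.nat 30 = τ₂.nat 30 := by rw [F₄.nat 30 (by decide), m₃]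
  have n₆ : τ₆.nat 0 [] = n := by simpa [h₆, h₅, den, Instr.exec, State.setNat] using n₄
  have z₆ : τ₆.nat 28 [] = 0 := by simpa [h₆, h₅, den, Instr.exec, State.setNat] using z₄
  have r₇ : τ₇.nat 29 [] = 5 ^ n ∧ ∀ a < n, τ₇.nat 32 [a] = 5 ^ a := by
    let I : ℕ → State K → Prop := fun k τ => τ.nat 29 [] = 5 ^ k ∧ ∀ a < k, τ.nat 32 [a] = 5 ^ a
    have : I (τ₆.nat 0 []) τ₇ := by
      refine den_rep I ?_ ?_ ?_ ?_
      · intro k τ x y h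
        simpa [I, State.setNat, State.idx] using h
      · intro y h
        simpa [I, State.setNat, State.idx] using h
      · simp [I, h₆, den, Instr.exec, State.setNat, State.idx]
      · rintro k τ - hk hF ⟨h, h'⟩
        have e28 : τ.nat 28 [] = 0 := by rw [hF.nat 28 (by decide), z₆]
        constructor
        · simp [block, den, Instr.exec, State.setNat, State.getNat, State.idx, h]; ring
        · intro a ha
          simp only [block, den, Instr.exec, State.setNat, State.getNat, State.idx]
          by_cases e : a = k
          · simp [e, hk, h, e28]
          · simpa [e, hk] using h' a (by omega)
    rwa [n₆] at this
  rw [h]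
  constructor
  · rw [F₇.nat 0 (by decide), n₆]
  · rw [F₇.nat 25 (by decide)]; simpa [h₆, h₅, den, Instr.exec, State.setNat] using s₄
  · rw [F₇.nat 26 (by decide)]; simpa [h₆, h₅, den, Instr.exec, State.setNat] using r₄.1
  · rw [F₇.nat 27 (by decide)]
    simp [h₆, h₅, den, Instr.exec, State.setNat, State.getNat, State.idx, s₄, n₄]
  · rw [F₇.nat 28 (by decide), z₆]
  · rw [F₇.nat 30 (by decide)]
    simpa [h₆, h₅, den, Instr.exec, State.setNat, m₄] using r₂.2
  · rw [F₇.nat 31 (by decide)]; simpa [h₆, h₅, den, Instr.exec, State.setNat] using r₄.2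
  · exact r₇.2
  · rw [← h, hfield]; funext l; simp [hσ, initState]
  · rw [← h, hfield]; simp [hσ, initState]

/-! ### Loops of elimination steps -/

/-- Common to the three eliminations: the body writes an equation that depends only on the loop
indices, then absorbs it. The last clause iterates `KernelBasis.le_pivot`: solutions that restrict
to unit vectors on the first `m` unknowns protect these unknowns in every step. -/
theorem den_absorb_loop {n : ℕ} {F : List ℕ → K} {vs : List ℕ} {A u C : ℕ} {fill : Cmd}
    {σ : State K} (hσ : Env n F σ) (hA : 9 < A) (hu : 24 < u) (hu28 : u ∈ [25, 26, 27])
    (hC : 0 < C) (hσC : σ.nat u [] = C)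
    (hvs : vs.Nodup) (hv : ∀ v ∈ vs, v ≠ 2 ∧ v ≠ 0 ∧ v ∉ (seq fill (absorb A u)).natWrites)
    (hE : (reps vs 0 (seq fill (absorb A u))).KeepsEnv) (hAf : A ∉ fill.fieldWrites)
    (hrow : List ℕ → ℕ → K)
    (hfill : ∀ t ∈ box n vs.length, ∀ τ, vs.map (fun v => τ.nat v []) = t →
      Frame (reps vs 0 (seq fill (absorb A u))) σ τ → ∀ c < C, vec (fill.den τ) 3 c = hrow t c)
    (h₀ : KernelBasis C (mat σ A) (range C) ∅) :
    ∃ S, KernelBasis C (mat ((reps vs 0 (seq fill (absorb A u))).den σ) A) S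
        (hrow '' (box n vs.length)) ∧
      ∀ m ≤ C, ∀ y : ℕ → ℕ → K, (∀ i < m, ∀ t ∈ box n vs.length, dot C (hrow t) (y i) = 0) →
        (∀ i < m, ∀ j < m, y i j = if i = j then 1 else 0) → range m ⊆ S := by
  have h0w : ∀ a ∈ [0, 25, 26, 27, 28, 30, 31, 32], a ∉ (seq fill (absorb A u)).natWrites :=
    fun a ha h => hE.1 a ha (natWrites_reps_subset vs 0 _ h)
  have hfillE : fill.KeepsEnv := by
    refine ⟨fun a ha h => h0w a ha (by simp [natWrites, h]), fun h => hE.2.1 ?_,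
      fun h => hE.2.2 ?_⟩ <;> simp [fieldWrites_reps, fieldWrites, h]
  have huE : ∀ {c : Cmd}, c.KeepsEnv → u ∉ c.natWrites := by
    intro c hc
    exact hc.1 u (by
      simp only [List.mem_cons, List.not_mem_nil, or_false] at hu28 ⊢; tauto)
  let I : Finset (List ℕ) → State K → Prop := fun P τ =>
    ∃ S, KernelBasis C (mat τ A) S (hrow '' P) ∧
      ∀ m ≤ C, ∀ y : ℕ → ℕ → K, (∀ i < m, ∀ t ∈ box n vs.length, dot C (hrow t) (y i) = 0) →
        (∀ i < m, ∀ j < m, y i j = if i = j then 1 else 0) → range m ⊆ S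
  have key : I (box (σ.nat 0 []) vs.length) ((reps vs 0 (seq fill (absorb A u))).den σ) := by
    refine den_reps hvs hv ⟨by decide, h0w 0 (by decide)⟩ I (fun P τ v x _ h => h) ?_ ?_
    · exact ⟨range C, by simpa using h₀, fun m hm y _ _ => range_subset_range.2 hm⟩
    · rintro t ht P hP - τ hτ hF ⟨S, hS, hS'⟩
      rw [hσ.size] at ht hP
      have hτE := hσ.of_frame hF hE
      have hfF := frame_den fill τ
      have hτE' := hτE.of_frame hfF hfillE
      set τ' := fill.den τ with hτ'
      have hτu : τ'.nat u [] = C := by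
        rw [hfF.nat u (huE hfillE), hF.nat u (huE hE), hσC]
      obtain ⟨p, hp, hN⟩ := den_absorb hA hu τ' hτE'.zero hτE'.zeroNat (by omega)
      rw [hτu] at hp hN
      have hmat : mat τ' A = mat τ A := by unfold mat; rw [hfF.field A hAf]
      have hr : ∀ s, dot C (vec τ' 3) (mat τ' A s) = dot C (hrow t) (mat τ A s) := fun s =>
        dot_congr (hfill t ht τ hτ hF) (fun c _ => by rw [hmat])
      simp only [hr] at hp hN
      rw [hmat] at hN
      have hd : (seq fill (absorb A u)).den τ = (absorb A u).den τ' := rfl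
      refine ⟨_, by rw [coe_insert, Set.image_insert_eq, hd]; exact hS.absorb hp hN, ?_⟩
      intro m hm y hy hyy
      have hmS := hS' m hm y hy hyy
      split_ifs with hvp
      · exact hmS
      · have : m ≤ p := by
          refine hS.le_pivot hmS hp y (fun i hi z hz => ?_) hyy hvp
          rcases hz with rfl | ⟨t', ht', rfl⟩
          · exact hy i hi t ht
          · exact hy i hi t' (hP ht')
        intro i hi
        exact mem_erase.2 ⟨by have := mem_range.1 hi; omega, hmS hi⟩
  rwa [hσ.size] at key

/-! ### The annihilator of the partial derivatives -/

theorem index₃_lt {n a b c : ℕ} (ha : a < n) (hb : b < n) (hc : c < n) :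
    a * (n * n) + b * n + c < n * (n * n) := by
  have h1 : b * n + c < n * n := by nlinarith
  nlinarith

theorem index₃_div {n a b c : ℕ} (hb : b < n) (hc : c < n) :
    (a * (n * n) + b * n + c) / (n * n) = a ∧ (a * (n * n) + b * n + c) / n % n = b ∧
      (a * (n * n) + b * n + c) % n = c := by
  have hn : 0 < n := by omega
  have e : a * (n * n) + b * n + c = c + n * (b + n * a) := by ring
  have h1 : (a * (n * n) + b * n + c) / n = b + n * a := by
    rw [e, Nat.add_mul_div_left _ _ hn, Nat.div_eq_of_lt hc, zero_add]
  refine ⟨?_, ?_, ?_⟩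
  · rw [← Nat.div_div_eq_div_mul, h1, Nat.add_mul_div_left _ _ hn, Nat.div_eq_of_lt hb, zero_add]
  · rw [h1, Nat.add_mul_mod_self_left, Nat.mod_eq_of_lt hb]
  · rw [e, Nat.add_mul_mod_self_left, Nat.mod_eq_of_lt hc]

theorem index₂_div {n a b : ℕ} (hb : b < n) : (a * n + b) / n = a ∧ (a * n + b) % n = b := by
  have hn : 0 < n := by omega
  rw [add_comm, mul_comm]
  exact ⟨by rw [Nat.add_mul_div_left _ _ hn, Nat.div_eq_of_lt hb, zero_add],
    by rw [Nat.add_mul_mod_self_left, Nat.mod_eq_of_lt hb]⟩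

theorem exists_index₃ {n x : ℕ} (hx : x < n * (n * n)) :
    ∃ a < n, ∃ b < n, ∃ c < n, x = a * (n * n) + b * n + c := by
  have hn : 0 < n := Nat.pos_of_ne_zero fun h => by simp [h] at hx
  refine ⟨x / (n * n), Nat.div_lt_of_lt_mul (by linarith), x / n % n, Nat.mod_lt _ hn, x % n,
    Nat.mod_lt _ hn, ?_⟩
  rw [← Nat.div_div_eq_div_mul]
  have h1 := Nat.div_add_mod x n
  have h2 := Nat.div_add_mod (x / n) n
  calc x = n * (n * (x / n / n) + x / n % n) + x % n := by rw [h2, h1]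
    _ = _ := by ring

theorem exists_index₂ {n x : ℕ} (hx : x < n * n) : ∃ a < n, ∃ b < n, x = a * n + b := by
  have hn : 0 < n := Nat.pos_of_ne_zero fun h => by simp [h] at hx
  refine ⟨x / n, Nat.div_lt_of_lt_mul hx, x % n, Nat.mod_lt _ hn, ?_⟩
  rw [mul_comm, Nat.div_add_mod]

/-- The coefficient of `x_a x_b x_c` in a partial derivative, in terms of the coefficients of the
quartic form. -/
def derivCoeff (F : List ℕ → K) (i j a b c : ℕ) : K :=
  F [i, j, a, b, c] + (if a = j then F [i, j, a, b, c] else 0) +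
    (if b = j then F [i, j, a, b, c] else 0) + (if c = j then F [i, j, a, b, c] else 0)

/-- The vector of the coefficients of a partial derivative. -/
def derivVec (n : ℕ) (F : List ℕ → K) (t : List ℕ) (x : ℕ) : K :=
  derivCoeff F (t.getD 0 0) (t.getD 1 0) (x / (n * n)) (x / n % n) (x % n)

theorem den_index₃ {n : ℕ} {F : List ℕ → K} {τ : State K} (hτ : Env n F τ) {a b c : ℕ}
    (hc : c ≠ 17) (ha : τ.nat a [] < n) (hb : τ.nat b [] < n) :
    (index₃ a b c).den τ =
      τ.setNat (var 17) (τ.nat a [] * (n * n) + τ.nat b [] * n + τ.nat c []) := by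
  simp only [index₃, den, Instr.exec, State.setNat, State.getNat, State.idx, List.map_nil,
    List.map_cons, hτ.mul _ hb, hτ.mulSq _ ha, hc, false_and, if_false, and_self, if_true]
  congr 1
  funext x l
  split_ifs <;> rfl

theorem den_seq (p q : Cmd) (σ : State K) : (seq p q).den σ = q.den (p.den σ) := rfl

/-- Skipping is treated as adding zero, so that a conditional addition becomes a single assignment
and chains of them need no case distinctions. -/
theorem den_add_if (τ : State K) (a b : ℕ) (r s : Ref) :
    (ite (.natEq (var a) (var b)) (instr (.fieldAdd r r s)) skip).den τ =
      τ.setField r (τ.getField r + if τ.nat a [] = τ.nat b [] then τ.getField s else 0) := by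
  by_cases h : τ.nat a [] = τ.nat b []
  · simp [den, Cond.Holds, State.getNat, State.idx, h, Instr.exec]
  · simp only [den, Cond.Holds, State.getNat, State.idx, List.map_nil, h, if_false, add_zero]
    cases τ
    simp only [State.setField, State.getField, State.mk.injEq, true_and, and_true]
    funext x l
    split_ifs with e
    · rw [e.1, e.2]
    · rfl

theorem den_derivativeRow {n : ℕ} {F : List ℕ → K} {σ : State K} (hσ : Env n F σ) :
    ∀ a < n, ∀ b < n, ∀ c < n, vec (derivativeRow.den σ) 3 (a * (n * n) + b * n + c) =
      derivCoeff F (σ.nat 3 []) (σ.nat 4 []) a b c := by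
  let I : Finset (List ℕ) → State K → Prop := fun P τ => ∀ a b c, [a, b, c] ∈ P →
    vec τ 3 (a * (n * n) + b * n + c) = derivCoeff F (σ.nat 3 []) (σ.nat 4 []) a b c
  have h : I (box (σ.nat 0 []) 3) (derivativeRow.den σ) := by
    refine den_reps (vs := [6, 7, 8]) (by decide) (by decide) (by decide) I
      (fun P τ v x _ h => h) (by simp [I]) ?_
    rintro _ ht P hP htP τ rfl hF hI a b c habc
    have hE := hσ.of_frame hF (by decide)
    rw [hσ.size] at ht hP
    simp only [List.map_cons, List.map_nil, mem_box, List.mem_cons, List.not_mem_nil, or_false,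
      forall_eq_or_imp, forall_eq] at ht
    obtain ⟨-, ha', hb', hc'⟩ := ht
    have hbody : ∀ x, vec ((block [index₃ 6 7 8,
        copy ⟨3, [17]⟩ ⟨0, [3, 4, 6, 7, 8]⟩,
        ite (.natEq (var 6) (var 4))
          (instr (.fieldAdd ⟨3, [17]⟩ ⟨3, [17]⟩ ⟨0, [3, 4, 6, 7, 8]⟩)) skip,
        ite (.natEq (var 7) (var 4))
          (instr (.fieldAdd ⟨3, [17]⟩ ⟨3, [17]⟩ ⟨0, [3, 4, 6, 7, 8]⟩)) skip,
        ite (.natEq (var 8) (var 4))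
          (instr (.fieldAdd ⟨3, [17]⟩ ⟨3, [17]⟩ ⟨0, [3, 4, 6, 7, 8]⟩)) skip]).den τ) 3 x =
        if x = τ.nat 6 [] * (n * n) + τ.nat 7 [] * n + τ.nat 8 [] then
          derivCoeff F (σ.nat 3 []) (σ.nat 4 []) (τ.nat 6 []) (τ.nat 7 []) (τ.nat 8 [])
        else vec τ 3 x := by
      intro x
      have e3 : τ.nat 3 [] = σ.nat 3 [] := by rw [hF.nat 3 (by decide)]
      have e4 : τ.nat 4 [] = σ.nat 4 [] := by rw [hF.nat 4 (by decide)]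
      have hd := den_index₃ (a := 6) (b := 7) (c := 8) hE (by decide) ha' hb'
      simp only [block, den_seq, hd, den_add_if]
      generalize τ.nat 6 [] * (n * n) + τ.nat 7 [] * n + τ.nat 8 [] = y
      by_cases e : x = y
      · simp [vec, copy, den, Instr.exec, State.setNat, State.setField,
          State.getField, State.idx, e, e3, e4, hE.zero, hE.input, derivCoeff]
      · simp [vec, copy, den, Instr.exec, State.setNat, State.setField,
          State.getField, State.idx, e]
    refine (hbody _).trans ?_
    by_cases e : [a, b, c] = [τ.nat 6 [], τ.nat 7 [], τ.nat 8 []]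
    · simp only [List.cons.injEq, and_true] at e
      obtain ⟨rfl, rfl, rfl⟩ := e
      rw [if_pos rfl]
    · have hmem : [a, b, c] ∈ P := (mem_insert.1 habc).resolve_left e
      have hb := hP hmem
      simp only [mem_box, List.mem_cons, List.not_mem_nil, or_false,
        forall_eq_or_imp, forall_eq] at hb
      rw [if_neg, hI a b c hmem]
      intro h
      apply e
      have h1 := index₃_div (a := a) hb.2.2.1 hb.2.2.2
      have h2 := index₃_div (a := τ.nat 6 []) hb' hc'
      rw [← h] at h2
      rw [h1.1.symm.trans h2.1, h1.2.1.symm.trans h2.2.1, h1.2.2.symm.trans h2.2.2]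
  intro a ha b hb c hc
  exact h a b c (by simp [mem_box, hσ.size, ha, hb, hc])

theorem den_annihilator {n : ℕ} {F : List ℕ → K} {σ : State K} (hσ : Env n F σ) (hn : 0 < n) :
    ∃ S, KernelBasis (n * (n * n)) (mat (annihilator.den σ) 10) S (derivVec n F '' (box n 2)) := by
  have hF₁ := frame_den (initBasis 10 26) σ
  have hE₁ := hσ.of_frame hF₁ (by decide)
  have h₀ := den_initBasis (A := 10) (u := 26) (by decide) σ
  rw [hσ.cube] at h₀
  obtain ⟨S, hS, -⟩ := den_absorb_loop (vs := [3, 4]) (A := 10) (u := 26) (fill := derivativeRow)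
    hE₁ (by decide) (by decide) (by decide) (by positivity) hE₁.cube (by decide) (by decide)
    (by decide) (by decide) (derivVec n F) (by
      rintro _ ht τ rfl hF c hc
      have hE := hE₁.of_frame hF (by decide)
      obtain ⟨a, ha, b, hb, c, hc', rfl⟩ := exists_index₃ hc
      rw [den_derivativeRow hE a ha b hb c hc']
      obtain ⟨d₁, d₂, d₃⟩ := index₃_div (a := a) hb hc'
      simp [derivVec, d₁, d₂, d₃]) (KernelBasis.initial _ _ h₀)
  exact ⟨S, hS⟩

end Cmd

end FDP

namespace FDP

namespace Cmd

open Finset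

variable {K : Type u} [Field K]

/-! ### The quotient -/

theorem Env.setNat {n : ℕ} {F : List ℕ → K} {τ : State K} (h : Env n F τ) {r : Ref} {x : ℕ}
    (hr : r.arr ∉ [0, 25, 26, 27, 28, 30, 31, 32]) : Env n F (τ.setNat r x) := by
  simp only [List.mem_cons, List.not_mem_nil, or_false, not_or, ne_comm (a := r.arr)] at hr
  obtain ⟨k₁, k₂, k₃, k₄, k₅, k₆, k₇, k₈⟩ := hr
  constructor <;> simp [State.setNat, *, h.size, h.square, h.cube, h.pairs, h.zeroNat, h.input,
    h.zero] <;> first | exact h.mul | exact h.mulSq | exact h.pow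

theorem Env.setField {n : ℕ} {F : List ℕ → K} {τ : State K} (h : Env n F τ) {r : Ref} {x : K}
    (hr : r.arr ∉ [0, 6]) : Env n F (τ.setField r x) := by
  simp only [List.mem_cons, List.not_mem_nil, or_false, not_or, ne_comm (a := r.arr)] at hr
  exact ⟨h.size, h.square, h.cube, h.pairs, h.zeroNat, h.mul, h.mulSq, h.pow,
    by simp [State.setField, hr.1, h.input], by simp [State.setField, hr.2, h.zero]⟩

theorem setField_add_zero (τ : State K) (r : Ref) : τ.setField r (τ.getField r + 0) = τ := by
  cases τ
  simp only [add_zero, State.setField, State.getField, State.mk.injEq, true_and, and_true]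
  funext x l
  split_ifs with e
  · rw [e.1, e.2]
  · rfl

theorem den_add_unless (τ : State K) (a b : ℕ) (r s : Ref) :
    (ite (.natEq (var a) (var b)) skip (instr (.fieldAdd r r s))).den τ =
      τ.setField r (τ.getField r + if τ.nat a [] = τ.nat b [] then 0 else τ.getField s) := by
  by_cases h : τ.nat a [] = τ.nat b []
  · simp only [h, if_true, setField_add_zero]
    simp [den, Cond.Holds, State.getNat, State.idx, h]
  · simp [den, Cond.Holds, State.getNat, State.idx, h, Instr.exec]

theorem den_add_unless_or (τ : State K) (a b c d : ℕ) (r s : Ref) :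
    (ite (.natEq (var a) (var b)) skip (ite (.natEq (var c) (var d)) skip
      (instr (.fieldAdd r r s)))).den τ =
      τ.setField r (τ.getField r + if τ.nat a [] = τ.nat b [] ∨ τ.nat c [] = τ.nat d [] then 0
        else τ.getField s) := by
  by_cases h : τ.nat a [] = τ.nat b []
  · simp only [h, true_or, if_true, setField_add_zero]
    simp [den, Cond.Holds, State.getNat, State.idx, h]
  · rw [den, if_neg (by simpa [Cond.Holds, State.getNat, State.idx] using h), den_add_unless]
    simp [h]

/-- The value at the product of `x_k` and `x_d x_e` of a functional on tables of cubic forms. -/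
def quotCoeff (n : ℕ) (y : ℕ → K) (k d e : ℕ) : K :=
  -- The table of `x_k x_d x_e` is read at the three positions that the factor `x_k` can take; the
  -- conditions make each position count once, in accordance with the order of the cases in `xMul`.
  y (k * (n * n) + d * n + e) + (if d = k then 0 else y (d * (n * n) + k * n + e)) +
    (if d = k ∨ e = k then 0 else y (d * (n * n) + e * n + k))

/-- The vector with the entries `quotCoeff`. -/
def quotVec (n : ℕ) (N : ℕ → ℕ → K) (t : List ℕ) (x : ℕ) : K :=
  quotCoeff n (N (t.getD 0 0 * (n * n) + t.getD 1 0 * n + t.getD 2 0)) (t.getD 3 0) (x / n) (x % n)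

theorem den_quotientRow {n : ℕ} {F : List ℕ → K} {σ : State K} (hσ : Env n F σ)
    (hk : σ.nat 5 [] < n) :
    ∀ d < n, ∀ e < n, vec (quotientRow.den σ) 3 (d * n + e) =
      quotCoeff n (mat σ 10 (σ.nat 16 [])) (σ.nat 5 []) d e := by
  let I : Finset (List ℕ) → State K → Prop := fun P τ => ∀ d e, [d, e] ∈ P →
    vec τ 3 (d * n + e) = quotCoeff n (mat σ 10 (σ.nat 16 [])) (σ.nat 5 []) d e
  have h : I (box (σ.nat 0 []) 2) (quotientRow.den σ) := by
    refine den_reps (vs := [6, 7]) (by decide) (by decide) (by decide) I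
      (fun P τ v x _ h => h) (by simp [I]) ?_
    rintro _ ht P hP htP τ rfl hF hI d e hde
    have hE := hσ.of_frame hF (by decide)
    rw [hσ.size] at ht hP
    simp only [List.map_cons, List.map_nil, mem_box, List.mem_cons, List.not_mem_nil, or_false,
      forall_eq_or_imp, forall_eq] at ht
    obtain ⟨-, hd', he'⟩ := ht
    have e5 : τ.nat 5 [] = σ.nat 5 [] := by rw [hF.nat 5 (by decide)]
    have e16 : τ.nat 16 [] = σ.nat 16 [] := by rw [hF.nat 16 (by decide)]
    have e10 : τ.field 10 = σ.field 10 := by rw [hF.field 10 (by decide)]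
    have hbody : ∀ x, vec ((block [
        instr (.natAdd (var 18) ⟨30, [6]⟩ (var 7)),
        index₃ 5 6 7,
        copy ⟨3, [18]⟩ ⟨10, [16, 17]⟩,
        index₃ 6 5 7,
        ite (.natEq (var 6) (var 5)) skip
          (instr (.fieldAdd ⟨3, [18]⟩ ⟨3, [18]⟩ ⟨10, [16, 17]⟩)),
        index₃ 6 7 5,
        ite (.natEq (var 6) (var 5)) skip (ite (.natEq (var 7) (var 5)) skip
          (instr (.fieldAdd ⟨3, [18]⟩ ⟨3, [18]⟩ ⟨10, [16, 17]⟩)))]).den τ) 3 x =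
        if x = τ.nat 6 [] * n + τ.nat 7 [] then
          quotCoeff n (mat σ 10 (σ.nat 16 [])) (σ.nat 5 []) (τ.nat 6 []) (τ.nat 7 [])
        else vec τ 3 x := by
      intro x
      simp only [block, den_seq, den_add_unless, den_add_unless_or]
      set τ₁ := (instr (.natAdd (var 18) ⟨30, [6]⟩ (var 7))).den τ with h₁
      have h₁' : τ₁ = τ.setNat (var 18) (τ.nat 6 [] * n + τ.nat 7 []) := by
        simp [h₁, den, Instr.exec, State.getNat, State.idx, hE.mul _ hd']
      have E₁ : Env n F τ₁ := by rw [h₁']; exact hE.setNat (by decide)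
      have h₂ := den_index₃ (a := 5) (b := 6) (c := 7) E₁ (by decide)
        (by simp [h₁', State.setNat, e5, hk]) (by simp [h₁', State.setNat, hd'])
      rw [h₂]
      have E₂ := E₁.setNat (r := var 17)
        (x := τ₁.nat 5 [] * (n * n) + τ₁.nat 6 [] * n + τ₁.nat 7 []) (by decide)
      set τ₂ := τ₁.setNat (var 17)
        (τ₁.nat 5 [] * (n * n) + τ₁.nat 6 [] * n + τ₁.nat 7 []) with h₂'
      set τ₃ := (copy ⟨3, [18]⟩ ⟨10, [16, 17]⟩).den τ₂ with h₃
      have E₃ : Env n F τ₃ := E₂.setField (r := ⟨3, [18]⟩) (by decide)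
      have h₄ := den_index₃ (a := 6) (b := 5) (c := 7) E₃ (by decide)
        (by simp [h₃, h₂', h₁', copy, den, Instr.exec, State.setField, State.setNat, hd'])
        (by simp [h₃, h₂', h₁', copy, den, Instr.exec, State.setField, State.setNat, e5, hk])
      rw [h₄]
      have E₄ := E₃.setNat (r := var 17)
        (x := τ₃.nat 6 [] * (n * n) + τ₃.nat 5 [] * n + τ₃.nat 7 []) (by decide)
      set τ₄ := τ₃.setNat (var 17)
        (τ₃.nat 6 [] * (n * n) + τ₃.nat 5 [] * n + τ₃.nat 7 []) with h₄'
      have E₅ := E₄.setField (r := ⟨3, [18]⟩) (x := τ₄.getField ⟨3, [18]⟩ +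
        if τ₄.nat 6 [] = τ₄.nat 5 [] then 0 else τ₄.getField ⟨10, [16, 17]⟩) (by decide)
      set τ₅ := τ₄.setField ⟨3, [18]⟩ (τ₄.getField ⟨3, [18]⟩ +
        if τ₄.nat 6 [] = τ₄.nat 5 [] then 0 else τ₄.getField ⟨10, [16, 17]⟩) with h₅
      have h₆ := den_index₃ (a := 6) (b := 7) (c := 5) E₅ (by decide)
        (by simp [h₅, h₄', h₃, h₂', h₁', copy, den, Instr.exec, State.setField, State.setNat, hd'])
        (by simp [h₅, h₄', h₃, h₂', h₁', copy, den, Instr.exec, State.setField, State.setNat, he'])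
      rw [h₆]
      have z : τ.field 6 [] = 0 := hE.zero
      have n5 : τ₅.nat = τ₄.nat := rfl
      have n3 : τ₃.nat = τ₂.nat := rfl
      simp only [n5]
      by_cases e : x = τ.nat 6 [] * n + τ.nat 7 []
      · rw [if_pos e]
        simp [h₅, h₄', h₃, h₂', h₁', vec, copy, den, Instr.exec, State.setNat, State.setField,
          State.getField, State.idx, e, e5, e16, e10, z, quotCoeff, mat]
      · rw [if_neg e]
        simp [h₅, h₄', h₃, h₂', h₁', vec, copy, den, Instr.exec, State.setNat, State.setField,
          State.idx, e]
    refine (hbody _).trans ?_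
    by_cases e' : [d, e] = [τ.nat 6 [], τ.nat 7 []]
    · simp only [List.cons.injEq, and_true] at e'
      obtain ⟨rfl, rfl⟩ := e'
      rw [if_pos rfl]
    · have hmem : [d, e] ∈ P := (mem_insert.1 hde).resolve_left e'
      have hb := hP hmem
      simp only [mem_box, List.mem_cons, List.not_mem_nil, or_false,
        forall_eq_or_imp, forall_eq] at hb
      rw [if_neg, hI d e hmem]
      intro h
      apply e'
      have h1 := index₂_div (a := d) hb.2.2
      have h2 := index₂_div (a := τ.nat 6 []) he'
      rw [← h] at h2
      rw [h1.1.symm.trans h2.1, h1.2.symm.trans h2.2]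
  intro d hd e he
  exact h d e (by simp [mem_box, hσ.size, hd, he])

theorem den_quotient {n : ℕ} {F : List ℕ → K} {σ : State K} (hσ : Env n F σ) (hn : 0 < n) :
    ∃ S, KernelBasis (n * n) (mat (quotient.den σ) 11) S (quotVec n (mat σ 10) '' (box n 4)) := by
  have hF₁ := frame_den (initBasis 11 25) σ
  have hE₁ := hσ.of_frame hF₁ (by decide)
  have h₀ := den_initBasis (A := 11) (u := 25) (by decide) σ
  rw [hσ.square] at h₀
  obtain ⟨S, hS, -⟩ := den_absorb_loop (vs := [3, 4, 10, 5]) (A := 11) (u := 25)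
    (fill := seq (index₃ 3 4 10) (seq (instr (.natAdd (var 16) (var 17) (var 28))) quotientRow))
    hE₁ (by decide) (by decide) (by decide) (by positivity) hE₁.square (by decide) (by decide)
    (by decide) (by decide) (quotVec n (mat σ 10)) (by
      rintro _ ht τ rfl hF c hc
      have hE := hE₁.of_frame hF (by decide)
      simp only [List.map_cons, List.map_nil, mem_box, List.mem_cons, List.not_mem_nil, or_false,
        forall_eq_or_imp, forall_eq] at ht
      obtain ⟨-, t₁, t₂, t₃, t₄⟩ := ht
      obtain ⟨a, ha, b, hb, rfl⟩ := exists_index₂ hc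
      rw [den_seq, den_seq, den_index₃ hE (by decide) t₁ t₂]
      have E' : Env n F ((instr (.natAdd (var 16) (var 17) (var 28))).den (τ.setNat (var 17)
          (τ.nat 3 [] * (n * n) + τ.nat 4 [] * n + τ.nat 10 []))) :=
        (hE.setNat (r := var 17) (by decide)).setNat (r := var 16) (by decide)
      rw [den_quotientRow E' (by simpa [den, Instr.exec, State.setNat] using t₄) a ha b hb]
      obtain ⟨d₁, d₂⟩ := index₂_div (a := a) hb
      have z := hE.zeroNat
      have e10 : τ.field 10 = σ.field 10 := by
        rw [hF.field 10 (by decide), hF₁.field 10 (by decide)]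
      have hm : ∀ υ : State K, υ.field 10 = σ.field 10 → mat υ 10 = mat σ 10 := fun υ h => by
        unfold mat; rw [h]
      simp [quotVec, d₁, d₂, den, Instr.exec, State.setNat, State.getNat, State.idx, z]
      rw [hm]
      exact e10)
    (KernelBasis.initial _ _ h₀)
  exact ⟨S, hS⟩

/-! ### The right factor -/

open Classical in
/-- The number of nonzero diagonal entries before the row `k`. -/
noncomputable def rankBefore (N : ℕ → ℕ → K) (k : ℕ) : ℕ := #{s ∈ range k | N s s ≠ 0}

theorem rankBefore_succ_of_eq {N : ℕ → ℕ → K} {k : ℕ} (h : N k k = 0) :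
    rankBefore N (k + 1) = rankBefore N k := by
  simp [rankBefore, range_add_one, filter_insert, h]

theorem rankBefore_succ_of_ne {N : ℕ → ℕ → K} {k : ℕ} (h : N k k ≠ 0) :
    rankBefore N (k + 1) = rankBefore N k + 1 := by
  rw [rankBefore, range_add_one, filter_insert, if_pos h, card_insert_of_notMem (by simp)]
  rfl

theorem rankBefore_mono {N : ℕ → ℕ → K} {k l : ℕ} (h : k ≤ l) : rankBefore N k ≤ rankBefore N l := by
  classical
  exact card_le_card (filter_subset_filter _ (range_subset_range.2 h))

/-- The nonzero rows are copied to consecutive slots. The rank of a nonzero row is strictly below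
that of any later one, so no slot is overwritten. -/
theorem den_extract {n : ℕ} {F : List ℕ → K} {σ : State K} (hσ : Env n F σ) :
    ∀ s < n * n, mat σ 11 s s ≠ 0 → ∀ a < n, ∀ b < n,
      (extract.den σ).field 2 [rankBefore (mat σ 11) s, a, b] = mat σ 11 s (a * n + b) := by
  set σ' := (instr (.natConst (var 15) 0)).den σ with hσ'
  have hE : Env n F σ' := hσ.setNat (r := var 15) (by decide)
  let I : ℕ → State K → Prop := fun k τ => τ.nat 15 [] = rankBefore (mat σ 11) k ∧
    ∀ s < k, mat σ 11 s s ≠ 0 → ∀ a < n, ∀ b < n,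
      τ.field 2 [rankBefore (mat σ 11) s, a, b] = mat σ 11 s (a * n + b)
  have h : I (σ'.nat 25 []) (extract.den σ) := by
    refine den_rep (σ := σ') I ?_ ?_ ?_ ?_
    · intro k υ x y h
      simpa [I, State.setNat, State.idx] using h
    · intro y h
      simpa [I, State.setNat, State.idx] using h
    · simp [I, hσ', den, Instr.exec, State.setNat, State.idx, rankBefore]
    · rintro k τ - hk hF ⟨h₁, h₂⟩
      have Eτ := hE.of_frame hF (by decide)
      have e11 : τ.field 11 = σ.field 11 := by rw [hF.field 11 (by decide)]; rfl
      by_cases hN : mat σ 11 k k = 0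
      · have : (ite (.fieldEq ⟨11, [12, 12]⟩ zeroCell) skip
            (seq (reps [6, 7] 0 (seq (instr (.natAdd (var 17) ⟨30, [6]⟩ (var 7)))
            (copy ⟨2, [15, 6, 7]⟩ ⟨11, [12, 17]⟩)))
            (seq (instr (.natConst (var 18) 1)) (instr (.natAdd (var 15) (var 15) (var 18)))))).den τ
            = τ := by
          rw [den, if_pos]
          · rfl
          · simp only [Cond.Holds, State.getField, State.idx, List.map_cons, List.map_nil, hk, e11,
              Eτ.zero]
            exact hN
        rw [this]
        refine ⟨by rw [h₁, rankBefore_succ_of_eq hN], fun s hs hsN => ?_⟩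
        rcases Nat.lt_succ_iff_lt_or_eq.1 hs with hs | rfl
        · exact h₂ s hs hsN
        · exact absurd hN hsN
      · set τ' := (reps [6, 7] 0 (seq (instr (.natAdd (var 17) ⟨30, [6]⟩ (var 7)))
            (copy ⟨2, [15, 6, 7]⟩ ⟨11, [12, 17]⟩))).den τ with hτ'
        have F' := frame_den (reps [6, 7] 0 (seq (instr (.natAdd (var 17) ⟨30, [6]⟩ (var 7)))
            (copy ⟨2, [15, 6, 7]⟩ ⟨11, [12, 17]⟩))) τ
        rw [← hτ'] at F'
        have : (ite (.fieldEq ⟨11, [12, 12]⟩ zeroCell) skip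
            (seq (reps [6, 7] 0 (seq (instr (.natAdd (var 17) ⟨30, [6]⟩ (var 7)))
            (copy ⟨2, [15, 6, 7]⟩ ⟨11, [12, 17]⟩)))
            (seq (instr (.natConst (var 18) 1)) (instr (.natAdd (var 15) (var 15) (var 18)))))).den τ
            = (τ'.setNat (var 18) 1).setNat (var 15) (τ'.nat 15 [] + 1) := by
          rw [den, if_neg]
          · simp [den, Instr.exec, State.getNat, State.setNat, State.idx, hτ']
          · simp only [Cond.Holds, State.getField, State.idx, List.map_cons, List.map_nil, hk, e11,
              Eτ.zero]
            exact hN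
        rw [this]
        let J : Finset (List ℕ) → State K → Prop := fun P υ =>
          (∀ a b, [a, b] ∈ P → υ.field 2 [τ.nat 15 [], a, b] = mat σ 11 k (a * n + b)) ∧
          ∀ r, r ≠ τ.nat 15 [] → ∀ l, υ.field 2 (r :: l) = τ.field 2 (r :: l)
        have inner : J (box (τ.nat 0 []) 2) τ' := by
          refine den_reps (vs := [6, 7]) (by decide) (by decide) (by decide) J
            (fun P τ v x _ h => h) (by simp [J]) ?_
          rintro _ ht P hP htP υ rfl hFυ ⟨j₁, j₂⟩
          have Eυ := Eτ.of_frame hFυ (by decide)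
          rw [Eτ.size] at ht
          simp only [List.map_cons, List.map_nil, mem_box, List.mem_cons, List.not_mem_nil, or_false,
            forall_eq_or_imp, forall_eq] at ht
          obtain ⟨-, ha', hb'⟩ := ht
          have f15 : υ.nat 15 [] = τ.nat 15 [] := by rw [hFυ.nat 15 (by decide)]
          have f12 : υ.nat 12 [] = k := by rw [hFυ.nat 12 (by decide), hk]
          have f11 : υ.field 11 = σ.field 11 := by rw [hFυ.field 11 (by decide), e11]
          have hbody : ∀ l, ((seq (instr (.natAdd (var 17) ⟨30, [6]⟩ (var 7)))
              (copy ⟨2, [15, 6, 7]⟩ ⟨11, [12, 17]⟩)).den υ).field 2 l =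
              if l = [τ.nat 15 [], υ.nat 6 [], υ.nat 7 []] then
                mat σ 11 k (υ.nat 6 [] * n + υ.nat 7 []) else υ.field 2 l := by
            intro l
            simp [den, copy, Instr.exec, State.getNat, State.setNat, State.idx, State.setField,
              State.getField, f15, f12, f11, Eυ.zero, Eυ.mul _ ha', mat]
          constructor
          · intro a b hab
            rw [hbody]
            by_cases e : a = υ.nat 6 [] ∧ b = υ.nat 7 []
            · rw [if_pos (by rw [e.1, e.2]), e.1, e.2]
            · rw [if_neg (by simpa using e)]
              exact j₁ a b (by simpa [e] using hab)
          · intro r hr l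
            rw [hbody, if_neg (by simp [hr]), j₂ r hr l]
        obtain ⟨j₁, j₂⟩ := inner
        constructor
        · simp [State.setNat, State.idx]
          rw [F'.nat 15 (by decide), h₁, rankBefore_succ_of_ne hN]
        · intro s hs hsN a ha b hb
          change τ'.field 2 _ = _
          rcases Nat.lt_succ_iff_lt_or_eq.1 hs with hs | rfl
          · rw [j₂, h₂ s hs hsN a ha b hb]
            rw [h₁]
            have := rankBefore_mono (N := mat σ 11) (Nat.succ_le_of_lt hs)
            rw [Nat.succ_eq_add_one, rankBefore_succ_of_ne hsN] at this
            omega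
          · rw [← h₁]
            exact j₁ a b (by simp [mem_box, Eτ.size, ha, hb])
  rw [hE.square] at h
  exact h.2

end Cmd

end FDP

namespace FDP

namespace Cmd

open Finset

variable {K : Type u} [Field K]

/-! ### The left factor -/

/-- A number that determines a monomial of degree four. -/
def monKey (a b c d : ℕ) : ℕ := 5 ^ a + 5 ^ b + 5 ^ c + 5 ^ d

/-- A summand of a coefficient of a product of two quadratic forms. -/
def prodTerm (H : List ℕ → K) (l m κ : ℕ) : List ℕ → K
  | [a, b, c, d] => if b < a ∨ d < c then 0 else
      if monKey a b c d = κ then H [l, a, b] * H [m, c, d] else 0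
  | _ => 0

/-- A coefficient of a product of two quadratic forms. -/
def prodCoeff (n : ℕ) (H : List ℕ → K) (l m κ : ℕ) : K :=
  if m < l then 0 else ∑ t ∈ box n 4, prodTerm H l m κ t

/-- The coefficients of a monomial in the input forms and in the products of quadratic forms. -/
def compVec (n : ℕ) (F H : List ℕ → K) (t : List ℕ) (x : ℕ) : K :=
  if x < n then F (x :: t) else
    -prodCoeff n H ((x - n) / n) ((x - n) % n)
      (monKey (t.getD 0 0) (t.getD 1 0) (t.getD 2 0) (t.getD 3 0))

theorem den_monomialKey {n : ℕ} {F : List ℕ → K} {τ : State K} (hτ : Env n F τ) {r a b c d : ℕ}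
    (hr : r ≠ 32) (hcr : c ≠ r) (hdr : d ≠ r)
    (ha : τ.nat a [] < n) (hb : τ.nat b [] < n) (hc : τ.nat c [] < n) (hd : τ.nat d [] < n) :
    (monomialKey r a b c d).den τ = τ.setNat (var r)
      (monKey (τ.nat a []) (τ.nat b []) (τ.nat c []) (τ.nat d [])) := by
  simp only [monomialKey, den, Instr.exec, State.setNat, State.getNat, State.idx, List.map_nil,
    List.map_cons, hcr, hdr, hr.symm, false_and, if_false, and_self, if_true, hτ.pow _ ha,
    hτ.pow _ hb, hτ.pow _ hc, hτ.pow _ hd, monKey]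
  congr 1
  funext x l
  split_ifs <;> rfl

theorem den_productCoeff {n : ℕ} {F : List ℕ → K} {σ : State K} (hσ : Env n F σ) :
    (productCoeff.den σ).field 9 [] =
      prodCoeff n (σ.field 2) (σ.nat 10 []) (σ.nat 11 []) (σ.nat 23 []) := by
  set σ' := (instr (.fieldZero ⟨9, []⟩)).den σ with hσ'
  have hE : Env n F σ' := hσ.setField (r := ⟨9, []⟩) (by decide)
  have z : σ'.field 9 [] = 0 := by simp [hσ', den, Instr.exec, State.setField, State.idx]
  have f2 : σ'.field 2 = σ.field 2 := by simp [hσ', den, Instr.exec, State.setField]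
  rw [productCoeff, den_seq, ← hσ', den, prodCoeff]
  by_cases hlm : σ.nat 11 [] < σ.nat 10 []
  · rw [if_pos hlm, if_pos (show Cond.Holds σ' (.natLt (var 11) (var 10)) from hlm)]
    exact z
  · rw [if_neg hlm, if_neg (show ¬ Cond.Holds σ' (.natLt (var 11) (var 10)) from hlm)]
    let I : Finset (List ℕ) → State K → Prop := fun P τ => τ.field 9 [] =
      ∑ t ∈ P, prodTerm (σ.field 2) (σ.nat 10 []) (σ.nat 11 []) (σ.nat 23 []) t
    rw [← hE.size]
    refine den_reps (vs := [19, 20, 21, 22]) (by decide) (by decide) (by decide) I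
      (fun P τ v x _ h => h) (by simp [I, z]) ?_
    rintro _ ht P hP htP τ rfl hF hI
    have Eτ := hE.of_frame hF (by decide)
    rw [hE.size] at ht
    simp only [List.map_cons, List.map_nil, mem_box, List.mem_cons, List.not_mem_nil, or_false,
      forall_eq_or_imp, forall_eq] at ht
    obtain ⟨-, t₁, t₂, t₃, t₄⟩ := ht
    have e10 : τ.nat 10 [] = σ.nat 10 [] := by rw [hF.nat 10 (by decide)]; rfl
    have e11 : τ.nat 11 [] = σ.nat 11 [] := by rw [hF.nat 11 (by decide)]; rfl
    have e23 : τ.nat 23 [] = σ.nat 23 [] := by rw [hF.nat 23 (by decide)]; rfl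
    have e2 : τ.field 2 = σ.field 2 := by rw [hF.field 2 (by decide), f2]
    simp only [I, sum_insert htP]
    rw [← hI]
    simp only [List.map_cons, List.map_nil, prodTerm]
    rw [den]
    by_cases c₁ : τ.nat 20 [] < τ.nat 19 []
    · rw [if_pos (by simpa [Cond.Holds, State.getNat, State.idx] using c₁), if_pos (.inl c₁),
        zero_add]
      rfl
    · rw [if_neg (by simpa [Cond.Holds, State.getNat, State.idx] using c₁), den]
      by_cases c₂ : τ.nat 22 [] < τ.nat 21 []
      · rw [if_pos (by simpa [Cond.Holds, State.getNat, State.idx] using c₂), if_pos (.inr c₂),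
          zero_add]
        rfl
      · rw [if_neg (by simpa [Cond.Holds, State.getNat, State.idx] using c₂),
          if_neg (by simp [c₁, c₂]), den_seq, den_monomialKey Eτ (by decide) (by decide) (by decide)
            t₁ t₂ t₃ t₄, den]
        by_cases c₃ : monKey (τ.nat 19 []) (τ.nat 20 []) (τ.nat 21 []) (τ.nat 22 []) = σ.nat 23 []
        · rw [if_pos (by simpa [Cond.Holds, State.getNat, State.setNat, State.idx, e23] using c₃),
            if_pos c₃]
          simp [den, Instr.exec, State.setNat, State.setField, State.getField, State.idx, e10, e11,
            e2, add_comm]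
        · rw [if_neg (by simpa [Cond.Holds, State.getNat, State.setNat, State.idx, e23] using c₃),
            if_neg c₃, zero_add]
          rfl

theorem den_pairIndex {n : ℕ} {F : List ℕ → K} {τ : State K} (hτ : Env n F τ)
    (hl : τ.nat 10 [] < n) :
    pairIndex.den τ = τ.setNat (var 17) (n + τ.nat 10 [] * n + τ.nat 11 []) := by
  simp only [pairIndex, den, Instr.exec, State.setNat, State.getNat, State.idx, List.map_nil,
    List.map_cons, hτ.mul _ hl, hτ.size]
  simp only [show (11 : ℕ) ≠ 17 by decide, false_and, if_false, and_self, if_true]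
  congr 1
  funext x l
  split_ifs <;> rfl

theorem den_compositionRow {n : ℕ} {F : List ℕ → K} {σ : State K} (hσ : Env n F σ)
    (h₁ : σ.nat 6 [] < n) (h₂ : σ.nat 7 [] < n) (h₃ : σ.nat 8 [] < n) (h₄ : σ.nat 9 [] < n) :
    ∀ x < n * n + n, vec (compositionRow.den σ) 3 x =
      compVec n F (σ.field 2) [σ.nat 6 [], σ.nat 7 [], σ.nat 8 [], σ.nat 9 []] x := by
  set κ := monKey (σ.nat 6 []) (σ.nat 7 []) (σ.nat 8 []) (σ.nat 9 []) with hκ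
  set σ₁ := σ.setNat (var 23) κ with hσ₁
  have E₁ : Env n F σ₁ := hσ.setNat (r := var 23) (by decide)
  set σ₂ := (reps [3] 0 (copy ⟨3, [3]⟩ ⟨0, [3, 6, 7, 8, 9]⟩)).den σ₁ with hσ₂
  have F₂ := frame_den (reps [3] 0 (copy ⟨3, [3]⟩ ⟨0, [3, 6, 7, 8, 9]⟩)) σ₁
  rw [← hσ₂] at F₂
  have E₂ := E₁.of_frame F₂ (by decide)
  have r₂ : ∀ i < n, vec σ₂ 3 i = F [i, σ.nat 6 [], σ.nat 7 [], σ.nat 8 [], σ.nat 9 []] := by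
    let I : Finset (List ℕ) → State K → Prop := fun P τ => ∀ i, [i] ∈ P →
      vec τ 3 i = F [i, σ.nat 6 [], σ.nat 7 [], σ.nat 8 [], σ.nat 9 []]
    have : I (box (σ₁.nat 0 []) 1) σ₂ := by
      refine den_reps (vs := [3]) (by decide) (by decide) (by decide) I
        (fun P τ v x _ h => h) (by simp [I]) ?_
      rintro _ - P - - τ rfl hF hI i hi
      have Eτ := E₁.of_frame hF (by decide)
      have e6 : τ.nat 6 [] = σ.nat 6 [] := by rw [hF.nat 6 (by decide)]; simp [hσ₁, State.setNat]
      have e7 : τ.nat 7 [] = σ.nat 7 [] := by rw [hF.nat 7 (by decide)]; simp [hσ₁, State.setNat]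
      have e8 : τ.nat 8 [] = σ.nat 8 [] := by rw [hF.nat 8 (by decide)]; simp [hσ₁, State.setNat]
      have e9 : τ.nat 9 [] = σ.nat 9 [] := by rw [hF.nat 9 (by decide)]; simp [hσ₁, State.setNat]
      by_cases e : i = τ.nat 3 []
      · simp [vec, copy, den, Instr.exec, State.setField, State.getField, State.idx, e, Eτ.zero,
          Eτ.input, e6, e7, e8, e9]
      · rw [← hI i (by simpa [e] using hi)]
        simp [vec, copy, den, Instr.exec, State.setField, State.getField, State.idx, e]
    intro i hi
    exact this i (by simp [mem_box, E₁.size, hi])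
  have hd : compositionRow.den σ = (reps [10, 11] 0 (seq productCoeff (seq pairIndex
        (instr (.fieldSub ⟨3, [17]⟩ zeroCell ⟨9, []⟩))))).den σ₂ := by
    rw [compositionRow, den_seq, den_monomialKey hσ (by decide) (by decide) (by decide)
      h₁ h₂ h₃ h₄, den_seq]
  rw [hd]
  let I : Finset (List ℕ) → State K → Prop := fun P τ =>
    (∀ i < n, vec τ 3 i = vec σ₂ 3 i) ∧
    ∀ l m, [l, m] ∈ P → vec τ 3 (n + l * n + m) = -prodCoeff n (σ.field 2) l m κ
  have key : I (box (σ₂.nat 0 []) 2) ((reps [10, 11] 0 (seq productCoeff (seq pairIndex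
        (instr (.fieldSub ⟨3, [17]⟩ zeroCell ⟨9, []⟩))))).den σ₂) := by
    refine den_reps (vs := [10, 11]) (by decide) (by decide) (by decide) I
      (fun P τ v x _ h => h) (by simp [I]) ?_
    rintro _ ht P hP htP τ rfl hF ⟨hI₁, hI₂⟩
    have Eτ := E₂.of_frame hF (by decide)
    rw [E₂.size] at ht hP
    simp only [List.map_cons, List.map_nil, mem_box, List.mem_cons, List.not_mem_nil, or_false,
      forall_eq_or_imp, forall_eq] at ht
    obtain ⟨-, t₁, t₂⟩ := ht
    have e2 : τ.field 2 = σ.field 2 := by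
      rw [hF.field 2 (by decide), F₂.field 2 (by decide)]; rfl
    have e23 : τ.nat 23 [] = κ := by
      rw [hF.nat 23 (by decide), F₂.nat 23 (by decide)]
      simp [hσ₁, State.setNat, State.idx]
    set τ' := productCoeff.den τ with hτ'
    have F' := frame_den productCoeff τ
    rw [← hτ'] at F'
    have E' := Eτ.of_frame F' (by decide)
    have e10 : τ'.nat 10 [] = τ.nat 10 [] := by rw [F'.nat 10 (by decide)]
    have e11 : τ'.nat 11 [] = τ.nat 11 [] := by rw [F'.nat 11 (by decide)]
    have e3 : τ'.field 3 = τ.field 3 := by rw [F'.field 3 (by decide)]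
    have e9 : τ'.field 9 [] = prodCoeff n (σ.field 2) (τ.nat 10 []) (τ.nat 11 []) κ := by
      rw [hτ', den_productCoeff Eτ, e2, e23]
    have hbody : ∀ x, vec ((seq productCoeff (seq pairIndex
        (instr (.fieldSub ⟨3, [17]⟩ zeroCell ⟨9, []⟩)))).den τ) 3 x =
        if x = n + τ.nat 10 [] * n + τ.nat 11 [] then
          -prodCoeff n (σ.field 2) (τ.nat 10 []) (τ.nat 11 []) κ else vec τ 3 x := by
      intro x
      rw [den_seq, den_seq, ← hτ', den_pairIndex E' (by rw [e10]; exact t₁), e10, e11]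
      by_cases e : x = n + τ.nat 10 [] * n + τ.nat 11 [] <;>
      simp [vec, den, Instr.exec, State.setField, State.setNat, State.getField, State.idx, e, e3,
        e9, E'.zero]
    constructor
    · intro i hi
      rw [hbody, if_neg (by omega), hI₁ i hi]
    · intro l m hlm
      rw [hbody]
      by_cases e : [l, m] = [τ.nat 10 [], τ.nat 11 []]
      · simp only [List.cons.injEq, and_true] at e
        obtain ⟨rfl, rfl⟩ := e
        rw [if_pos rfl]
      · have hmem : [l, m] ∈ P := (mem_insert.1 hlm).resolve_left e
        have hb := hP hmem
        simp only [mem_box, List.mem_cons, List.not_mem_nil, or_false,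
          forall_eq_or_imp, forall_eq] at hb
        rw [if_neg, hI₂ l m hmem]
        intro h
        apply e
        have h1 := index₂_div (a := l) hb.2.2
        have h2 := index₂_div (a := τ.nat 10 []) t₂
        rw [show τ.nat 10 [] * n + τ.nat 11 [] = l * n + m by omega] at h2
        rw [h1.1.symm.trans h2.1, h1.2.symm.trans h2.2]
  obtain ⟨k₁, k₂⟩ := key
  intro x hx
  by_cases hxn : x < n
  · rw [k₁ x hxn, r₂ x hxn, compVec, if_pos hxn]
  · obtain ⟨l, hl, m, hm, hlm⟩ := exists_index₂ (n := n) (x := x - n) (by omega)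
    obtain ⟨d₁, d₂⟩ := index₂_div (a := l) hm
    rw [show x = n + l * n + m by omega, k₂ l m (by simp [mem_box, E₂.size, hl, hm]), compVec,
      if_neg (by omega), show n + l * n + m - n = l * n + m by omega, d₁, d₂]
    rfl

/-- The first `n` unknowns are the coefficients of the input forms, the other `n²` those of the
products. With this order the choice of the last pivot eliminates an input form only if no product
can be eliminated instead. -/
theorem den_relations {n : ℕ} {F : List ℕ → K} {σ : State K} (hσ : Env n F σ) (hn : 0 < n) :
    ∃ S, KernelBasis (n * n + n) (mat (relations.den σ) 12) S
        (compVec n F (σ.field 2) '' (box n 4)) ∧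
      ∀ y : ℕ → ℕ → K,
        (∀ i < n, ∀ t ∈ box n 4, dot (n * n + n) (compVec n F (σ.field 2) t) (y i) = 0) →
        (∀ i < n, ∀ j < n, y i j = if i = j then 1 else 0) → range n ⊆ S := by
  have hF₁ := frame_den (initBasis 12 27) σ
  have hE₁ := hσ.of_frame hF₁ (by decide)
  have h₀ := den_initBasis (A := 12) (u := 27) (by decide) σ
  rw [hσ.pairs] at h₀
  obtain ⟨S, hS, hS'⟩ := den_absorb_loop (vs := [6, 7, 8, 9]) (A := 12) (u := 27)
    (fill := compositionRow)
    hE₁ (by decide) (by decide) (by decide) (by positivity) hE₁.pairs (by decide) (by decide)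
    (by decide) (by decide) (compVec n F (σ.field 2)) (by
      rintro _ ht τ rfl hF c hc
      have hE := hE₁.of_frame hF (by decide)
      simp only [List.map_cons, List.map_nil, mem_box, List.mem_cons, List.not_mem_nil, or_false,
        forall_eq_or_imp, forall_eq] at ht
      obtain ⟨-, t₁, t₂, t₃, t₄⟩ := ht
      have e2 : τ.field 2 = σ.field 2 := by
        rw [hF.field 2 (by decide), hF₁.field 2 (by decide)]
      rw [den_compositionRow hE t₁ t₂ t₃ t₄ c hc, e2]
      rfl)
    (KernelBasis.initial _ _ h₀)
  exact ⟨S, hS, hS' n (by nlinarith)⟩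

theorem den_writeLeft {n : ℕ} {F : List ℕ → K} {σ : State K} (hσ : Env n F σ) :
    ∀ i < n, ∀ l < n, ∀ m < n,
      (writeLeft.den σ).field 1 [i, l, m] = mat σ 12 i (n + l * n + m) := by
  let I : Finset (List ℕ) → State K → Prop := fun P τ => ∀ i l m, [i, l, m] ∈ P →
    τ.field 1 [i, l, m] = mat σ 12 i (n + l * n + m)
  have h : I (box (σ.nat 0 []) 3) (writeLeft.den σ) := by
    refine den_reps (vs := [3, 10, 11]) (by decide) (by decide) (by decide) I
      (fun P τ v x _ h => h) (by simp [I]) ?_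
    rintro _ ht P hP htP τ rfl hF hI i l m hilm
    have hE := hσ.of_frame hF (by decide)
    rw [hσ.size] at ht
    simp only [List.map_cons, List.map_nil, mem_box, List.mem_cons, List.not_mem_nil, or_false,
      forall_eq_or_imp, forall_eq] at ht
    have e12 : τ.field 12 = σ.field 12 := by rw [hF.field 12 (by decide)]
    rw [den_seq, den_pairIndex hE ht.2.2.1]
    by_cases e : i = τ.nat 3 [] ∧ l = τ.nat 10 [] ∧ m = τ.nat 11 []
    · simp [copy, den, Instr.exec, State.setField, State.setNat, State.getField, State.idx, e, e12,
        hE.zero, mat]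
    · rw [← hI i l m (by simpa [e] using hilm)]
      simp [copy, den, Instr.exec, State.setField, State.setNat, State.getField, State.idx, e]
  intro i hi l hl m hm
  exact h i l m (by simp [mem_box, hσ.size, hi, hl, hm])

/-- One pass raises the flag at any nonzero input coefficient; a second pass clears it if the
unknown of some input form has been eliminated. -/
theorem den_announce {n : ℕ} {F : List ℕ → K} {σ : State K} (hσ : Env n F σ)
    (h₁ : σ.nat 1 [] = 0) :
    (announce.den σ).nat 1 [] = 1 ↔ (∃ t ∈ box n 5, F t ≠ 0) ∧ ∀ i < n, mat σ 12 i i ≠ 0 := by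
  set σ' := (reps [3, 6, 7, 8, 9] 0 (ite (.fieldEq ⟨0, [3, 6, 7, 8, 9]⟩ zeroCell) skip
      (instr (.natConst (var 1) 1)))).den σ with hσ'
  have F' := frame_den (reps [3, 6, 7, 8, 9] 0 (ite (.fieldEq ⟨0, [3, 6, 7, 8, 9]⟩ zeroCell) skip
      (instr (.natConst (var 1) 1)))) σ
  rw [← hσ'] at F'
  have E' := hσ.of_frame F' (by decide)
  have r₁ : (σ'.nat 1 [] = 0 ∨ σ'.nat 1 [] = 1) ∧ (σ'.nat 1 [] = 1 ↔ ∃ t ∈ box n 5, F t ≠ 0) := by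
    let I : Finset (List ℕ) → State K → Prop := fun P τ => (τ.nat 1 [] = 0 ∨ τ.nat 1 [] = 1) ∧
      (τ.nat 1 [] = 1 ↔ ∃ t ∈ P, F t ≠ 0)
    have : I (box (σ.nat 0 []) 5) σ' := by
      refine den_reps (vs := [3, 6, 7, 8, 9]) (by decide) (by decide) (by decide) I
        ?_ (by simp [I, h₁]) ?_
      · rintro P τ v x hv hI
        have : 1 ≠ v := by rintro rfl; simp at hv
        simpa [I, State.setNat, this] using hI
      · rintro _ - P - - τ rfl hF ⟨hI₁, hI₂⟩
        have Eτ := hσ.of_frame hF (by decide)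
        rw [den]
        by_cases e : F ([3, 6, 7, 8, 9].map fun v => τ.nat v []) = 0
        · rw [if_pos (by simpa [Cond.Holds, State.getField, State.idx, Eτ.zero, Eτ.input] using e)]
          refine ⟨hI₁, hI₂.trans ?_⟩
          simp only [exists_mem_insert, e, ne_eq, not_true_eq_false, false_or]
        · rw [if_neg (by simpa [Cond.Holds, State.getField, State.idx, Eτ.zero, Eτ.input] using e)]
          have : ((instr (.natConst (var 1) 1)).den τ).nat 1 [] = 1 := by
            simp [den, Instr.exec, State.setNat, State.idx]
          refine ⟨.inr this, ⟨fun _ => ⟨_, mem_insert_self _ _, e⟩, fun _ => this⟩⟩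
    rwa [hσ.size] at this
  have m12 : mat σ' 12 = mat σ 12 := by unfold mat; rw [F'.field 12 (by decide)]
  let I : Finset (List ℕ) → State K → Prop := fun P τ =>
    (τ.nat 1 [] = 1 ↔ σ'.nat 1 [] = 1 ∧ ∀ i, [i] ∈ P → mat σ 12 i i ≠ 0)
  have : I (box (σ'.nat 0 []) 1) (announce.den σ) := by
    refine den_reps (vs := [3]) (σ := σ') (by decide) (by decide) (by decide) I
        ?_ (by simp [I]) ?_
    · rintro P τ v x hv hI
      have : 1 ≠ v := by rintro rfl; simp at hv
      simpa [I, State.setNat, this] using hI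
    · rintro _ - P - - τ rfl hF hI
      have Eτ := E'.of_frame hF (by decide)
      have e12 : τ.field 12 [τ.nat 3 [], τ.nat 3 []] = mat σ 12 (τ.nat 3 []) (τ.nat 3 []) := by
        rw [hF.field 12 (by decide), ← m12]; rfl
      rw [den]
      by_cases e : mat σ 12 (τ.nat 3 []) (τ.nat 3 []) = 0
      · rw [if_pos (by simpa [Cond.Holds, State.getField, State.idx, Eτ.zero, e12] using e)]
        have : ((instr (.natConst (var 1) 0)).den τ).nat 1 [] = 0 := by
          simp [den, Instr.exec, State.setNat, State.idx]
        simp only [I, this]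
        refine ⟨fun h => absurd h (by decide), fun h => absurd e (h.2 _ (by simp))⟩
      · rw [if_neg (by simpa [Cond.Holds, State.getField, State.idx, Eτ.zero, e12] using e)]
        refine Iff.trans hI (and_congr_right fun _ => ⟨fun h i hi => ?_, fun h i hi => ?_⟩)
        · by_cases hi' : i = τ.nat 3 []
          · rw [hi']; exact e
          · exact h i (by simpa [hi'] using hi)
        · exact h i (mem_insert_of_mem hi)
  rw [E'.size] at this
  refine Iff.trans this (and_congr r₁.2 ⟨fun h i hi => h i (by simp [mem_box, hi]),
    fun h i hi => h i (by simpa [mem_box] using hi)⟩)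

end Cmd

end FDP

namespace FDP

open Finset MvPolynomial

variable {K : Type u} [Field K] {n : ℕ}

/-! ## Quadratic forms and their products -/

theorem sum_sym2 {M : Type*} [AddCommMonoid M] (φ : Sym2 (Fin n) → M) :
    ∑ s, φ s = ∑ a, ∑ b, if a ≤ b then φ s(a, b) else 0 := by
  rw [← Equiv.sum_comp Sym2.sortEquiv.symm,
    ← Fintype.sum_prod_type' (fun a b => if a ≤ b then φ s(a, b) else 0), ← sum_filter]
  exact (sum_subtype _ (by simp) fun p : Fin n × Fin n => φ s(p.1, p.2)).symm

theorem bind₁_quadForm (h : Fin n → MvPolynomial (Fin n) K) (c : Sym2 (Fin n) → K) :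
    bind₁ h (quadForm c) = ∑ a, ∑ b, if a ≤ b then C (c s(a, b)) * (h a * h b) else 0 := by
  rw [quadForm, map_sum, sum_sym2]
  refine sum_congr rfl fun a _ => sum_congr rfl fun b _ => ?_
  simp [Sym2.mul]

theorem quadForm_eq (c : Sym2 (Fin n) → K) :
    quadForm c = ∑ a, ∑ b, if a ≤ b then C (c s(a, b)) * (X a * X b) else 0 := by
  rw [← bind₁_quadForm, bind₁_X_left]
  rfl

theorem quadForm_isHomogeneous (c : Sym2 (Fin n) → K) : (quadForm c).IsHomogeneous 2 := by
  rw [quadForm_eq]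
  refine IsHomogeneous.sum _ _ _ fun a _ => IsHomogeneous.sum _ _ _ fun b _ => ?_
  split_ifs
  · exact (isHomogeneous_C_mul_X _ a).mul (isHomogeneous_X K b) |> fun h => by
      simpa [mul_assoc] using h
  · exact isHomogeneous_zero _ _ _

theorem coeff_quadForm (c : Sym2 (Fin n) → K) (a b : Fin n) :
    coeff (Finsupp.single a 1 + Finsupp.single b 1) (quadForm c) = c s(a, b) := by
  rw [quadForm, coeff_sum, sum_eq_single s(a, b)]
  · simp [Sym2.mul, X, monomial_mul]
  · intro s _
    induction s with | _ p q
    intro hs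
    have : Finsupp.single p 1 + Finsupp.single q 1 ≠ Finsupp.single a 1 + Finsupp.single b 1 := by
      rw [Ne, Finsupp.single_add_single_eq_single_add_single one_ne_zero one_ne_zero]
      simpa using hs
    simp [Sym2.mul, X, monomial_mul, this, coeff_C_mul]
  · simp

/-! ### Quartic monomials and their numerical keys -/

/-- The exponent of the monomial `x_a x_b x_c x_d`. -/
noncomputable def quarticMon (a b c d : Fin n) : Fin n →₀ ℕ :=
  Finsupp.single a 1 + Finsupp.single b 1 + Finsupp.single c 1 + Finsupp.single d 1

theorem sum_digits_injective {b : ℕ} {m m' : Fin n → ℕ} (h : ∀ x, m x < b) (h' : ∀ x, m' x < b)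
    (e : ∑ x, m x * b ^ (x : ℕ) = ∑ x, m' x * b ^ (x : ℕ)) : m = m' := by
  induction n with
  | zero => exact Subsingleton.elim _ _
  | succ n ih =>
    have hs : ∀ m : Fin (n + 1) → ℕ, ∑ x, m x * b ^ (x : ℕ) =
        m 0 + b * ∑ x : Fin n, m x.succ * b ^ (x : ℕ) := fun m => by
      rw [Fin.sum_univ_succ, mul_sum]
      simp only [Fin.val_zero, pow_zero, mul_one, Fin.val_succ]
      congr 1
      exact sum_congr rfl fun x _ => by ring
    rw [hs, hs] at e
    have hb : 0 < b := (Nat.zero_le _).trans_lt (h 0)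
    have e₀ : m 0 = m' 0 := by
      have := congrArg (· % b) e
      simpa [Nat.add_mul_mod_self_left, Nat.mod_eq_of_lt (h 0), Nat.mod_eq_of_lt (h' 0)] using this
    rw [e₀] at e
    have := ih (fun x => h x.succ) (fun x => h' x.succ)
      (Nat.eq_of_mul_eq_mul_left hb (Nat.add_left_cancel e))
    funext x
    refine Fin.cases e₀ (fun x => congrFun this x) x

/-- The exponents of a quartic monomial are at most four, so they are the digits of its key in base
five. -/
theorem monKey_eq_iff (a b c d a' b' c' d' : Fin n) :
    Cmd.monKey a b c d = Cmd.monKey a' b' c' d' ↔ quarticMon a b c d = quarticMon a' b' c' d' := by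
  have key : ∀ a b c d : Fin n,
      Cmd.monKey a b c d = ∑ x, quarticMon a b c d x * 5 ^ (x : ℕ) := fun a b c d => by
    simp [quarticMon, add_mul, sum_add_distrib, Finsupp.single_apply, Cmd.monKey]
  have lt : ∀ (a b c d : Fin n) x, quarticMon a b c d x < 5 := fun a b c d x => by
    simp only [quarticMon, Finsupp.add_apply, Finsupp.single_apply]
    split_ifs <;> decide
  rw [key, key]
  refine ⟨fun h => DFunLike.coe_injective (sum_digits_injective (lt _ _ _ _) (lt _ _ _ _) h),
    fun h => by rw [h]⟩

/-- The quadratic form with the coefficients `H [l, a, b]`, `a ≤ b`. -/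
noncomputable def tableForm (H : List ℕ → K) (l : ℕ) : MvPolynomial (Fin n) K :=
  quadForm fun s => H [l, s.inf, s.sup]

theorem tableForm_eq (H : List ℕ → K) (l : ℕ) : (tableForm H l : MvPolynomial (Fin n) K) =
    ∑ a : Fin n, ∑ b : Fin n, if a ≤ b then C (H [l, a, b]) * (X a * X b) else 0 := by
  rw [tableForm, quadForm_eq]
  refine sum_congr rfl fun a _ => sum_congr rfl fun b _ => ?_
  split_ifs with h
  · simp [h]
  · rfl

theorem prodCoeff_eq (H : List ℕ → K) {l m : ℕ} (hlm : l ≤ m) (a b c d : Fin n) :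
    Cmd.prodCoeff n H l m (Cmd.monKey a b c d) =
      coeff (quarticMon a b c d) (tableForm H l * tableForm H m) := by
  rw [Cmd.prodCoeff, if_neg (not_lt.2 hlm)]
  simp only [Cmd.sum_box_succ, Cmd.sum_box_zero, sum_range, tableForm_eq, sum_mul_sum, coeff_sum]
  refine sum_congr rfl fun p _ => ?_
  rw [sum_comm]
  refine sum_congr rfl fun r _ => sum_congr rfl fun q _ => sum_congr rfl fun s _ => ?_
  rw [Cmd.prodTerm]
  by_cases h₁ : p ≤ q
  · by_cases h₂ : r ≤ s
    · rw [if_neg (by simp [h₁, h₂]), if_pos h₁, if_pos h₂,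
        show C (H [l, p, q]) * (X p * X q) * (C (H [m, r, s]) * (X r * X s)) =
          C (H [l, p, q] * H [m, r, s]) * (monomial (quarticMon p q r s) 1) by
            rw [show monomial (quarticMon p q r s) (1 : K) = X p * X q * X r * X s by
              simp [quarticMon, X, monomial_mul], C_mul]; ring, coeff_C_mul,
        coeff_monomial]
      simp only [monKey_eq_iff, mul_ite, mul_one, mul_zero]
    · simp [h₂]
  · simp [h₁]

theorem exists_single_add {k : ℕ} {m : Fin n →₀ ℕ} (hm : m.degree = k + 1) :
    ∃ (a : Fin n) (m' : Fin n →₀ ℕ), m = Finsupp.single a 1 + m' ∧ m'.degree = k := by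
  have h0 : m ≠ 0 := by rintro rfl; simp at hm
  obtain ⟨a, ha⟩ := Finsupp.ne_iff.1 h0
  have le : Finsupp.single a 1 ≤ m := by
    rw [Finsupp.single_le_iff]; exact Nat.one_le_iff_ne_zero.2 ha
  refine ⟨a, m - Finsupp.single a 1, (add_tsub_cancel_of_le le).symm, ?_⟩
  have := congrArg Finsupp.degree (add_tsub_cancel_of_le le)
  rw [map_add, Finsupp.degree_single, hm] at this
  omega

theorem eq_of_coeff_quarticMon {φ ψ : MvPolynomial (Fin n) K} (h : φ.IsHomogeneous 4)
    (h' : ψ.IsHomogeneous 4)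
    (e : ∀ a b c d, coeff (quarticMon a b c d) φ = coeff (quarticMon a b c d) ψ) : φ = ψ := by
  ext m
  by_cases hm : m.degree = 4
  · obtain ⟨a, m₁, rfl, h₁⟩ := exists_single_add hm
    obtain ⟨b, m₂, rfl, h₂⟩ := exists_single_add h₁
    obtain ⟨c, m₃, rfl, h₃⟩ := exists_single_add h₂
    obtain ⟨d, m₄, rfl, h₄⟩ := exists_single_add h₃
    obtain rfl := (Finsupp.degree_eq_zero_iff _).1 h₄
    simpa [quarticMon, add_assoc] using e a b c d
  · rw [h.coeff_eq_zero hm, h'.coeff_eq_zero hm]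

theorem quarticTable_eq (f : Fin n → MvPolynomial (Fin n) K) (i a b c d : Fin n) :
    quarticTable f [i, a, b, c, d] = coeff (quarticMon a b c d) (f i) := by
  simp [quarticTable, quarticMon]

theorem compose_isHomogeneous {g h : Fin n → MvPolynomial (Fin n) K}
    (hg : ∀ i, (g i).IsHomogeneous 2) (hh : ∀ i, (h i).IsHomogeneous 2) (i : Fin n) :
    (compose g h i).IsHomogeneous 4 :=
  (hg i).aeval h hh

theorem tupleDegree_eq {f : Fin n → MvPolynomial (Fin n) K} {d : ℕ}
    (hf : ∀ i, (f i).IsHomogeneous d) (h0 : f ≠ 0) : tupleDegree f = d := by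
  obtain ⟨i, hi⟩ := Function.ne_iff.1 h0
  refine le_antisymm (Finset.sup_le fun i _ => (hf i).totalDegree_le) ?_
  rw [← (hf i).totalDegree hi]
  exact le_sup (f := fun i => (f i).totalDegree) (mem_univ i)

/-- A nonzero `f` forces `g` and `h` to be nonzero, and nonzero homogeneous tuples have the expected
degrees, `4 = 2 * 2`. -/
theorem isQuadraticDecomposition {f g h : Fin n → MvPolynomial (Fin n) K}
    (hg : ∀ i, (g i).IsHomogeneous 2) (hh : ∀ i, (h i).IsHomogeneous 2) (e : f = compose g h)
    (h0 : f ≠ 0) : IsQuadraticDecomposition f g h := by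
  refine ⟨⟨e, ?_⟩, hg, hh⟩
  have hg0 : g ≠ 0 := by
    rintro rfl; exact h0 (by rw [e]; funext i; simp [compose])
  have hh0 : h ≠ 0 := by
    rintro rfl
    refine h0 ?_
    rw [e]; funext i
    have : constantCoeff (g i) = 0 := (hg i).coeff_eq_zero (by simp)
    change aeval (0 : Fin n → MvPolynomial (Fin n) K) (g i) = 0
    rw [aeval_zero, this, map_zero]
  rw [tupleDegree_eq hg hg0, tupleDegree_eq hh hh0,
    tupleDegree_eq (d := 4) (fun i => by rw [e]; exact compose_isHomogeneous hg hh i) h0]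

theorem sum_range_mul {M : Type*} [AddCommMonoid M] (a b : ℕ) (φ : ℕ → M) :
    ∑ x ∈ range (a * b), φ x = ∑ i : Fin a, ∑ j : Fin b, φ (i * b + j) := by
  rw [sum_range, ← finProdFinEquiv.sum_comp, Fintype.sum_prod_type]
  exact sum_congr rfl fun i _ => sum_congr rfl fun j _ => by
    rw [finProdFinEquiv_apply_val, add_comm, mul_comm]

/-- Orthogonality to the equations of all monomials is thus a polynomial identity between the `f i`
and the products. The unknowns with `l > m` occur with coefficient zero, which avoids an enumeration
of the pairs `l ≤ m`. -/
theorem dot_compVec (f : Fin n → MvPolynomial (Fin n) K) (H : List ℕ → K) (a b c d : Fin n)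
    (y : ℕ → K) :
    dot (n * n + n) (Cmd.compVec n (quarticTable f) H [a, b, c, d]) y =
      coeff (quarticMon a b c d) (∑ i : Fin n, C (y i) * f i - ∑ l : Fin n, ∑ m : Fin n,
        C (y (n + l * n + m)) * if l ≤ m then tableForm H l * tableForm H m else 0) := by
  rw [dot, add_comm, sum_range_add, sum_range_mul, sum_range, coeff_sub, sub_eq_add_neg]
  congr 1
  · rw [coeff_sum]
    refine sum_congr rfl fun i _ => ?_
    rw [Cmd.compVec, if_pos i.2, coeff_C_mul, quarticTable_eq, mul_comm]
  · simp only [coeff_sum, ← sum_neg_distrib, coeff_C_mul]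
    refine sum_congr rfl fun l _ => sum_congr rfl fun m _ => ?_
    obtain ⟨d₁, d₂⟩ := Cmd.index₂_div (a := l) m.2
    rw [Cmd.compVec, if_neg (by omega), show n + (l * n + m : ℕ) - n = l * n + m by omega, d₁, d₂,
      add_assoc, mul_comm, ← mul_neg]
    congr 2
    split_ifs with h
    · exact prodCoeff_eq H h a b c d
    · rw [Cmd.prodCoeff, if_pos (by simpa using h), coeff_zero]

end FDP

namespace FDP

open Finset MvPolynomial

variable {K : Type u} [Field K] {n : ℕ}

/-! ## Correctness of the program -/

/-- The interface between machine and algebra: all that the correctness proofs use about the final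
state. -/
theorem den_main (hn : 0 < n) (f : Fin n → MvPolynomial (Fin n) K) (ρ : ℕ → K) {τ : State K}
    (hτ : τ = Cmd.main.den (Cmd.setup.den (initState f ρ))) :
    ∃ (N₁ N₂ N₃ : ℕ → ℕ → K) (S₁ S₂ S₃ : Finset ℕ),
      KernelBasis (n * (n * n)) N₁ S₁ (Cmd.derivVec n (quarticTable f) '' (Cmd.box n 2)) ∧
      KernelBasis (n * n) N₂ S₂ (Cmd.quotVec n N₁ '' (Cmd.box n 4)) ∧
      (∀ s < n * n, N₂ s s ≠ 0 → ∀ a < n, ∀ b < n,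
        τ.field 2 [Cmd.rankBefore N₂ s, a, b] = N₂ s (a * n + b)) ∧
      KernelBasis (n * n + n) N₃ S₃
        (Cmd.compVec n (quarticTable f) (τ.field 2) '' (Cmd.box n 4)) ∧
      (∀ y : ℕ → ℕ → K, (∀ i < n, ∀ t ∈ Cmd.box n 4,
          dot (n * n + n) (Cmd.compVec n (quarticTable f) (τ.field 2) t) (y i) = 0) →
        (∀ i < n, ∀ j < n, y i j = if i = j then 1 else 0) → range n ⊆ S₃) ∧
      (∀ i < n, ∀ l < n, ∀ m < n, τ.field 1 [i, l, m] = N₃ i (n + l * n + m)) ∧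
      (Announces τ ↔ (∃ t ∈ Cmd.box n 5, quarticTable f t ≠ 0) ∧ ∀ i < n, N₃ i i ≠ 0) := by
  set σ₀ := Cmd.setup.den (initState f ρ) with h₀
  set σ₁ := Cmd.annihilator.den σ₀ with h₁
  set σ₂ := Cmd.quotient.den σ₁ with h₂
  set σ₃ := Cmd.extract.den σ₂ with h₃
  set σ₄ := Cmd.relations.den σ₃ with h₄
  set σ₅ := Cmd.writeLeft.den σ₄ with h₅
  have hτ' : τ = Cmd.announce.den σ₅ := hτ
  have F₀ := Cmd.frame_den Cmd.setup (initState f ρ)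
  have F₁ := Cmd.frame_den Cmd.annihilator σ₀
  have F₂ := Cmd.frame_den Cmd.quotient σ₁
  have F₃ := Cmd.frame_den Cmd.extract σ₂
  have F₄ := Cmd.frame_den Cmd.relations σ₃
  have F₅ := Cmd.frame_den Cmd.writeLeft σ₄
  have F₆ := Cmd.frame_den Cmd.announce σ₅
  rw [← h₀] at F₀
  rw [← h₁] at F₁
  rw [← h₂] at F₂
  rw [← h₃] at F₃
  rw [← h₄] at F₄
  rw [← h₅] at F₅
  rw [← hτ'] at F₆
  have E₀ := Cmd.env_setup f ρ
  have E₁ := E₀.of_frame F₁ (by decide)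
  have E₂ := E₁.of_frame F₂ (by decide)
  have E₃ := E₂.of_frame F₃ (by decide)
  have E₄ := E₃.of_frame F₄ (by decide)
  have E₅ := E₄.of_frame F₅ (by decide)
  have one : σ₅.nat 1 [] = 0 := by
    rw [F₅.nat 1 (by decide), F₄.nat 1 (by decide), F₃.nat 1 (by decide), F₂.nat 1 (by decide),
      F₁.nat 1 (by decide), F₀.nat 1 (by decide)]
    simp [initState]
  have two : τ.field 2 = σ₃.field 2 := by
    rw [F₆.field 2 (by decide), F₅.field 2 (by decide), F₄.field 2 (by decide)]
  have m12 : Cmd.mat σ₅ 12 = Cmd.mat σ₄ 12 := by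
    unfold Cmd.mat; rw [F₅.field 12 (by decide)]
  obtain ⟨S₁, hS₁⟩ := Cmd.den_annihilator E₀ hn
  obtain ⟨S₂, hS₂⟩ := Cmd.den_quotient E₁ hn
  obtain ⟨S₃, hS₃, hS₃'⟩ := Cmd.den_relations E₃ hn
  refine ⟨Cmd.mat σ₁ 10, Cmd.mat σ₂ 11, Cmd.mat σ₄ 12, S₁, S₂, S₃, hS₁, hS₂, ?_, ?_, ?_, ?_, ?_⟩
  · rw [two]; exact Cmd.den_extract E₂
  · rw [two]; exact hS₃
  · rw [two]; exact hS₃'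
  · rw [F₆.field 1 (by decide)]; exact Cmd.den_writeLeft E₄
  · rw [← m12, Announces, hτ']; exact Cmd.den_announce E₅ one

/-- No genericity is involved, as the last elimination certifies its own result. If the first `n`
unknowns are free, duality gives the `i`-th basis vector the entry one at `f i` and zero at the
other forms, so the relation it stands for expresses `f i` by the products of the forms in the
output. -/
theorem main_sound (hn : 0 < n) {f : Fin n → MvPolynomial (Fin n) K}
    (hf : ∀ i, (f i).IsHomogeneous 4) (ρ : ℕ → K) {τ : State K}
    (hτ : τ = Cmd.main.den (Cmd.setup.den (initState f ρ))) (h : Announces τ) :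
    IsQuadraticDecomposition f (outputLeft n τ) (outputRight n τ) := by
  obtain ⟨-, -, N, -, -, S, -, -, -, hN, -, hg, ha⟩ := den_main hn f ρ hτ
  obtain ⟨⟨t, ht, htF⟩, hd⟩ := ha.1 h
  have lt : ∀ i < n, i < n * n + n := fun i hi => by nlinarith
  have hS : ∀ i < n, i ∈ S := fun i hi => (hN.alive_iff (lt i hi)).2 (hd i hi)
  refine isQuadraticDecomposition (fun i => quadForm_isHomogeneous _)
    (fun i => quadForm_isHomogeneous _) ?_ ?_
  · funext i
    refine eq_of_coeff_quarticMon (hf i) (compose_isHomogeneous (fun i => quadForm_isHomogeneous _)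
      (fun i => quadForm_isHomogeneous _) i) fun a b c d => ?_
    have key := hN.solves _ ⟨[(a : ℕ), b, c, d], by simp [Cmd.mem_box], rfl⟩ i (lt i i.2)
    rw [dot_compVec, coeff_sub, sub_eq_zero] at key
    have e : ∑ j : Fin n, C (N i j) * f j = f i := by
      rw [sum_eq_single i]
      · rw [hN.dual i (hS i i.2) i (hS i i.2)]; simp
      · intro j _ hj
        rw [hN.dual i (hS i i.2) j (hS j j.2), if_neg (by simpa [Fin.ext_iff] using hj.symm)]
        simp
      · simp
    rw [← e, key, compose, outputLeft, readForms, bind₁_quadForm]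
    congr 1
    refine sum_congr rfl fun l _ => sum_congr rfl fun m _ => ?_
    split_ifs with hlm
    · rw [← hg i i.2 l l.2 m m.2]
      simp only [Sym2.inf_mk, Sym2.sup_mk, inf_eq_left.2 hlm, sup_eq_right.2 hlm]
      rfl
    · rw [mul_zero]
  · rintro rfl
    refine htF ?_
    rw [quarticTable.eq_def]
    split
    · split_ifs <;> simp
    · rfl

end FDP

namespace FDP

open Finset MvPolynomial

variable {K : Type u} [Field K] {n : ℕ}

/-! ## Tables of forms and their derivatives -/

/-- The Hessian matrix of the quadratic form with coefficients `c`. -/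
def hess {R : Type*} [Add R] (c : Sym2 (Fin n) → R) (a b : Fin n) : R :=
  if a = b then c s(a, b) + c s(a, b) else c s(a, b)

/-- The table of the product of `x_k` and the quadratic form with the table `q`. -/
def xMul {R : Type*} [Zero R] (k : Fin n) (q : Fin n → Fin n → R) (a b c : Fin n) : R :=
  if a = k then q b c else if b = k then q a c else if c = k then q a b else 0

/-- The table of the quadratic form `h m`. -/
def rightTable {R : Type*} (v : CoeffIdx n → R) (m a b : Fin n) : R := v (1, m, s(a, b))

/-- The matrix that expresses the partial derivatives `∂_j f_i` by the products `x_k h_m`. -/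
def chainMatrix {R : Type*} [NonUnitalNonAssocSemiring R] (v : CoeffIdx n → R) :
    Matrix (Fin n × Fin n) (Fin n × Fin n) R := fun p q =>
  ∑ l, hess (fun s => v (0, p.1, s)) l q.1 * hess (fun s => v (1, l, s)) p.2 q.2

/-- A quadratic form without squares whose products with the variables are combinations of the
`x_k h_m` vanishes. -/
def TrivialQuotient (v : CoeffIdx n → K) : Prop :=
  ∀ q : Fin n → Fin n → K, (∀ a, q a a = 0) →
    (∀ k, ∃ L : Fin n → Fin n → K, ∀ a b c,
      xMul k q a b c = ∑ k', ∑ m, L k' m * xMul k' (rightTable v m) a b c) → q = 0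

/-- The Leibniz rule yields two terms for each pair `a ≤ b`; exchanging the indices in one of them
fills the two triangles of the Hessian and doubles its diagonal. Allowing any `u` covers both `h_l`
in the variables and `g_i` in the forms `h`, the two uses in the chain rule. -/
theorem derivation_quadratic {R A : Type*} [CommRing R] [CommRing A] [Algebra R A]
    (D : Derivation R A A) (c : Sym2 (Fin n) → R) (u : Fin n → A) :
    D (∑ a, ∑ b, if a ≤ b then algebraMap R A (c s(a, b)) * (u a * u b) else 0) =
      ∑ l, ∑ m, algebraMap R A (hess c l m) * (D (u l) * u m) := by
  have e : ∀ l m, algebraMap R A (hess c l m) * (D (u l) * u m) =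
      (if l ≤ m then algebraMap R A (c s(l, m)) * (D (u l) * u m) else 0) +
      (if m ≤ l then algebraMap R A (c s(m, l)) * (D (u l) * u m) else 0) := fun l m => by
    rcases lt_trichotomy l m with h | rfl | h
    · rw [if_pos h.le, if_neg (not_le.2 h), hess, if_neg h.ne, add_zero]
    · simp [hess, add_mul]
    · rw [if_pos h.le, if_neg (not_le.2 h), hess, if_neg h.ne', zero_add, Sym2.eq_swap]
  simp only [e, sum_add_distrib]
  rw [sum_comm (f := fun l m => if m ≤ l then algebraMap R A (c s(m, l)) * (D (u l) * u m) else 0),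
    ← sum_add_distrib, map_sum]
  refine sum_congr rfl fun a _ => ?_
  rw [map_sum, ← sum_add_distrib]
  refine sum_congr rfl fun b _ => ?_
  split_ifs
  · simp only [Derivation.leibniz, Derivation.map_algebraMap, smul_eq_mul]
    ring
  · simp

theorem pderiv_quadForm (c : Sym2 (Fin n) → K) (j : Fin n) :
    pderiv j (quadForm c) = ∑ k, C (hess c j k) * X k := by
  rw [quadForm_eq]
  refine (derivation_quadratic (pderiv j) c X).trans ?_
  rw [sum_eq_single j]
  · simp [algebraMap_eq]
  · intro l _ hl
    simp [Pi.single_eq_of_ne hl]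
  · simp

theorem pderiv_compose (v : CoeffIdx n → K) (i j : Fin n) :
    pderiv j (compose (leftFactor v) (rightFactor v) i) =
      ∑ m, ∑ k, C (chainMatrix v (i, j) (m, k)) * (X k * rightFactor v m) := by
  rw [compose, leftFactor, bind₁_quadForm]
  refine (derivation_quadratic (pderiv j) (fun s => v (0, i, s)) (rightFactor v)).trans ?_
  rw [sum_comm]
  refine sum_congr rfl fun m _ => ?_
  simp only [chainMatrix, map_sum, sum_mul]
  rw [sum_comm]
  refine sum_congr rfl fun l _ => ?_
  rw [rightFactor, pderiv_quadForm, sum_mul, mul_sum]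
  refine sum_congr rfl fun k _ => ?_
  rw [C_mul, algebraMap_eq]
  ring

/-- The exponent of the monomial `x_a x_b x_c`. -/
noncomputable def cubicMon (a b c : Fin n) : Fin n →₀ ℕ :=
  Finsupp.single a 1 + Finsupp.single b 1 + Finsupp.single c 1

theorem coeff_X_mul_quadForm (w : Sym2 (Fin n) → K) (k a b c : Fin n) :
    coeff (cubicMon a b c) (X k * quadForm w) = xMul k (fun a b => w s(a, b)) a b c := by
  rw [cubicMon, xMul]
  split_ifs with h₁ h₂ h₃
  · subst h₁
    rw [add_assoc, add_comm, mul_comm, coeff_mul_X, coeff_quadForm]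
  · subst h₂
    rw [add_right_comm, mul_comm, coeff_mul_X, coeff_quadForm]
  · subst h₃
    rw [mul_comm, coeff_mul_X, coeff_quadForm]
  · rw [coeff_X_mul', if_neg]
    simp [h₁, h₂, h₃]

/-- The exponent of `x_j` in `x_j x_a x_b x_c` is one plus the number of indices among `a, b, c`
equal to `j`; the conditional additions in `derivCoeff` produce this factor. -/
theorem derivVec_eq (f : Fin n → MvPolynomial (Fin n) K) (i j a b c : Fin n) :
    Cmd.derivVec n (quarticTable f) [i, j] (a * (n * n) + b * n + c) =
      coeff (cubicMon a b c) (pderiv j (f i)) := by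
  obtain ⟨d₁, d₂, d₃⟩ := Cmd.index₃_div (a := a) b.2 c.2
  rw [Cmd.derivVec, d₁, d₂, d₃, coeff_pderiv, show cubicMon a b c + Finsupp.single j 1 =
    quarticMon j a b c by rw [cubicMon, quarticMon]; abel]
  simp only [List.getD_cons_zero, List.getD_cons_succ, Cmd.derivCoeff, quarticTable_eq, cubicMon,
    Finsupp.add_apply, Finsupp.single_apply, Fin.val_inj]
  push_cast
  split_ifs <;> ring

theorem dot_cube (y z : ℕ → K) : dot (n * (n * n)) y z =
    ∑ a : Fin n, ∑ b : Fin n, ∑ c : Fin n,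
      y (a * (n * n) + b * n + c) * z (a * (n * n) + b * n + c) := by
  rw [dot, sum_range_mul]
  refine sum_congr rfl fun a _ => ?_
  rw [← sum_range fun x => y (a * (n * n) + x) * z (a * (n * n) + x), sum_range_mul]
  simp only [add_assoc]

/-- The vector of the table of the product of `x_k` and a quadratic form. -/
def xMulVec (n : ℕ) (k : ℕ) (y : ℕ → K) (x : ℕ) : K :=
  if x / (n * n) = k then y (x / n % n * n + x % n) else
    if x / n % n = k then y (x / (n * n) * n + x % n) else
      if x % n = k then y (x / (n * n) * n + x / n % n) else 0

theorem xMulVec_eq (k a b c : Fin n) (y : ℕ → K) :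
    xMulVec n k y (a * (n * n) + b * n + c) =
      xMul k (fun a b => y (a * n + b)) a b c := by
  obtain ⟨d₁, d₂, d₃⟩ := Cmd.index₃_div (a := a) b.2 c.2
  simp only [xMulVec, d₁, d₂, d₃, xMul, Fin.val_inj]

/-- Adjointness: the equations of the second elimination are the pullbacks of the annihilating
functionals under multiplication by `x_k`. -/
theorem dot_quotVec (N : ℕ → ℕ → K) (p q r k : Fin n) (y : ℕ → K) :
    dot (n * n) (Cmd.quotVec n N [p, q, r, k]) y =
      dot (n * (n * n)) (N (p * (n * n) + q * n + r)) (xMulVec n k y) := by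
  rw [dot_cube, dot, sum_range_mul]
  simp only [xMulVec_eq]
  set z := N (p * (n * n) + q * n + r) with hz
  -- The nested cases of `xMul` become a sum of three terms with disjoint conditions, each of which
  -- fixes one index to be `k`.
  have e : ∀ a b c : Fin n, xMul k (fun a b : Fin n => y (a * n + b)) a b c =
      (if a = k then y (b * n + c) else 0) +
      (if b = k then (if a = k then 0 else y (a * n + c)) else 0) +
      (if c = k then (if a = k ∨ b = k then 0 else y (a * n + b)) else 0) := fun a b c => by
    rw [xMul]
    split_ifs <;> simp_all
  simp only [e, mul_add, sum_add_distrib, mul_ite, mul_zero]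
  have s₁ : ∑ a : Fin n, ∑ b : Fin n, ∑ c : Fin n, (if a = k then
      z (a * (n * n) + b * n + c) * y (b * n + c) else 0) =
      ∑ b : Fin n, ∑ c : Fin n, z (k * (n * n) + b * n + c) * y (b * n + c) := by
    rw [sum_eq_single k]
    · simp
    · intro a _ ha; simp [ha]
    · simp
  have s₂ : ∀ a : Fin n, ∑ b : Fin n, ∑ c : Fin n, (if b = k then (if a = k then 0 else
      z (a * (n * n) + b * n + c) * y (a * n + c)) else 0) =
      ∑ c : Fin n, if a = k then 0 else z (a * (n * n) + k * n + c) * y (a * n + c) := fun a => by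
    rw [sum_eq_single k]
    · simp
    · intro a _ ha; simp [ha]
    · simp
  rw [s₁, sum_congr rfl fun a _ => s₂ a]
  simp only [sum_ite_eq', mem_univ, if_true, ← sum_add_distrib]
  refine sum_congr rfl fun d _ => sum_congr rfl fun e _ => ?_
  obtain ⟨d₁, d₂⟩ := Cmd.index₂_div (a := d) e.2
  simp only [Cmd.quotVec, Cmd.quotCoeff, d₁, d₂, List.getD_cons_zero, List.getD_cons_succ, ← hz,
    Fin.val_inj]
  split_ifs <;> simp_all <;> ring

end FDP

/-! ### Completeness: recovering the span of the right factor from the derivatives -/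

namespace FDP

open Finset MvPolynomial

variable {K : Type u} [Field K] {n : ℕ}

theorem exists_vec {R : Type*} (hn : 0 < n) (q : Fin n → Fin n → R) :
    ∃ y : ℕ → R, ∀ a b : Fin n, y (a * n + b) = q a b := by
  refine ⟨fun x => q (⟨x / n % n, Nat.mod_lt _ hn⟩) ⟨x % n, Nat.mod_lt _ hn⟩, fun a b => ?_⟩
  obtain ⟨d₁, d₂⟩ := Cmd.index₂_div (a := a) b.2
  simp only [d₁, d₂, Nat.mod_eq_of_lt a.2]

theorem exists_fin_of_mem_box {t : List ℕ} (ht : t ∈ Cmd.box n 4) :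
    ∃ a b c d : Fin n, t = [(a : ℕ), b, c, d] := by
  obtain ⟨hl, h⟩ := Cmd.mem_box.1 ht
  obtain ⟨a, b, c, d, rfl⟩ := List.length_eq_four.1 hl
  simp only [List.mem_cons, List.not_mem_nil, or_false, forall_eq_or_imp, forall_eq] at h
  exact ⟨⟨a, h.1⟩, ⟨b, h.2.1⟩, ⟨c, h.2.2.1⟩, ⟨d, h.2.2.2⟩, rfl⟩

theorem dot_comm (C : ℕ) (x y : ℕ → K) : dot C x y = dot C y x :=
  sum_congr rfl fun _ _ => mul_comm _ _

theorem dot_sum_smul {ι : Type*} (C : ℕ) (x : ℕ → K) (s : Finset ι) (c : ι → K) (y : ι → ℕ → K) :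
    dot C x (fun t => ∑ i ∈ s, c i * y i t) = ∑ i ∈ s, c i * dot C x (y i) := by
  simp only [dot, mul_sum]
  rw [sum_comm]
  exact sum_congr rfl fun _ _ => sum_congr rfl fun _ _ => by ring

theorem coeff_pderiv_compose (v : CoeffIdx n → K) (i j a b c : Fin n) :
    coeff (cubicMon a b c) (pderiv j (compose (leftFactor v) (rightFactor v) i)) =
      ∑ p : Fin n × Fin n, chainMatrix v (i, j) p * xMul p.2 (rightTable v p.1) a b c := by
  simp only [pderiv_compose, coeff_sum, coeff_C_mul, rightFactor, coeff_X_mul_quadForm,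
    Fintype.sum_prod_type]
  rfl

/-- Inverts the chain rule: a left inverse of `chainMatrix` writes each `x_k h_m` as a combination
of the partial derivatives. -/
theorem xMul_eq_sum (v : CoeffIdx n → K) {B : Matrix (Fin n × Fin n) (Fin n × Fin n) K}
    (hB : B * chainMatrix v = 1) (k m a b c : Fin n) :
    xMul k (rightTable v m) a b c = ∑ p : Fin n × Fin n, B (m, k) p *
      coeff (cubicMon a b c) (pderiv p.2 (compose (leftFactor v) (rightFactor v) p.1)) := by
  simp only [coeff_pderiv_compose, mul_sum]
  rw [sum_comm]
  have e : ∀ q : Fin n × Fin n, ∑ p : Fin n × Fin n, B (m, k) p *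
      (chainMatrix v (p.1, p.2) q * xMul q.2 (rightTable v q.1) a b c) =
      if (m, k) = q then xMul q.2 (rightTable v q.1) a b c else 0 := fun q => by
    simp only [← mul_assoc, ← sum_mul]
    rw [show ∑ p, B (m, k) p * chainMatrix v p q = (B * chainMatrix v) (m, k) q from rfl, hB,
      Matrix.one_apply, ite_mul, one_mul, zero_mul]
  rw [sum_congr rfl fun q _ => e q, sum_ite_eq]
  simp

/-- Each `h_m` lies in the computed quotient, because functionals that vanish on the partial
derivatives vanish on `x_k h_m`. -/
theorem solves_rightTable (v : CoeffIdx n → K) {B : Matrix (Fin n × Fin n) (Fin n × Fin n) K}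
    (hB : B * chainMatrix v = 1) {N : ℕ → ℕ → K} {S : Finset ℕ}
    (hN : KernelBasis (n * (n * n)) N S
      (Cmd.derivVec n (quarticTable (compose (leftFactor v) (rightFactor v))) '' (Cmd.box n 2)))
    {m : Fin n} {y : ℕ → K} (hy : ∀ a b : Fin n, y (a * n + b) = rightTable v m a b)
    {x : ℕ → K} (hx : x ∈ Cmd.quotVec n N '' (Cmd.box n 4)) : dot (n * n) x y = 0 := by
  obtain ⟨t, ht, rfl⟩ := hx
  obtain ⟨p, q, r, k, rfl⟩ := exists_fin_of_mem_box ht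
  rw [dot_quotVec, dot_congr (fun _ _ => rfl) (y' := fun x => ∑ w : Fin n × Fin n, B (m, k) w *
    Cmd.derivVec n (quarticTable (compose (leftFactor v) (rightFactor v))) [w.1, w.2] x),
    dot_sum_smul]
  · refine sum_eq_zero fun w _ => ?_
    rw [dot_comm, hN.solves _ ⟨_, by simp [Cmd.mem_box], rfl⟩ _ (Cmd.index₃_lt p.2 q.2 r.2),
      mul_zero]
  · intro x hx
    obtain ⟨a, ha, b, hb, c, hc, rfl⟩ := Cmd.exists_index₃ hx
    have e := xMulVec_eq k ⟨a, ha⟩ ⟨b, hb⟩ ⟨c, hc⟩ y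
    simp only [hy] at e
    refine e.trans ((xMul_eq_sum v hB k m ⟨a, ha⟩ ⟨b, hb⟩ ⟨c, hc⟩).trans ?_)
    exact sum_congr rfl fun w _ => by rw [← derivVec_eq]

/-- The map `Φ` sends an element of the quotient, given by its coordinates, to its `n` square
coefficients. Its kernel consists of forms without squares, which vanish by hypothesis, so the
dimension is at most `n`. Here only the inclusion of the span of the derivatives in that of the `x_k
h_m` is used, which holds for every pair. -/
theorem card_le_of_trivialQuotient (v : CoeffIdx n → K) (hQ : TrivialQuotient v)
    {N M : ℕ → ℕ → K} {S S' : Finset ℕ}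
    (hN : KernelBasis (n * (n * n)) N S
      (Cmd.derivVec n (quarticTable (compose (leftFactor v) (rightFactor v))) '' (Cmd.box n 2)))
    (hM : KernelBasis (n * n) M S' (Cmd.quotVec n N '' (Cmd.box n 4))) : #S' ≤ n := by
  let Φ : (S' → K) →ₗ[K] (Fin n → K) :=
    { toFun := fun c a => ∑ s, c s * M s (a * n + a)
      map_add' := fun c d => by funext a; simp [add_mul, sum_add_distrib]
      map_smul' := fun r c => by funext a; simp [mul_sum, mul_assoc] }
  have inj : Function.Injective Φ := by
    rw [injective_iff_map_eq_zero]
    intro c hc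
    set y : ℕ → K := fun x => ∑ s : S', c s * M s x with hy
    have hy0 : (fun a b : Fin n => y (a * n + b)) = 0 := by
      refine hQ _ (fun a => congrFun hc a) fun k => ?_
      -- All functionals that vanish on the derivatives vanish on `x_k` times the form `y`; by
      -- `KernelBasis.mem_span` this product is a combination of derivatives, hence of the `x_k'
      -- h_m`.
      have hk : ∀ s < n * (n * n), dot (n * (n * n)) (N s) (xMulVec n k y) = 0 := fun s hs => by
        obtain ⟨p, hp, q, hq, r, hr, rfl⟩ := Cmd.exists_index₃ hs
        have := dot_quotVec N ⟨p, hp⟩ ⟨q, hq⟩ ⟨r, hr⟩ k y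
        rw [← this, hy, dot_sum_smul]
        refine sum_eq_zero fun s _ => ?_
        rw [hM.solves _ ⟨_, by simp [Cmd.mem_box, hp, hq, hr], rfl⟩ s (mem_range.1 (hM.sub s.2)),
          mul_zero]
      have hs := hN.mem_span _ hk
      have main : ∀ w ∈ Submodule.span K ((fun (x : ℕ → K) (c : Fin (n * (n * n))) => x c) ''
          (Cmd.derivVec n (quarticTable (compose (leftFactor v) (rightFactor v))) '' (Cmd.box n 2))),
          ∃ L : Fin n → Fin n → K, ∀ a b c : Fin n,
            w ⟨a * (n * n) + b * n + c, Cmd.index₃_lt a.2 b.2 c.2⟩ =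
              ∑ k', ∑ m, L k' m * xMul k' (rightTable v m) a b c := by
        intro w hw
        induction hw using Submodule.span_induction with
        | mem w hw =>
          obtain ⟨_, ⟨t, ht, rfl⟩, rfl⟩ := hw
          obtain ⟨hl, h⟩ := Cmd.mem_box.1 ht
          obtain ⟨i, j, rfl⟩ := List.length_eq_two.1 hl
          simp only [List.mem_cons, List.not_mem_nil, or_false, forall_eq_or_imp, forall_eq] at h
          refine ⟨fun k m => chainMatrix v (⟨i, h.1⟩, ⟨j, h.2⟩) (m, k), fun a b c => ?_⟩
          refine (derivVec_eq _ ⟨i, h.1⟩ ⟨j, h.2⟩ a b c).trans ?_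
          rw [coeff_pderiv_compose, Fintype.sum_prod_type, sum_comm]
        | zero => exact ⟨0, by simp⟩
        | add w w' _ _ ih ih' =>
          obtain ⟨L, hL⟩ := ih
          obtain ⟨L', hL'⟩ := ih'
          exact ⟨L + L', fun a b c => by simp [hL, hL', add_mul, sum_add_distrib]⟩
        | smul r w _ ih =>
          obtain ⟨L, hL⟩ := ih
          exact ⟨r • L, fun a b c => by simp [hL, mul_sum, mul_assoc]⟩
      obtain ⟨L, hL⟩ := main _ hs
      refine ⟨L, fun a b c => ?_⟩
      rw [← hL, xMulVec_eq]
    funext s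
    have hs := mem_range.1 (hM.sub s.2)
    obtain ⟨a, ha, b, hb, e⟩ := Cmd.exists_index₂ hs
    have h0 : y s = 0 := by
      rw [e]; exact congrFun (congrFun hy0 ⟨a, ha⟩) ⟨b, hb⟩
    rw [hy] at h0
    simp only at h0
    rw [sum_eq_single s] at h0
    · simpa [hM.dual s s.2 s s.2] using h0
    · intro t _ hts
      rw [hM.dual t t.2 s s.2, if_neg fun h => hts (Subtype.ext h), mul_zero]
    · simp
  have := LinearMap.finrank_le_finrank_of_injective inj
  simpa using this

theorem rankBefore_lt_card {C : ℕ} {M : ℕ → ℕ → K} {S : Finset ℕ} {rows : Set (ℕ → K)}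
    (hM : KernelBasis C M S rows) {s : ℕ} (hs : s ∈ S) : Cmd.rankBefore M s < #S := by
  have hsC := mem_range.1 (hM.sub hs)
  have h : Cmd.rankBefore M C = #S := by
    rw [Cmd.rankBefore]
    congr 1
    ext t
    simp only [mem_filter, mem_range]
    exact ⟨fun h => (hM.alive_iff h.1).2 h.2,
      fun h => ⟨mem_range.1 (hM.sub h), (hM.alive_iff (mem_range.1 (hM.sub h))).1 h⟩⟩
  rw [← h]
  have := Cmd.rankBefore_succ_of_ne ((hM.alive_iff hsC).1 hs)
  have := Cmd.rankBefore_mono (N := M) (show s + 1 ≤ C from hsC)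
  omega

/-- A quadratic expression in combinations of the `t` is a combination of their products, and
commutativity permits `l ≤ m`. -/
theorem bind₁_mem_span {h t : Fin n → MvPolynomial (Fin n) K}
    (ht : ∀ m, h m ∈ Submodule.span K (Set.range t)) (c : Sym2 (Fin n) → K) :
    bind₁ h (quadForm c) ∈ Submodule.span K
      (Set.range fun p : Fin n × Fin n => if p.1 ≤ p.2 then t p.1 * t p.2 else 0) := by
  rw [bind₁_quadForm]
  refine Submodule.sum_mem _ fun a _ => Submodule.sum_mem _ fun b _ => ?_
  split_ifs
  · rw [← smul_eq_C_mul]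
    refine Submodule.smul_mem _ _ ?_
    have := Submodule.mul_mem_mul (ht a) (ht b)
    rw [Submodule.span_mul_span] at this
    refine (Submodule.span_le.2 ?_) this
    rintro _ ⟨_, ⟨p, rfl⟩, _, ⟨q, rfl⟩, rfl⟩
    rcases le_total p q with hpq | hpq
    · exact Submodule.subset_span ⟨(p, q), by simp [hpq]⟩
    · exact Submodule.subset_span ⟨(q, p), by simp [hpq, mul_comm]⟩
  · exact Submodule.zero_mem _

/-- If the composition had only zero coefficients, so would its derivatives, hence all `x_k h_m` and
all `h_m`; but then `chainMatrix` is zero and has no left inverse. -/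
theorem exists_quarticTable_ne_zero (hn : 0 < n) (v : CoeffIdx n → K)
    {B : Matrix (Fin n × Fin n) (Fin n × Fin n) K} (hB : B * chainMatrix v = 1) :
    ∃ t ∈ Cmd.box n 5, quarticTable (compose (leftFactor v) (rightFactor v)) t ≠ 0 := by
  by_contra! h
  have h₁ : ∀ m b c : Fin n, rightTable v m b c = 0 := fun m b c => by
    have : xMul b (rightTable v m) b b c = 0 := by
      rw [xMul_eq_sum v hB]
      refine sum_eq_zero fun p _ => ?_
      obtain ⟨d₁, d₂, d₃⟩ := Cmd.index₃_div (a := b) b.2 c.2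
      rw [← derivVec_eq, Cmd.derivVec, d₁, d₂, d₃, Cmd.derivCoeff]
      simp [h [p.1, p.2, b, b, c] (by simp [Cmd.mem_box])]
    simpa [xMul] using this
  have h₂ : chainMatrix v = 0 := by
    ext p q
    refine sum_eq_zero fun l _ => ?_
    have := h₁ l p.2 q.2
    rw [rightTable] at this
    simp [hess, this]
  rw [h₂, Matrix.mul_zero] at hB
  exact zero_ne_one (congrFun (congrFun hB (⟨0, hn⟩, ⟨0, hn⟩)) (⟨0, hn⟩, ⟨0, hn⟩) |>.trans
    (Matrix.one_apply_eq _))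

/-- At most `n` basis forms of the quotient are extracted, so all of them occur among the `n` forms
`t`. These span every `h_m`, and therefore each input form satisfies a relation with the products
that involves no other input form. Such relations keep the first `n` unknowns free. -/
theorem main_complete (hn : 0 < n) (v : CoeffIdx n → K)
    {B : Matrix (Fin n × Fin n) (Fin n × Fin n) K} (hB : B * chainMatrix v = 1)
    (hQ : TrivialQuotient v) (ρ : ℕ → K) {τ : State K}
    (hτ : τ = Cmd.main.den (Cmd.setup.den
      (initState (compose (leftFactor v) (rightFactor v)) ρ))) : Announces τ := by
  obtain ⟨N₁, N₂, N₃, S₁, S₂, S₃, h₁, h₂, hH, h₃, hS, -, ha⟩ := den_main hn _ ρ hτ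
  refine ha.2 ⟨exists_quarticTable_ne_zero hn v hB, fun i hi => ?_⟩
  refine (h₃.alive_iff (by nlinarith)).1 ?_
  have hcard := card_le_of_trivialQuotient v hQ h₁ h₂
  set t : Fin n → MvPolynomial (Fin n) K := fun r => tableForm (τ.field 2) r with ht
  have hspan : ∀ m, rightFactor v m ∈ Submodule.span K (Set.range t) := fun m => by
    obtain ⟨y, hy⟩ := exists_vec hn (rightTable v m)
    -- The expansion of the solution `h_m` in the dual basis, with its own coefficients at the free
    -- unknowns.
    have e : rightFactor v m = ∑ s ∈ S₂, y s • tableForm (τ.field 2) (Cmd.rankBefore N₂ s) := by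
      simp only [rightFactor, quadForm_eq, tableForm_eq, smul_sum]
      rw [sum_comm (s := S₂)]
      refine sum_congr rfl fun a _ => ?_
      rw [sum_comm (s := S₂)]
      refine sum_congr rfl fun b _ => ?_
      split_ifs with hab
      · have e₁ := h₂.spans y (fun x hx => solves_rightTable v hB h₁ hy hx) (a * n + b)
          (by nlinarith [a.2, b.2])
        rw [hy, rightTable] at e₁
        rw [e₁, map_sum, sum_mul]
        refine sum_congr rfl fun s hs => ?_
        have hs' := mem_range.1 (h₂.sub hs)
        rw [hH s hs' ((h₂.alive_iff hs').1 hs) a a.2 b b.2, smul_eq_C_mul, C_mul, mul_assoc]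
      · simp
    rw [e]
    refine Submodule.sum_mem _ fun s hs => Submodule.smul_mem _ _ (Submodule.subset_span ?_)
    exact ⟨⟨Cmd.rankBefore N₂ s, (rankBefore_lt_card h₂ hs).trans_le hcard⟩, rfl⟩
  have hy : ∀ i : Fin n, ∃ y : ℕ → K, (∀ j < n, y j = if (i : ℕ) = j then 1 else 0) ∧
      ∀ s ∈ Cmd.box n 4, dot (n * n + n) (Cmd.compVec n
        (quarticTable (compose (leftFactor v) (rightFactor v))) (τ.field 2) s) y = 0 := by
    intro i
    obtain ⟨c, hc⟩ := (Submodule.mem_span_range_iff_exists_fun K).1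
      (bind₁_mem_span hspan fun s => v (0, i, s))
    obtain ⟨z, hz⟩ := exists_vec hn fun a b => c (a, b)
    -- The relation `f_i = ∑ c (l, m) t_l t_m`: a unit vector on the first `n` unknowns, followed by
    -- the coefficients of the products.
    refine ⟨fun x => if x < n then (if (i : ℕ) = x then 1 else 0) else z (x - n),
      fun j hj => if_pos hj, fun s hs => ?_⟩
    obtain ⟨a, b, c', d, rfl⟩ := exists_fin_of_mem_box hs
    rw [dot_compVec, sub_eq_zero.2, coeff_zero]
    have e₁ : ∀ l m : Fin n, ¬ n + l * n + m < n := fun l m => by omega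
    have e₂ : ∀ l m : Fin n, z (n + l * n + m - n) = c (l, m) := fun l m => by
      rw [← hz l m]; congr 1; omega
    simp only [e₁, if_false, e₂, Fin.is_lt, if_true, Fin.val_inj]
    rw [sum_eq_single i (by intro j _ hj; simp [hj.symm]) (by simp)]
    simp only [if_true, C_1, one_mul]
    rw [Fintype.sum_prod_type] at hc
    simp only [smul_eq_C_mul] at hc
    exact hc.symm
  choose y hy₁ hy₂ using hy
  refine hS (fun i => if hi : i < n then y ⟨i, hi⟩ else 0) (fun i hi s hs => ?_)
    (fun i hi j hj => ?_) (mem_range.2 hi)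
  · rw [dif_pos hi]; exact hy₂ _ s hs
  · rw [dif_pos hi]; exact hy₁ _ j hj

end FDP

namespace FDP

open Finset

variable {K : Type u} [Field K]

/-! ## A nondegenerate pair in characteristic two -/

/-- Families of alternating matrices `G i` and `A l` such that the linear map with the matrix
`∑_l G_i(l, m) A_l(j, k)` is injective. -/
def Nondegenerate {ι κ : Type*} [Fintype ι] [Fintype κ] (G : ι → ι → ι → K) (A : ι → κ → κ → K) :
    Prop :=
  (∀ l j, A l j j = 0) ∧ (∀ l j k, A l j k = A l k j) ∧
    ∀ c : ι → κ → K, (∀ i j, ∑ l, ∑ m, ∑ k, G i l m * (A l j k * c m k) = 0) → c = 0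

/-- Enlarges the set of variables of the inner forms: for block diagonal matrices the equations
separate according to the column index of `c`. -/
theorem Nondegenerate.sum_right {ι κ κ' : Type*} [Fintype ι] [Fintype κ] [Fintype κ']
    {G : ι → ι → ι → K} {A : ι → κ → κ → K} {A' : ι → κ' → κ' → K} (h : Nondegenerate G A)
    (h' : Nondegenerate G A') :
    Nondegenerate G fun l => Sum.elim (fun j => Sum.elim (A l j) 0)
      (fun j => Sum.elim 0 (A' l j)) := by
  refine ⟨?_, ?_, fun c hc => ?_⟩
  · rintro l (j | j)
    · exact h.1 l j
    · exact h'.1 l j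
  · rintro l (j | j) (k | k)
    · exact h.2.1 l j k
    · rfl
    · rfl
    · exact h'.2.1 l j k
  · have e := h.2.2 (fun m k => c m (.inl k)) fun i j => by
      simpa [Fintype.sum_sum_type] using hc i (.inl j)
    have e' := h'.2.2 (fun m k => c m (.inr k)) fun i j => by
      simpa [Fintype.sum_sum_type] using hc i (.inr j)
    funext m k
    rcases k with k | k
    · exact congrFun (congrFun e m) k
    · exact congrFun (congrFun e' m) k

/-- The direct sum of two families of matrices. -/
def directSum {ι ι' : Type*} (G : ι → ι → ι → K) (G' : ι' → ι' → ι' → K) :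
    ι ⊕ ι' → ι ⊕ ι' → ι ⊕ ι' → K :=
  Sum.elim (fun i => Sum.elim (fun l => Sum.elim (G i l) 0) 0)
    (fun i => Sum.elim 0 (fun l => Sum.elim 0 (G' i l)))

theorem directSum_self {ι ι' : Type*} {G : ι → ι → ι → K} {G' : ι' → ι' → ι' → K}
    (h : ∀ i l, G i l l = 0) (h' : ∀ i l, G' i l l = 0) :
    ∀ i l, directSum G G' i l l = 0 := by
  rintro (i | i) (l | l)
  · exact h i l
  · rfl
  · rfl
  · exact h' i l

theorem directSum_comm {ι ι' : Type*} {G : ι → ι → ι → K} {G' : ι' → ι' → ι' → K}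
    (h : ∀ i l m, G i l m = G i m l) (h' : ∀ i l m, G' i l m = G' i m l) :
    ∀ i l m, directSum G G' i l m = directSum G G' i m l := by
  rintro (i | i) (l | l) (m | m)
  all_goals first | rfl | exact h i l m | exact h' i l m

/-- Enlarges the set of outer variables: the equations separate according to the row index of `c`.
-/
theorem Nondegenerate.sum_left {ι ι' κ : Type*} [Fintype ι] [Fintype ι'] [Fintype κ]
    {G : ι → ι → ι → K} {G' : ι' → ι' → ι' → K} {A : ι → κ → κ → K} {A' : ι' → κ → κ → K}
    (h : Nondegenerate G A) (h' : Nondegenerate G' A') :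
    Nondegenerate (directSum G G') (Sum.elim A A') := by
  refine ⟨?_, ?_, fun c hc => ?_⟩
  · rintro (l | l) j
    · exact h.1 l j
    · exact h'.1 l j
  · rintro (l | l) j k
    · exact h.2.1 l j k
    · exact h'.2.1 l j k
  · have e := h.2.2 (fun m k => c (.inl m) k) fun i j => by
      simpa [Fintype.sum_sum_type, directSum] using hc (.inl i) j
    have e' := h'.2.2 (fun m k => c (.inr m) k) fun i j => by
      simpa [Fintype.sum_sum_type, directSum] using hc (.inr i) j
    funext m k
    rcases m with m | m
    · exact congrFun (congrFun e m) k
    · exact congrFun (congrFun e' m) k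

theorem Nondegenerate.congr {ι κ ι' κ' : Type*} [Fintype ι] [Fintype κ] [Fintype ι'] [Fintype κ']
    {G : ι → ι → ι → K} {A : ι → κ → κ → K} (h : Nondegenerate G A) (e : ι' ≃ ι) (e' : κ' ≃ κ) :
    Nondegenerate (fun i l m => G (e i) (e l) (e m)) (fun l j k => A (e l) (e' j) (e' k)) := by
  refine ⟨fun l j => h.1 _ _, fun l j k => h.2.1 _ _ _, fun c hc => ?_⟩
  have := h.2.2 (fun m k => c (e.symm m) (e'.symm k)) fun i j => by
    rw [← hc (e.symm i) (e'.symm j), ← e.sum_comp]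
    refine sum_congr rfl fun l _ => ?_
    rw [← e.sum_comp]
    refine sum_congr rfl fun m _ => ?_
    rw [← e'.sum_comp]
    simp
  funext m k
  simpa using congrFun (congrFun this (e m)) (e' k)

/-! ### Elimination over the field with two elements -/

/-- The sum of the `x b` over the binary digits `b < D` of `m`. -/
def digitSum (D : ℕ) (x : ℕ → K) (m : ℕ) : K := ∑ b ∈ range D, if m.testBit b then x b else 0

theorem digitSum_xor (h2 : (2 : K) = 0) (D : ℕ) (x : ℕ → K) (m m' : ℕ) :
    digitSum D x (m ^^^ m') = digitSum D x m + digitSum D x m' := by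
  simp only [digitSum, ← sum_add_distrib]
  refine sum_congr rfl fun b _ => ?_
  have : x b + x b = 0 := by rw [← two_mul, h2, zero_mul]
  rw [Nat.testBit_xor]
  cases m.testBit b <;> cases m'.testBit b <;> simp [this]

theorem digitSum_zero (D : ℕ) (x : ℕ → K) : digitSum D x 0 = 0 := by
  simp [digitSum]

theorem digitSum_two_pow {D : ℕ} (x : ℕ → K) {b : ℕ} (hb : b < D) :
    digitSum D x (2 ^ b) = x b := by
  simp [digitSum, Nat.testBit_two_pow, hb]

/-- Add `p` to `r` if this removes the digit `b`. -/
def clearDigit (p b r : ℕ) : ℕ := if r.testBit b then r ^^^ p else r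

/-- Gauss–Jordan elimination of the digits below the first argument. -/
def gaussJordan : ℕ → List ℕ → List ℕ → List ℕ
  | 0, _, done => done
  | b + 1, pending, done =>
    match pending.find? (·.testBit b) with
    | none => []
    | some p => gaussJordan b ((pending.erase p).map (clearDigit p b))
        (p :: done.map (clearDigit p b))

theorem digitSum_clearDigit (h2 : (2 : K) = 0) {D : ℕ} {x : ℕ → K} {p r : ℕ} (b : ℕ)
    (hp : digitSum D x p = 0) (hr : digitSum D x r = 0) :
    digitSum D x (clearDigit p b r) = 0 := by
  rw [clearDigit]
  split_ifs
  · rw [digitSum_xor h2, hr, hp, add_zero]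
  · exact hr

/-- Rows are only combined by addition, so every row in the result is a consequence of the system.
Without a pivot the result is the empty list, for which nothing is claimed. -/
theorem digitSum_gaussJordan (h2 : (2 : K) = 0) {D : ℕ} {x : ℕ → K} :
    ∀ (b : ℕ) (pending done : List ℕ), (∀ r ∈ pending, digitSum D x r = 0) →
      (∀ r ∈ done, digitSum D x r = 0) → ∀ r ∈ gaussJordan b pending done, digitSum D x r = 0
  | 0, _, _, _, hd => hd
  | b + 1, pending, done, hp, hd => by
    rw [gaussJordan]
    split
    · simp
    · next p hf =>
      have hp0 := hp p (List.mem_of_find?_eq_some hf)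
      refine digitSum_gaussJordan h2 b _ _ ?_ ?_
      · intro r hr
        obtain ⟨s, hs, rfl⟩ := List.mem_map.1 hr
        exact digitSum_clearDigit h2 b hp0 (hp s (List.mem_of_mem_erase hs))
      · intro r hr
        rcases List.mem_cons.1 hr with rfl | hr
        · exact hp0
        · obtain ⟨s, hs, rfl⟩ := List.mem_map.1 hr
          exact digitSum_clearDigit h2 b hp0 (hd s hs)

/-- Graphs with the vertices `0, …, d - 1`, encoded by the binary digits of a number. -/
def edge (w d l j k : ℕ) : Bool :=
  j != k && w.testBit (l * d * d + min j k * d + max j k)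

/-- The equation with index `j` that relates the blocks `i` and `i'` of unknowns, restricted to the
first unknowns of each block. -/
def equation (w d i i' j : ℕ) : ℕ → ℕ
  | 0 => 0
  | k + 1 => equation w d i i' j k ^^^ (if edge w d i j k then 2 ^ (i' * d + k) else 0) ^^^
      (if edge w d i' j k then 2 ^ (i * d + k) else 0)

/-- The system of equations that relate cyclically adjacent blocks of unknowns. -/
def cyclicSystem (w N d : ℕ) : List ℕ :=
  (List.range N).flatMap fun i => (List.range d).map fun j => equation w d i ((i + 1) % N) j d

/-- Elimination solves the cyclic system. -/
def FullRank (w N d : ℕ) : Prop :=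
  ∀ b < N * d, 2 ^ b ∈ gaussJordan (N * d) (cyclicSystem w N d) []

instance (w N d : ℕ) : Decidable (FullRank w N d) := inferInstanceAs (Decidable (∀ b < _, _))

theorem digitSum_equation (h2 : (2 : K) = 0) {w d D : ℕ} (x : ℕ → K) {i i' j : ℕ}
    (hi : i * d + d ≤ D) (hi' : i' * d + d ≤ D) (k : ℕ) (hk : k ≤ d) :
    digitSum D x (equation w d i i' j k) =
      ∑ k ∈ range k, ((if edge w d i j k then x (i' * d + k) else 0) +
        (if edge w d i' j k then x (i * d + k) else 0)) := by
  induction k with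
  | zero => simp [equation, digitSum_zero]
  | succ k ih =>
    have e : ∀ (p : Bool) (b : ℕ), b < D → digitSum D x (if p then 2 ^ b else 0) =
        if p then x b else 0 := fun p b hb => by
      cases p
      · exact digitSum_zero D x
      · exact digitSum_two_pow x hb
    rw [equation, digitSum_xor h2, digitSum_xor h2, ih (by omega), sum_range_succ,
      e _ _ (by omega), e _ _ (by omega), add_assoc]

/-- The row `2 ^ b` is the equation `x b = 0`. The computation with binary digits applies to every
field with `2 = 0`, since all coefficients are zero or one and `^^^` acts as addition. -/
theorem FullRank.eq_zero (h2 : (2 : K) = 0) {w N d : ℕ} (h : FullRank w N d) (x : ℕ → K)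
    (hx : ∀ i < N, ∀ j < d, ∑ k ∈ range d, ((if edge w d i j k then x ((i + 1) % N * d + k) else 0) +
        (if edge w d ((i + 1) % N) j k then x (i * d + k) else 0)) = 0) :
    ∀ b < N * d, x b = 0 := by
  intro b hb
  rw [← digitSum_two_pow x hb]
  refine digitSum_gaussJordan h2 _ _ _ ?_ (by simp) _ (h b hb)
  intro r hr
  simp only [cyclicSystem, List.mem_flatMap, List.mem_map, List.mem_range] at hr
  obtain ⟨i, hi, j, hj, rfl⟩ := hr
  have le : ∀ i < N, i * d + d ≤ N * d := fun i hi => by nlinarith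
  rw [digitSum_equation h2 x (le _ hi) (le _ (Nat.mod_lt _ (by omega))) d le_rfl]
  exact hx i hi j hj

/-- The cyclic successor. -/
def cyclicSucc {N : ℕ} (i : Fin N) : Fin N := ⟨(i + 1) % N, Nat.mod_lt _ i.pos⟩

/-- The Hessian matrices of the quadratic forms `y_i y_{i + 1}`, the indices being cyclic. -/
def cyclicForms (N : ℕ) (i l m : Fin N) : K :=
  (if l = i ∧ m = cyclicSucc i then 1 else 0) + (if l = cyclicSucc i ∧ m = i then 1 else 0)

theorem cyclicForms_self {N : ℕ} (hN : 1 < N) (i l : Fin N) : cyclicForms (K := K) N i l l = 0 := by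
  have : i ≠ cyclicSucc i := by
    intro h
    have h' := congrArg Fin.val h
    simp only [cyclicSucc] at h'
    rcases Nat.lt_or_ge (i + 1) N with h₁ | h₁
    · rw [Nat.mod_eq_of_lt h₁] at h'; omega
    · have : (i : ℕ) + 1 = N := by omega
      rw [this, Nat.mod_self] at h'; omega
  have h₁ : ¬ (l = i ∧ l = cyclicSucc i) := fun h => this (h.1.symm.trans h.2)
  have h₂ : ¬ (l = cyclicSucc i ∧ l = i) := fun h => h₁ h.symm
  simp [cyclicForms, h₁, h₂]

theorem cyclicForms_comm {N : ℕ} (i l m : Fin N) :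
    cyclicForms (K := K) N i l m = cyclicForms N i m l := by
  rw [cyclicForms, cyclicForms, add_comm]
  simp only [and_comm]

/-- The adjacency matrices of the graphs encoded by `w`. -/
def edgeMatrix (w : ℕ) {N d : ℕ} (l : Fin N) (j k : Fin d) : K := if edge w d l j k then 1 else 0

/-- For the Hessian of `y_i y_{i+1}` the triple sum collapses to `A_i c_{i+1} + A_{i+1} c_i`, which
links neighbouring blocks of unknowns only. -/
theorem FullRank.nondegenerate (h2 : (2 : K) = 0) {w N d : ℕ} (hd : 0 < d) (h : FullRank w N d) :
    Nondegenerate (cyclicForms (K := K) N) (edgeMatrix w (N := N) (d := d)) := by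
  refine ⟨fun l j => by simp [edgeMatrix, edge], fun l j k => ?_, fun c hc => ?_⟩
  · rw [edgeMatrix, edgeMatrix, edge, edge, bne_comm, min_comm, max_comm]
  · rcases Nat.eq_zero_or_pos N with rfl | hN
    · exact Subsingleton.elim _ _
    set x : ℕ → K := fun b => c ⟨b / d % N, Nat.mod_lt _ hN⟩ ⟨b % d, Nat.mod_lt _ hd⟩ with hx
    have hxe : ∀ (m : Fin N) (k : Fin d), x (m * d + k) = c m k := fun m k => by
      obtain ⟨d₁, d₂⟩ := Cmd.index₂_div (a := m) k.2
      simp only [hx, d₁, d₂, Nat.mod_eq_of_lt m.2]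
    have := h.eq_zero h2 x fun i hi j hj => by
      have := hc ⟨i, hi⟩ ⟨j, hj⟩
      rw [sum_range]
      have e₁ : ∀ k : Fin d, x ((i + 1) % N * d + k) = c (cyclicSucc ⟨i, hi⟩) k :=
        fun k => hxe (cyclicSucc ⟨i, hi⟩) k
      have e₂ : ∀ k : Fin d, x (i * d + k) = c ⟨i, hi⟩ k := fun k => hxe ⟨i, hi⟩ k
      simp only [e₁, e₂]
      refine Eq.trans ?_ this
      simp only [cyclicForms, add_mul, sum_add_distrib, ite_and, ite_mul, zero_mul, one_mul]
      simp [edgeMatrix, cyclicSucc]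
    funext m k
    rw [← hxe m k]
    refine this _ ?_
    nlinarith [m.2, k.2]

/-- The powers merely supply binary digits that encode graphs; all that matters is that the
elimination succeeds. For block sizes `4` and `4 + r` with `r < 4` all four combinations of outer
and inner size are needed for the direct sums. -/
theorem fullRank_power : FullRank (25 ^ 99) 4 4 ∧
    (FullRank (37 ^ 99) 5 4 ∧ FullRank (5 ^ 99) 4 5 ∧ FullRank (59 ^ 99) 5 5) ∧
    (FullRank (85 ^ 99) 6 4 ∧ FullRank (7 ^ 99) 4 6 ∧ FullRank (17 ^ 99) 6 6) ∧
    (FullRank (157 ^ 99) 7 4 ∧ FullRank (5 ^ 99) 4 7 ∧ FullRank (13 ^ 99) 7 7) := by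
  decide +kernel

theorem exists_nondegenerate_cyclic (h2 : (2 : K) = 0) {r : ℕ} (hr : r < 4) :
    (∃ A : Fin 4 → Fin 4 → Fin 4 → K, Nondegenerate (cyclicForms 4) A) ∧
    (∃ A : Fin (4 + r) → Fin 4 → Fin 4 → K, Nondegenerate (cyclicForms (4 + r)) A) ∧
    (∃ A : Fin 4 → Fin (4 + r) → Fin (4 + r) → K, Nondegenerate (cyclicForms 4) A) ∧
    (∃ A : Fin (4 + r) → Fin (4 + r) → Fin (4 + r) → K,
      Nondegenerate (cyclicForms (4 + r)) A) := by
  obtain ⟨h₀, h₁, h₂', h₃⟩ := fullRank_power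
  have e {w N d : ℕ} (hd : 0 < d) (h : FullRank w N d) :
      ∃ A : Fin N → Fin d → Fin d → K, Nondegenerate (cyclicForms N) A :=
    ⟨_, h.nondegenerate h2 hd⟩
  interval_cases r
  · exact ⟨e (by decide) h₀, e (by decide) h₀, e (by decide) h₀, e (by decide) h₀⟩
  · exact ⟨e (by decide) h₀, e (by decide) h₁.1, e (by decide) h₁.2.1, e (by decide) h₁.2.2⟩
  · exact ⟨e (by decide) h₀, e (by decide) h₂'.1, e (by decide) h₂'.2.1, e (by decide) h₂'.2.2⟩
  · exact ⟨e (by decide) h₀, e (by decide) h₃.1, e (by decide) h₃.2.1, e (by decide) h₃.2.2⟩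

/-- The same outer forms must work with inner forms in `4` and in `4 + r` variables, since both
kinds of blocks are joined in `exists_nondegenerate` for a fixed `G`. -/
theorem exists_nondegenerate_left (h2 : (2 : K) = 0) {r : ℕ} (hr : r < 4) (q : ℕ) :
    ∃ G : Fin (4 * q + (4 + r)) → Fin (4 * q + (4 + r)) → Fin (4 * q + (4 + r)) → K,
      (∀ i l, G i l l = 0) ∧ (∀ i l m, G i l m = G i m l) ∧
      (∃ A : Fin (4 * q + (4 + r)) → Fin 4 → Fin 4 → K, Nondegenerate G A) ∧
      ∃ A : Fin (4 * q + (4 + r)) → Fin (4 + r) → Fin (4 + r) → K, Nondegenerate G A := by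
  obtain ⟨⟨A₀, h₀⟩, ⟨A₁, h₁⟩, ⟨A₂, h₂⟩, ⟨A₃, h₃⟩⟩ := exists_nondegenerate_cyclic h2 hr
  induction q with
  | zero =>
    let e : Fin (4 * 0 + (4 + r)) ≃ Fin (4 + r) := finCongr (by omega)
    exact ⟨fun i l m => cyclicForms (4 + r) (e i) (e l) (e m),
      fun i l => cyclicForms_self (by omega) _ _, fun i l m => cyclicForms_comm _ _ _,
      ⟨_, h₁.congr e (Equiv.refl _)⟩, ⟨_, h₃.congr e (Equiv.refl _)⟩⟩
  | succ q ih =>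
    obtain ⟨G, hG, hG', ⟨A, hA⟩, ⟨A', hA'⟩⟩ := ih
    let e : Fin (4 * (q + 1) + (4 + r)) ≃ Fin (4 * q + (4 + r)) ⊕ Fin 4 :=
      (finCongr (by omega)).trans finSumFinEquiv.symm
    exact ⟨fun i l m => directSum G (cyclicForms 4) (e i) (e l) (e m),
      fun i l => directSum_self hG (cyclicForms_self (by decide)) _ _,
      fun i l m => directSum_comm hG' cyclicForms_comm _ _ _,
      ⟨_, (hA.sum_left h₀).congr e (Equiv.refl _)⟩, ⟨_, (hA'.sum_left h₂).congr e (Equiv.refl _)⟩⟩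

theorem exists_nondegenerate (h2 : (2 : K) = 0) {n : ℕ} (hn : 4 ≤ n) :
    ∃ (G : Fin n → Fin n → Fin n → K) (A : Fin n → Fin n → Fin n → K),
      (∀ i l, G i l l = 0) ∧ (∀ i l m, G i l m = G i m l) ∧ Nondegenerate G A := by
  -- One block of size between four and seven takes up the residue modulo four; all others have size
  -- four.
  obtain ⟨q, r, hr, rfl⟩ : ∃ q r, r < 4 ∧ n = 4 * q + (4 + r) :=
    ⟨n / 4 - 1, n % 4, Nat.mod_lt _ (by decide), by omega⟩
  obtain ⟨G, hG, hG', ⟨A, hA⟩, ⟨A', hA'⟩⟩ := exists_nondegenerate_left h2 hr q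
  have main : ∀ q', ∃ B : Fin (4 * q + (4 + r)) → Fin (4 * q' + (4 + r)) → Fin (4 * q' + (4 + r)) → K,
      Nondegenerate G B := by
    intro q'
    induction q' with
    | zero => exact ⟨_, hA'.congr (Equiv.refl _) (finCongr (by omega))⟩
    | succ q' ih =>
      obtain ⟨B, hB⟩ := ih
      exact ⟨_, (hB.sum_right hA).congr (Equiv.refl _)
        ((finCongr (by omega) : Fin (4 * (q' + 1) + (4 + r)) ≃ Fin (4 * q' + (4 + r) + 4)).trans
          finSumFinEquiv.symm)⟩
  obtain ⟨B, hB⟩ := main q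
  exact ⟨G, B, hG, hG', hB⟩

end FDP

namespace FDP

open Finset MvPolynomial

variable {K : Type u} [Field K] {n : ℕ}

/-! ## Generic pairs -/

theorem totalDegree_det_le {σ κ : Type*} [Fintype κ] [DecidableEq κ]
    (A : Matrix κ κ (MvPolynomial σ K)) {d : ℕ} (h : ∀ i j, (A i j).totalDegree ≤ d) :
    A.det.totalDegree ≤ Fintype.card κ * d := by
  rw [Matrix.det_apply]
  refine totalDegree_finsetSum_le fun π _ => ?_
  have : (∏ i, A (π i) i).totalDegree ≤ Fintype.card κ * d := by
    refine (totalDegree_finsetProd _ _).trans ((sum_le_sum fun i _ => h _ _).trans ?_)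
    simp
  rcases Int.units_eq_one_or (Equiv.Perm.sign π) with e | e <;> simpa [e] using this

/-- With a constant left inverse `B` of the matrix at `v₀`, the polynomial `det (B A)` equals one at
`v₀`, and wherever it does not vanish `(B A)⁻¹ B` is a left inverse. The fixed factor `B` does not
raise the degree, and rectangular matrices are covered. -/
theorem exists_leftInverse_generic {σ ι κ : Type*} [Fintype ι] [Fintype κ] [DecidableEq ι]
    [DecidableEq κ] (A : Matrix ι κ (MvPolynomial σ K)) {d : ℕ}
    (h : ∀ i j, (A i j).totalDegree ≤ d) (v₀ : σ → K)
    (inj : ∀ x : κ → K, (A.map (eval v₀)).mulVec x = 0 → x = 0) :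
    ∃ D : MvPolynomial σ K, D ≠ 0 ∧ D.totalDegree ≤ Fintype.card κ * d ∧
      ∀ v, eval v D ≠ 0 → ∃ B : Matrix κ ι K, B * A.map (eval v) = 1 := by
  obtain ⟨g, hg⟩ := LinearMap.exists_leftInverse_of_injective (Matrix.toLin' (A.map (eval v₀)))
    (LinearMap.ker_eq_bot'.2 fun x hx => inj x (by simpa using hx))
  set B := LinearMap.toMatrix' g with hB
  have hBA : B * A.map (eval v₀) = 1 := by
    rw [← LinearMap.toMatrix'_toLin' (A.map (eval v₀)), hB, ← LinearMap.toMatrix'_comp, hg,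
      LinearMap.toMatrix'_id]
  set B' : Matrix κ ι (MvPolynomial σ K) := B.map C with hB'
  have he : ∀ v, eval v (B' * A).det = (B * A.map (eval v)).det := fun v => by
    rw [RingHom.map_det, RingHom.mapMatrix_apply, Matrix.map_mul]
    congr 2
    ext i j
    simp [hB']
  refine ⟨(B' * A).det, fun h0 => ?_, totalDegree_det_le _ fun i j => ?_, fun v hv => ?_⟩
  · have := he v₀
    rw [h0, hBA] at this
    simp at this
  · rw [Matrix.mul_apply]
    refine totalDegree_finsetSum_le fun k _ => (totalDegree_mul _ _).trans ?_
    simpa [hB'] using h k j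
  · rw [he] at hv
    exact ⟨(B * A.map (eval v))⁻¹ * B, by
      rw [Matrix.mul_assoc, Matrix.nonsing_inv_mul _ (isUnit_iff_ne_zero.2 hv)]⟩

theorem totalDegree_hess_le {σ : Type*} (c : Sym2 (Fin n) → MvPolynomial σ K) {d : ℕ}
    (h : ∀ s, (c s).totalDegree ≤ d) (a b : Fin n) : (hess c a b).totalDegree ≤ d := by
  rw [hess]
  split_ifs
  · exact (totalDegree_add _ _).trans (by simp [h])
  · exact h _

theorem chainMatrix_map_eval (v : CoeffIdx n → K) :
    (chainMatrix (X : CoeffIdx n → MvPolynomial (CoeffIdx n) K)).map (eval v) = chainMatrix v := by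
  ext p q
  simp only [Matrix.map_apply, chainMatrix, map_sum, map_mul]
  refine sum_congr rfl fun l _ => ?_
  simp only [hess, apply_ite (eval v), map_add, eval_X]

theorem chainMatrix_mulVec (v : CoeffIdx n → K) (x : Fin n × Fin n → K) (i j : Fin n) :
    (chainMatrix v).mulVec x (i, j) = ∑ l, ∑ m, ∑ k, hess (fun s => v (0, i, s)) l m *
      (hess (fun s => v (1, l, s)) j k * x (m, k)) := by
  simp only [Matrix.mulVec, dotProduct, chainMatrix, sum_mul, Fintype.sum_prod_type]
  rw [sum_congr rfl fun m _ => sum_comm, sum_comm]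
  exact sum_congr rfl fun l _ => sum_congr rfl fun m _ => sum_congr rfl fun k _ => mul_assoc _ _ _

/-- When `2 = 0` the diagonal of every Hessian vanishes, so sums of squares are useless and the
alternating families constructed above are needed. -/
theorem exists_chainMatrix_injective (hn : 4 ≤ n) : ∃ v : CoeffIdx n → K,
    ∀ x : Fin n × Fin n → K, (chainMatrix v).mulVec x = 0 → x = 0 := by
  by_cases h2 : (2 : K) = 0
  · obtain ⟨G, A, hG, hG', hA, hA', h⟩ := exists_nondegenerate h2 hn
    -- A symmetric matrix with zero diagonal is the Hessian of the form whose coefficients are its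
    -- entries above the diagonal.
    have e : ∀ M : Fin n → Fin n → K, (∀ l, M l l = 0) → (∀ l m, M l m = M m l) →
        ∀ l m, hess (fun s => M s.inf s.sup) l m = M l m := fun M h₁ h₂ l m => by
      rcases lt_trichotomy l m with hlm | rfl | hlm
      · simp [hess, hlm.ne, hlm.le]
      · simp [hess, h₁]
      · simp [hess, hlm.ne', hlm.le, h₂ m l]
    refine ⟨fun p => if p.1 = 0 then G p.2.1 p.2.2.inf p.2.2.sup else A p.2.1 p.2.2.inf p.2.2.sup,
      fun x hx => ?_⟩
    have := h (fun m k => x (m, k)) fun i j => by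
      have := congrFun hx (i, j)
      rw [chainMatrix_mulVec] at this
      simpa [e (G i) (hG i) (hG' i), fun l => e (A l) (hA l) (hA' l)] using this
    funext p
    exact congrFun (congrFun this p.1) p.2
  -- The pair `g_i = y_i²`, `h_l = ∑ x_j²`: the Hessians are twice a diagonal matrix unit and twice
  -- the identity, so `chainMatrix` is four times the identity.
  · refine ⟨fun p => if p.1 = 0 then (if p.2.2 = s(p.2.1, p.2.1) then 1 else 0)
      else (if p.2.2.IsDiag then 1 else 0), fun x hx => ?_⟩
    have e₁ : ∀ i l m : Fin n, hess (fun s => if s = s(i, i) then (1 : K) else 0) l m =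
        if l = i ∧ m = i then 2 else 0 := fun i l m => by
      by_cases hlm : l = m
      · subst hlm
        by_cases h : l = i <;> simp [hess, h, one_add_one_eq_two]
      · have : ¬ (l = i ∧ m = i) := fun h => hlm (h.1.trans h.2.symm)
        simp [hess, hlm, this]
    have e₂ : ∀ j k : Fin n, hess (fun s => if s.IsDiag then (1 : K) else 0) j k =
        if j = k then 2 else 0 := fun j k => by
      by_cases h : j = k <;> simp [hess, h, one_add_one_eq_two]
    funext ⟨i, j⟩
    have := congrFun hx (i, j)
    rw [chainMatrix_mulVec] at this
    simp only [e₁, e₂, if_true, one_ne_zero, if_false, ite_and, ite_mul, zero_mul, mul_ite,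
      mul_zero, sum_ite_eq, mem_univ] at this
    rw [sum_eq_single i (by intro l _ hl; simp [hl]) (by simp), sum_eq_single i
      (by intro l _ hl; simp [hl]) (by simp), if_pos rfl, if_pos rfl] at this
    simpa [h2] using this

/-! ### Triviality of the quotient as a rank condition -/

/-- The matrix of the linear map that expresses `TrivialQuotient`. -/
def quotMatrix {R : Type*} [CommRing R] (v : CoeffIdx n → R) :
    Matrix (Fin n ⊕ Fin n × Fin n × Fin n × Fin n) (Fin n × Fin n ⊕ Fin n × Fin n × Fin n) R :=
  fun i j => match i, j with
    | .inl a, .inl p => if p = (a, a) then 1 else 0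
    | .inl _, .inr _ => 0
    | .inr t, .inl p => xMul t.1 (fun a b => if p = (a, b) then 1 else 0) t.2.1 t.2.2.1 t.2.2.2
    | .inr t, .inr p =>
      if p.1 = t.1 then -xMul p.2.1 (rightTable v p.2.2) t.2.1 t.2.2.1 t.2.2.2 else 0

theorem quotMatrix_mulVec_inl (v : CoeffIdx n → K) (q : Fin n × Fin n → K)
    (L : Fin n × Fin n × Fin n → K) (a : Fin n) :
    (quotMatrix v).mulVec (Sum.elim q L) (.inl a) = q (a, a) := by
  simp [quotMatrix, Matrix.mulVec, dotProduct]

theorem quotMatrix_mulVec_inr (v : CoeffIdx n → K) (q : Fin n × Fin n → K)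
    (L : Fin n × Fin n × Fin n → K) (k a b c : Fin n) :
    (quotMatrix v).mulVec (Sum.elim q L) (.inr (k, a, b, c)) =
      xMul k (fun a b => q (a, b)) a b c -
        ∑ k', ∑ m, L (k, k', m) * xMul k' (rightTable v m) a b c := by
  have e : ∀ a b c, ∑ p, xMul k (fun a b => if p = (a, b) then (1 : K) else 0) a b c * q p =
      xMul k (fun a b => q (a, b)) a b c := fun a b c => by
    simp only [xMul]
    split_ifs <;> simp
  simp only [quotMatrix, Matrix.mulVec, dotProduct, Fintype.sum_sum_type,
    Sum.elim_inl, Sum.elim_inr, e]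
  rw [sub_eq_add_neg, Fintype.sum_prod_type, sum_eq_single k (by intro j _ hj; simp [hj])
    (by simp), Fintype.sum_prod_type, ← sum_neg_distrib]
  congr 1
  refine sum_congr rfl fun k' _ => ?_
  rw [← sum_neg_distrib]
  refine sum_congr rfl fun m _ => ?_
  simp [mul_comm]

theorem quotMatrix_map_eval (v : CoeffIdx n → K) :
    (quotMatrix (X : CoeffIdx n → MvPolynomial (CoeffIdx n) K)).map (eval v) = quotMatrix v := by
  ext (a | t) (p | p)
  · simp [quotMatrix, apply_ite (eval v)]
  · simp [quotMatrix]
  · simp [quotMatrix, xMul, apply_ite (eval v)]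
  · simp [quotMatrix, xMul, rightTable, apply_ite (eval v)]

theorem totalDegree_quotMatrix_le (i j) :
    (quotMatrix (X : CoeffIdx n → MvPolynomial (CoeffIdx n) K) i j).totalDegree ≤ 1 := by
  have e : ∀ (p : Prop) [Decidable p] (x y : MvPolynomial (CoeffIdx n) K),
      x.totalDegree ≤ 1 → y.totalDegree ≤ 1 → (if p then x else y).totalDegree ≤ 1 := by
    intro p _ x y hx hy
    split_ifs <;> assumption
  rcases i with a | t <;> rcases j with p | p <;>
    simp only [quotMatrix, xMul, rightTable]
  · refine e _ _ _ ?_ ?_ <;> simp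
  · simp
  · refine e _ _ _ (e _ _ _ ?_ ?_) (e _ _ _ (e _ _ _ ?_ ?_) (e _ _ _ (e _ _ _ ?_ ?_) ?_)) <;> simp
  · refine e _ _ _ ?_ (by simp)
    rw [totalDegree_neg]
    refine e _ _ _ ?_ (e _ _ _ ?_ (e _ _ _ ?_ ?_)) <;> simp

/-- The multipliers `L` are unknowns along with `q`, which makes the condition linear with entries
of degree at most one in `v`. A left inverse then forces `L` to vanish as well, which is more than
needed but still generic. -/
theorem trivialQuotient_of_mul_eq_one (v : CoeffIdx n → K)
    {B : Matrix (Fin n × Fin n ⊕ Fin n × Fin n × Fin n)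
      (Fin n ⊕ Fin n × Fin n × Fin n × Fin n) K} (hB : B * quotMatrix v = 1) :
    TrivialQuotient v := by
  intro q hq hL
  choose L hL using hL
  set x : Fin n × Fin n ⊕ Fin n × Fin n × Fin n → K :=
    Sum.elim (fun p => q p.1 p.2) (fun p => L p.1 p.2.1 p.2.2) with hx
  have h0 : (quotMatrix v).mulVec x = 0 := by
    funext i
    rcases i with a | ⟨k, a, b, c⟩
    · rw [hx, quotMatrix_mulVec_inl]; exact hq a
    · rw [hx, quotMatrix_mulVec_inr, Pi.zero_apply, sub_eq_zero]; exact hL k a b c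
  have hx0 : x = 0 := by
    rw [← Matrix.one_mulVec x, ← hB, ← Matrix.mulVec_mulVec, h0, Matrix.mulVec_zero]
  funext a b
  exact congrFun hx0 (.inl (a, b))

/-- Take `h_m = x_m²`. The products `x_k x_m²` contain no monomial in three distinct variables,
which kills `q`, and they are linearly independent, which kills `L`. -/
theorem exists_quotMatrix_injective (hn : 3 ≤ n) : ∃ v : CoeffIdx n → K,
    ∀ x, (quotMatrix v).mulVec x = 0 → x = 0 := by
  refine ⟨fun p => if p.2.2 = s(p.2.1, p.2.1) then 1 else 0, fun x hx => ?_⟩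
  set v : CoeffIdx n → K := fun p => if p.2.2 = s(p.2.1, p.2.1) then 1 else 0 with hv
  have ht : ∀ m a b, rightTable v m a b = if a = m ∧ b = m then 1 else 0 := fun m a b => by
    simp [rightTable, hv]
  obtain ⟨q, L, rfl⟩ : ∃ q L, x = Sum.elim q L := ⟨x ∘ .inl, x ∘ .inr, by simp⟩
  have h₁ : ∀ a, q (a, a) = 0 := fun a => by
    rw [← quotMatrix_mulVec_inl v q L, hx]; rfl
  have h₂ : ∀ k a b c, xMul k (fun a b => q (a, b)) a b c =
      ∑ k', ∑ m, L (k, k', m) * xMul k' (rightTable v m) a b c := fun k a b c => by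
    rw [← sub_eq_zero, ← quotMatrix_mulVec_inr, hx]; rfl
  have hq : ∀ a b, q (a, b) = 0 := fun a b => by
    by_cases hab : a = b
    · rw [hab]; exact h₁ b
    -- A third variable `x_k` turns the coefficient of `x_a x_b` in `q` into that of `x_k x_a x_b`
    -- in `x_k q`; this is where three variables are required.
    · obtain ⟨k, hk⟩ : ∃ k, k ∉ ({a, b} : Finset (Fin n)) := by
        by_contra! hall
        have := (card_le_card (fun k _ => hall k : (univ : Finset (Fin n)) ⊆ {a, b})).trans
          card_le_two
        simp at this
        omega
      simp only [mem_insert, mem_singleton, not_or] at hk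
      have := h₂ k k a b
      rw [xMul, if_pos rfl] at this
      rw [this]
      refine sum_eq_zero fun k' _ => sum_eq_zero fun m _ => ?_
      have : xMul k' (rightTable v m) k a b = 0 := by
        simp only [xMul, ht]
        split_ifs <;> simp_all
      rw [this, mul_zero]
  have hL : ∀ k k' m, L (k, k', m) = 0 := fun k k' m => by
    have := h₂ k k' m m
    have z : xMul k (fun a b => q (a, b)) k' m m = 0 := by
      simp [xMul, hq]
    rw [z, sum_eq_single k', sum_eq_single m] at this
    · simpa [xMul, ht] using this.symm
    · intro m' _ hm
      simp [xMul, ht, hm.symm]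
    · simp
    · intro k'' _ hk
      refine sum_eq_zero fun m' _ => ?_
      have : xMul k'' (rightTable v m') k' m m = 0 := by
        rw [xMul, if_neg hk.symm]
        by_cases h : m = k''
        · rw [if_pos h, ht, if_neg fun e => hk (by rw [← h, e.2, e.1])]
        · rw [if_neg h, if_neg h]
      rw [this, mul_zero]
    · simp
  funext i
  rcases i with ⟨a, b⟩ | ⟨k, k', m⟩
  · exact hq a b
  · exact hL k k' m

/-- Degree count: `n²` columns of degree two from the chain rule, and `n² + n³` columns of degree
one from the quotient. -/
theorem exists_generic (hn : 4 ≤ n) :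
    ∃ D : MvPolynomial (CoeffIdx n) K, D ≠ 0 ∧ D.totalDegree ≤ n ^ 3 + 3 * n ^ 2 ∧
      ∀ v, eval v D ≠ 0 → (∃ B : Matrix (Fin n × Fin n) (Fin n × Fin n) K,
        B * chainMatrix v = 1) ∧ TrivialQuotient v := by
  obtain ⟨v₁, h₁⟩ := exists_chainMatrix_injective (K := K) hn
  obtain ⟨v₂, h₂⟩ := exists_quotMatrix_injective (K := K) (n := n) (by omega)
  obtain ⟨D₁, n₁, d₁, g₁⟩ := exists_leftInverse_generic
    (chainMatrix (X : CoeffIdx n → MvPolynomial (CoeffIdx n) K)) (d := 2) (fun p q => by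
      refine totalDegree_finsetSum_le fun l _ => (totalDegree_mul _ _).trans ?_
      exact add_le_add (totalDegree_hess_le (d := 1) _ (fun s => by simp) _ _)
        (totalDegree_hess_le (d := 1) _ (fun s => by simp) _ _)) v₁
    (fun x hx => h₁ x (by rwa [chainMatrix_map_eval] at hx))
  obtain ⟨D₂, n₂, d₂, g₂⟩ := exists_leftInverse_generic
    (quotMatrix (X : CoeffIdx n → MvPolynomial (CoeffIdx n) K)) totalDegree_quotMatrix_le v₂
    (fun x hx => h₂ x (by rwa [quotMatrix_map_eval] at hx))
  refine ⟨D₁ * D₂, mul_ne_zero n₁ n₂, (totalDegree_mul _ _).trans ?_, fun v hv => ?_⟩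
  · simp only [Fintype.card_sum, Fintype.card_prod, Fintype.card_fin] at d₁ d₂
    nlinarith
  · rw [map_mul] at hv
    obtain ⟨B, hB⟩ := g₁ v (left_ne_zero_of_mul hv)
    obtain ⟨B', hB'⟩ := g₂ v (right_ne_zero_of_mul hv)
    rw [chainMatrix_map_eval] at hB
    rw [quotMatrix_map_eval] at hB'
    exact ⟨⟨B, hB⟩, trivialQuotient_of_mul_eq_one v hB'⟩

end FDP

namespace FDP

open Finset MvPolynomial

variable {K : Type u} [Field K] {n : ℕ}

/-! ## The program -/

/-- The program that decomposes quartic forms. -/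
def program : Prog := .seq Cmd.setup.compile Cmd.main.compile

/-- A bound for the running time of `program`. -/
noncomputable def runningTime : Polynomial ℕ :=
  -- The loops of `main` are bounded by `n`, `n²`, `n³` and `n² + n`, none of which exceeds `n³ + n²
  -- + n`.
  Cmd.setup.costPoly + Cmd.main.costPoly.comp (.X ^ 3 + .X ^ 2 + .X)

theorem exec_program (f : Fin n → MvPolynomial (Fin n) K) (ρ : ℕ → K) :
    ∃ t ≤ runningTime.eval n,
      Exec program (initState f ρ) t (Cmd.main.den (Cmd.setup.den (initState f ρ))) := by
  obtain ⟨s, hs, h₁⟩ := Cmd.exec_compile Cmd.setup Cmd.countersSafe_setup Cmd.bounds_setup n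
    (initState f ρ) fun u _ => by simp only [initState]; split_ifs <;> omega
  have E := Cmd.env_setup f ρ
  obtain ⟨t, ht, h₂⟩ := Cmd.exec_compile Cmd.main Cmd.countersSafe_main Cmd.bounds_main
    (n ^ 3 + n ^ 2 + n) (Cmd.setup.den (initState f ρ)) fun u hu => by
      have hb : ∀ u ∈ Cmd.main.bounds, u = 0 ∨ u = 25 ∨ u = 26 ∨ u = 27 := by decide
      have p : n ^ 3 = n * (n * n) := by ring
      have p' : n ^ 2 = n * n := by ring
      rcases hb u hu with rfl | rfl | rfl | rfl
      · rw [E.size]; omega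
      · rw [E.square]; omega
      · rw [E.cube]; omega
      · rw [E.pairs]; omega
  refine ⟨s + t, ?_, .seq h₁ h₂⟩
  simp only [runningTime, Polynomial.eval_add, Polynomial.eval_comp, Polynomial.eval_pow,
    Polynomial.eval_X]
  exact add_le_add hs ht

theorem succeeds_of_generic (hn : 0 < n) {v : CoeffIdx n → K}
    (hB : ∃ B : Matrix (Fin n × Fin n) (Fin n × Fin n) K, B * chainMatrix v = 1)
    (hQ : TrivialQuotient v) {m : ℕ} (r : Fin m → K) :
    Succeeds program (compose (leftFactor v) (rightFactor v)) r := by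
  obtain ⟨B, hB⟩ := hB
  obtain ⟨t, -, ht⟩ := exec_program (compose (leftFactor v) (rightFactor v)) (extendTape r)
  have ha := main_complete hn v hB hQ (extendTape r) rfl
  exact ⟨t, _, ht, ha, main_sound hn (compose_isHomogeneous (fun i => quadForm_isHomogeneous _)
    fun i => quadForm_isHomogeneous _) (extendTape r) rfl ha⟩

/-! ### Counting zeros and successes over a finite field -/

/-- The number of zeros of a polynomial over a finite field. -/
theorem card_zeros_le [Finite K] {σ : Type*} [Fintype σ] {D : MvPolynomial σ K} (hD : D ≠ 0) :
    (Nat.card {v : σ → K // eval v D = 0} : ℝ) ≤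
      D.totalDegree / Nat.card K * Nat.card (σ → K) := by
  classical
  have := Fintype.ofFinite K
  let e := Fintype.equivFin σ
  have h0 : rename e D ≠ 0 := fun h => hD (rename_injective _ e.injective (by rw [h, map_zero]))
  have h := schwartz_zippel_totalDegree h0 (univ : Finset K)
  have hc : #{f ∈ Fintype.piFinset fun _ : Fin (Fintype.card σ) => (univ : Finset K) |
      eval f (rename e D) = 0} = Nat.card {v : σ → K // eval v D = 0} := by
    rw [Fintype.piFinset_univ, ← Fintype.card_subtype, ← Nat.card_eq_fintype_card]
    refine Nat.card_congr ((e.arrowCongr (Equiv.refl K)).symm.subtypeEquiv fun f => ?_)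
    rw [eval_rename]
    rfl
  rw [hc, card_univ] at h
  replace h := h.trans (div_le_div_of_nonneg_right
    (Nat.cast_le.2 (totalDegree_rename_le e D)) (Nat.cast_nonneg _))
  have hq : (0 : ℝ) < Fintype.card K := by exact_mod_cast Fintype.card_pos
  have h' : (Nat.card {v : σ → K // eval v D = 0} : ℝ) / (Fintype.card K : ℝ) ^ Fintype.card σ ≤
      D.totalDegree / Fintype.card K := by
    simpa using (NNRat.cast_le (K := ℝ)).2 h
  rw [div_le_iff₀ (by positivity)] at h'
  simpa [Nat.card_eq_fintype_card] using h'

/-- A pair off the zero set succeeds with every tape, so the number of tapes cancels and only the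
proportion of zeros of `D` remains. -/
theorem le_successProb [Finite K] {A : Prog} {m : ℕ} {D : MvPolynomial (CoeffIdx n) K}
    (hD : D ≠ 0)
    (h : ∀ v, eval v D ≠ 0 → ∀ r : Fin m → K,
      Succeeds A (compose (leftFactor v) (rightFactor v)) r) :
    1 - (D.totalDegree : ℝ) / Nat.card K ≤ successProb K n m A := by
  classical
  have := Fintype.ofFinite K
  have c₁ : Nat.card ({v : CoeffIdx n → K // ¬ eval v D = 0} × (Fin m → K)) ≤
      Nat.card {ω : (CoeffIdx n → K) × (Fin m → K) //
        Succeeds A (compose (leftFactor ω.1) (rightFactor ω.1)) ω.2} :=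
    Nat.card_le_card_of_injective (fun p => ⟨(p.1.1, p.2), h _ p.1.2 _⟩) fun p q hpq => by
      simp only [Subtype.mk.injEq, Prod.mk.injEq] at hpq
      exact Prod.ext (Subtype.ext hpq.1) hpq.2
  have c₂ : Nat.card {v : CoeffIdx n → K // eval v D = 0} +
      Nat.card {v : CoeffIdx n → K // ¬ eval v D = 0} = Nat.card (CoeffIdx n → K) := by
    rw [← Nat.card_sum]
    exact Nat.card_congr (Equiv.sumCompl _)
  have c₃ := card_zeros_le hD
  rw [Nat.card_prod] at c₁
  have p₁ : (0 : ℝ) < Nat.card (CoeffIdx n → K) := by exact_mod_cast Nat.card_pos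
  have p₂ : (0 : ℝ) < Nat.card (Fin m → K) := by exact_mod_cast Nat.card_pos
  have c₁' : (Nat.card {v : CoeffIdx n → K // ¬ eval v D = 0} : ℝ) * Nat.card (Fin m → K) ≤
      Nat.card {ω : (CoeffIdx n → K) × (Fin m → K) //
        Succeeds A (compose (leftFactor ω.1) (rightFactor ω.1)) ω.2} := by exact_mod_cast c₁
  have c₂' : (Nat.card {v : CoeffIdx n → K // eval v D = 0} : ℝ) +
      Nat.card {v : CoeffIdx n → K // ¬ eval v D = 0} = Nat.card (CoeffIdx n → K) := by
    exact_mod_cast c₂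
  rw [successProb, Nat.card_prod, Nat.cast_mul, le_div_iff₀ (by positivity)]
  refine le_trans ?_ c₁'
  rw [← mul_assoc]
  refine mul_le_mul_of_nonneg_right ?_ p₂.le
  linarith

end FDP

/-! ### The main theorem -/

theorem mainTheorem1 :
    ∃ (A : FDP.Prog) (T Q : Polynomial ℕ),
      -- over every field, polynomial running time, and no wrong output
      (∀ (K : Type u) [Field K] (n : ℕ), 5 ≤ n →
        ∀ f : Fin n → MvPolynomial (Fin n) K, (∀ i, (f i).IsHomogeneous 4) →
        ∀ ρ : ℕ → K, ∃ (t : ℕ) (τ : FDP.State K),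
          FDP.Exec A (FDP.initState f ρ) t τ ∧ t ≤ T.eval n ∧
          (FDP.Announces τ →
            FDP.IsQuadraticDecomposition f (FDP.outputLeft n τ) (FDP.outputRight n τ))) ∧
      -- characteristic zero: success off a proper algebraic subset of the coefficient space,
      -- for all random choices off a proper algebraic subset
      (∀ (K : Type u) [Field K] [CharZero K] (n : ℕ), 5 ≤ n →
        ∃ D : MvPolynomial (FDP.CoeffIdx n) K, D ≠ 0 ∧
          ∀ v : FDP.CoeffIdx n → K, MvPolynomial.eval v D ≠ 0 →
            ∃ E : MvPolynomial (Fin (T.eval n)) K, E ≠ 0 ∧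
              ∀ r : Fin (T.eval n) → K, MvPolynomial.eval r E ≠ 0 →
                FDP.Succeeds A (FDP.compose (FDP.leftFactor v) (FDP.rightFactor v)) r) ∧
      -- finite fields
      (∀ (K : Type u) [Field K] [Finite K] (n : ℕ), 5 ≤ n →
        1 - ((Q.eval n : ℕ) : ℝ) / (Nat.card K : ℝ) ≤ FDP.successProb K n (T.eval n) A) := by
  -- `Q` is the degree bound of `exists_generic`.
  refine ⟨FDP.program, FDP.runningTime, .X ^ 3 + 3 * .X ^ 2, ?_, ?_, ?_⟩
  · intro K _ n hn f hf ρ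
    obtain ⟨t, ht, h⟩ := FDP.exec_program f ρ
    exact ⟨t, _, h, ht, FDP.main_sound (by omega) hf ρ rfl⟩
  · intro K _ _ n hn
    obtain ⟨D, hD, -, h⟩ := FDP.exists_generic (K := K) (n := n) (by omega)
    -- Generic pairs succeed for every tape, so no random choices have to be excluded and `E = 1`
    -- will do.
    exact ⟨D, hD, fun v hv => ⟨1, one_ne_zero, fun r _ =>
      FDP.succeeds_of_generic (by omega) (h v hv).1 (h v hv).2 r⟩⟩
  · intro K _ _ n hn
    obtain ⟨D, hD, hd, h⟩ := FDP.exists_generic (K := K) (n := n) (by omega)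
    refine le_trans ?_ (FDP.le_successProb hD fun v hv r =>
      FDP.succeeds_of_generic (by omega) (h v hv).1 (h v hv).2 r)
    have : Polynomial.eval n (.X ^ 3 + 3 * .X ^ 2 : Polynomial ℕ) = n ^ 3 + 3 * n ^ 2 := by simp
    rw [this]
    have hd' : (D.totalDegree : ℝ) ≤ ((n ^ 3 + 3 * n ^ 2 : ℕ) : ℝ) := by exact_mod_cast hd
    gcongr
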